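/- Let $n\in\mathbb N$, let $g=(g^{ab})$ be a constant, symmetric, invertible real $n\times n$ matrix, and let $P=g\,\frac{d}{dx}$ be the corresponding Poisson bivector of hydrodynamic type on the space of smooth loops $u:S^1=\mathbb R/\mathbb Z\to\mathbb R^n$. A differential function is a smooth function $f(u,u_x,\dots,u_{k})$ of finitely many derivatives of $u$; vector fields and $1$-forms are $n$-tuples of differential functions, and a bivector is a matrix differential operator $Q=\sum_{k=0}^{N}A_k(u,u_x,\dots)\frac{d^k}{dx^k}$, whose coefficients are matrices of differential functions (no homogeneity is required), with $Q^*=-Q$. A prime denotes the Fréchet derivative with respect to $u$, ${}^*$ the formal adjoint with respect to $\langle v,\beta\rangle=\int_0^1 v\cdot\beta\,dx$, and $L_X(P)=-X'P-P\,X'^*$. The condition $[P,Q]=0$ means that the Schouten bracket vanishes, i.e. that the cyclic sum over $(\alpha,\beta,\gamma)$ of $\langle\alpha,Q_u'(\beta;P\gamma)\rangle$ is zero for all loops $u$ and all smooth $1$-periodic $\alpha,\beta,\gamma$, where $Q'_u(\beta;v)=\frac{d}{ds}Q_{u+sv}\beta|_{s=0}$. Let $C^a=\int_0^1u^a\,dx$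 and $\{F,H\}_Q=\langle\frac{\delta F}{\delta u},Q\frac{\delta H}{\delta u}\rangle$. Let $Q$ be a bivector with $[P,Q]=0$. (i) If $\{C^a,C^b\}_Q=0$ for all $a,b$, then $Q=L_X(P)$ for some vector field $X$. Moreover, there are a matrix $A$ of differential functions and a skewsymmetric matrix differential operator $\Gamma$ with $Q=A^tP+PA+P\Gamma P$; and for every such pair $(A,\Gamma)$ the following formulas define differential functions, respectively operators, and give such an $X$. Put $Z^a=-h^a$ with $h^a(u)=\int_0^1\sum_b A_{ba}(\lambda u,\lambda u_x,\dots)\,u^b\,d\lambda$; there is a matrix differential operator $R$ with $Z'=-A^t+PR$; put $\Omega=\Gamma+R-R^*$ and $\theta(u)=-\int_0^1\Omega_{\lambda u}(\lambda u)\,d\lambda$; then $X=Z+P\theta$ satisfies $Q=L_X(P)$. (ii) If $n=1$, the condition $\{C^a,C^b\}_Q=0$ holds automatically, so every $Q$ with $[P,Q]=0$ is of the form $L_X(P)$. -/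

import Mathlib

open scoped ContDiff Matrix

/-- Points of the loop space of `ℝⁿ` (and also vector fields along a loop and `1`-forms at a loop,
which are identified by the pairing `⟨v, β⟩ = ∫₀¹ v(x) β(x) dx`): smooth maps `ℝ → ℝⁿ` of period
one. -/
def IsLoop {n : ℕ} (u : ℝ → Fin n → ℝ) : Prop :=
  ContDiff ℝ ∞ u ∧ Function.Periodic u 1

/-- A differential function `f(u, u_x, …)`: a smooth function of the first `len` entries
`u, u_x, …, u_{len-1}` of the jet of a loop. -/
structure DiffFun (n : ℕ) where
  len : ℕ
  toFun : (Fin len → Fin n → ℝ) → ℝ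
  smooth : ContDiff ℝ ∞ toFun

namespace DiffFun

variable {n : ℕ}

/-- The value `f(u(x), u_x(x), …)`. -/
noncomputable def eval (f : DiffFun n) (u : ℝ → Fin n → ℝ) (x : ℝ) : ℝ :=
  f.toFun (fun k => iteratedDeriv (k : ℕ) u x)

/-- The partial derivative of `f` with respect to the jet variable `u^c_k`, evaluated along `u`
at `x`. -/
noncomputable def pd (f : DiffFun n) (k : Fin f.len) (c : Fin n) (u : ℝ → Fin n → ℝ) (x : ℝ) : ℝ :=
  fderiv ℝ f.toFun (fun k => iteratedDeriv (k : ℕ) u x) (Pi.single k (Pi.single c 1))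

/-- A constant, as a differential function. -/
def const (r : ℝ) : DiffFun n where
  len := 0
  toFun _ := r
  smooth := contDiff_const

/-- The coordinate `u^a`, as a differential function. -/
def coord (a : Fin n) : DiffFun n where
  len := 1
  toFun j := j 0 a
  smooth := by fun_prop

/-- The variational derivative `δF/δu^c = ∑_k (-d/dx)^k (∂f/∂u^c_k)` of the local functional
`F = ∫ f dx`. -/
noncomputable def euler (f : DiffFun n) (u : ℝ → Fin n → ℝ) (x : ℝ) (c : Fin n) : ℝ :=
  ∑ k : Fin f.len, (-1) ^ (k : ℕ) * iteratedDeriv (k : ℕ) (fun y => f.pd k c u y) x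

end DiffFun

/-- A local vector field `u̇ = X(u, u_x, …)`, or a local `1`-form `θ(u, u_x, …)`. -/
abbrev DiffVec (n : ℕ) := Fin n → DiffFun n

/-- A matrix of differential functions. -/
abbrev DiffMat (n : ℕ) := Matrix (Fin n) (Fin n) (DiffFun n)

namespace DiffVec

variable {n : ℕ}

/-- The value of `X` along the loop `u`. -/
noncomputable def eval (X : DiffVec n) (u : ℝ → Fin n → ℝ) (x : ℝ) : Fin n → ℝ :=
  fun a => (X a).eval u x

/-- The Fréchet derivative `X'_u v = d/ds X(u + s v)` at `s = 0`. -/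
noncomputable def frechet (X : DiffVec n) (u v : ℝ → Fin n → ℝ) (x : ℝ) : Fin n → ℝ :=
  deriv (fun s : ℝ => DiffVec.eval X (u + s • v) x) 0

/-- The formal adjoint of the Fréchet derivative:
`(X'_u^* β)_c = ∑_{k, a} (-d/dx)^k (∂X^a/∂u^c_k · β_a)`. -/
noncomputable def frechetAdj (X : DiffVec n) (u β : ℝ → Fin n → ℝ) (x : ℝ) : Fin n → ℝ :=
  fun c => ∑ a : Fin n, ∑ k : Fin (X a).len,
    (-1) ^ (k : ℕ) * iteratedDeriv (k : ℕ) (fun y => (X a).pd k c u y * β y a) x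

end DiffVec

/-- The matrix of values of a matrix of differential functions. -/
noncomputable def DiffMat.eval {n : ℕ} (A : DiffMat n) (u : ℝ → Fin n → ℝ) (x : ℝ) :
    Matrix (Fin n) (Fin n) ℝ :=
  Matrix.of fun a b => (A a b).eval u x

/-- A matrix differential operator `∑_{k < len} A_k(u, u_x, …) (d/dx)^k`. -/
structure DiffOp (n : ℕ) where
  len : ℕ
  coeff : Fin len → DiffMat n

namespace DiffOp

variable {n : ℕ}

/-- The value `Q_u α` of the operator on `α`, at the loop `u`. -/
noncomputable def app (Q : DiffOp n) (u α : ℝ → Fin n → ℝ) (x : ℝ) : Fin n → ℝ :=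
  ∑ k : Fin Q.len, DiffMat.eval (Q.coeff k) u x *ᵥ iteratedDeriv (k : ℕ) α x

/-- The formal adjoint `Q_u^* β = ∑_k (-d/dx)^k (A_kᵗ β)`. -/
noncomputable def adj (Q : DiffOp n) (u β : ℝ → Fin n → ℝ) (x : ℝ) : Fin n → ℝ :=
  ∑ k : Fin Q.len, (-1 : ℝ) ^ (k : ℕ) •
    iteratedDeriv (k : ℕ) (fun y => (DiffMat.eval (Q.coeff k) u y)ᵀ *ᵥ β y) x

/-- `Q^* = -Q`. A (local) bivector on the loop space is a differential operator with this
property. -/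
def IsSkew (Q : DiffOp n) : Prop :=
  ∀ u β : ℝ → Fin n → ℝ, IsLoop u → IsLoop β → ∀ x, Q.adj u β x = -Q.app u β x

/-- The derivative `Q'_u(α; v) = d/ds Q_{u + s v} α` at `s = 0`. -/
noncomputable def frechet (Q : DiffOp n) (u α v : ℝ → Fin n → ℝ) (x : ℝ) : Fin n → ℝ :=
  deriv (fun s : ℝ => Q.app (u + s • v) α x) 0

/-- The bivector of hydrodynamic type `g^{ab} d/dx` with constant coefficients. -/
def hydro (g : Matrix (Fin n) (Fin n) ℝ) : DiffOp n where
  len := 2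
  coeff k := if k = 1 then g.map DiffFun.const else Matrix.of fun _ _ => DiffFun.const 0

end DiffOp

/-- The pairing `⟨v, β⟩ = ∫₀¹ v(x) β(x) dx` of vector fields and `1`-forms. -/
noncomputable def pairing {n : ℕ} (v β : ℝ → Fin n → ℝ) : ℝ :=
  ∫ x in (0 : ℝ)..1, v x ⬝ᵥ β x

/-- The Schouten bracket of two bivectors, as a trilinear form on `1`-forms: half the cyclic sum
of `⟨α, P'(β; Q γ)⟩ + ⟨α, Q'(β; P γ)⟩`. -/
noncomputable def schouten {n : ℕ} (P Q : DiffOp n) (u α β γ : ℝ → Fin n → ℝ) : ℝ :=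
  (1 / 2) *
    (pairing α (P.frechet u β (Q.app u γ)) + pairing α (Q.frechet u β (P.app u γ)) +
     pairing β (P.frechet u γ (Q.app u α)) + pairing β (Q.frechet u γ (P.app u α)) +
     pairing γ (P.frechet u α (Q.app u β)) + pairing γ (Q.frechet u α (P.app u β)))

/-- The cocycle condition `[P, Q] = 0`. -/
def IsCocycle {n : ℕ} (P Q : DiffOp n) : Prop :=
  ∀ u α β γ : ℝ → Fin n → ℝ, IsLoop u → IsLoop α → IsLoop β → IsLoop γ →
    schouten P Q u α β γ = 0

/-- The bracket `{F, H}_Q = ⟨δF/δu, Q δH/δu⟩` of the local functionals with densities `f`, `h`,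
at the loop `u`. -/
noncomputable def functionalBracket {n : ℕ} (Q : DiffOp n) (f h : DiffFun n)
    (u : ℝ → Fin n → ℝ) : ℝ :=
  pairing (f.euler u) (Q.app u (h.euler u))

/-- `{C^a, C^b}_Q = 0` for the functionals `C^a = ∫₀¹ u^a dx`. -/
def CasimirsCommute {n : ℕ} (Q : DiffOp n) : Prop :=
  ∀ a b : Fin n, ∀ u : ℝ → Fin n → ℝ, IsLoop u →
    functionalBracket Q (DiffFun.coord a) (DiffFun.coord b) u = 0

/-- The Lie derivative of a bivector along a vector field, in operator form:
`L_X(Q) α = Q'(α; X) - X' Q α - Q X'^* α`. -/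
noncomputable def lieDeriv {n : ℕ} (X : DiffVec n) (Q : DiffOp n) (u α : ℝ → Fin n → ℝ) (x : ℝ) :
    Fin n → ℝ :=
  Q.frechet u α (DiffVec.eval X u) x - DiffVec.frechet X u (Q.app u α) x
    - Q.app u (DiffVec.frechetAdj X u α) x

/-- `Q = L_X(P)`. -/
def IsPotential {n : ℕ} (P Q : DiffOp n) (X : DiffVec n) : Prop :=
  ∀ u α : ℝ → Fin n → ℝ, IsLoop u → IsLoop α → ∀ x, Q.app u α x = lieDeriv X P u α x

/-- `Q = Aᵗ P + P A + P Γ P` with `Γ` skewsymmetric. -/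
def IsRepresentation {n : ℕ} (P Q : DiffOp n) (A : DiffMat n) (Γ : DiffOp n) : Prop :=
  Γ.IsSkew ∧ ∀ u α : ℝ → Fin n → ℝ, IsLoop u → IsLoop α → ∀ x,
    Q.app u α x = (DiffMat.eval A u x)ᵀ *ᵥ P.app u α x
      + P.app u (fun y => DiffMat.eval A u y *ᵥ α y) x
      + P.app u (Γ.app u (P.app u α)) x

/-- `Z = -h^a Z_a` with `h^a(u) = ∫₀¹ ∑_b A_{ba}(λu) u^b dλ`, where `Z_a` is the vector field
`u̇^b = δ^b_a`. -/
def IsTransversalField {n : ℕ} (A : DiffMat n) (Z : DiffVec n) : Prop :=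
  ∀ u : ℝ → Fin n → ℝ, IsLoop u → ∀ x a,
    DiffVec.eval Z u x a = -∫ l in (0 : ℝ)..1, ∑ b, (A b a).eval (l • u) x * u x b

/-- `Z' = -Aᵗ + P R`. -/
def IsRemainder {n : ℕ} (P : DiffOp n) (A : DiffMat n) (Z : DiffVec n) (R : DiffOp n) : Prop :=
  ∀ u φ : ℝ → Fin n → ℝ, IsLoop u → IsLoop φ → ∀ x,
    DiffVec.frechet Z u φ x = -((DiffMat.eval A u x)ᵀ *ᵥ φ x) + P.app u (R.app u φ) x

/-- `θ(u) = -∫₀¹ Ω_{λu}(λu) dλ` with `Ω = Γ + R - R^*`. -/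
def IsHomotopyForm {n : ℕ} (Γ R : DiffOp n) (θ : DiffVec n) : Prop :=
  ∀ u : ℝ → Fin n → ℝ, IsLoop u → ∀ x,
    DiffVec.eval θ u x = -∫ l in (0 : ℝ)..1,
      (Γ.app (l • u) (l • u) x + R.app (l • u) (l • u) x - R.adj (l • u) (l • u) x)

/-! If P were invertible, [P,Q] = 0 would say that the 2-form P⁻¹QP⁻¹ is closed, and the Poincaré
lemma would give Q = L_X(P). But P = g∂ kills constant loops, and its image consists of the
derivatives of loops. The proof splits off the part of Q that feels this defect.

Since δC^a/δu is a constant covector e_a, commutation of the C^a says that every component of Q e_b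
integrates to zero. Hence Q e_b is a total derivative (`IsDiffVec.exists_primitive`), and dividing
by ∂ on both sides gives Q = ∂B + Bᵗ∂ + C∂ + ∂S∂. Skewness forces C to be a constant symmetric
matrix and S to be skew (`DiffOp.IsSkew.decomposition_symm`). With A = g⁻¹(B + C/2) and Γ = g⁻¹Sg⁻¹
this becomes Q = AᵗP + PA + PΓP (`exists_isRepresentation`).

Inserting a constant e as one argument of the cocycle condition isolates A: the 1-form Ae is closed
(`IsRepresentation.closed`). So the columns of A are variational derivatives, with densities h^a
obtained by integrating along λu. For Z = -h this gives Z' = -Aᵗ + PR (`exists_isTransversalField`),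
whence L_Z(P) = AᵗP + PA - P(R - R^*)P and Q - L_Z(P) = PΩP with Ω = Γ + R - R^*. Second Fréchet
derivatives commute, so Z drops out of the cocycle condition, which then says that Ω is closed
(`IsRepresentation.cyclic_sum`). The radial homotopy produces θ with θ' - θ'^* = -Ω
(`DiffOp.IsSkew.exists_homotopyForm`), that is, L_{Pθ}(P) = PΩP.

The cocycle condition only ever tests arguments in the image of P, hence of mean zero. The passage
to arbitrary loops is a locality argument: the mean of one argument can be removed by a bump placed
where the other argument vanishes (`local_biadditive_eq_zero`). Identities between operators are
proved weakly, through the nondegenerate pairing. -/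

/-! ### Integrals over the unit interval depending on parameters. -/

section ParametricIntegrals

variable {E F : Type} [NormedAddCommGroup E] [NormedSpace ℝ E] [NormedAddCommGroup F]
  [NormedSpace ℝ F]

/-- Differentiation under the integral sign over `[0, 1]`, for a `C¹` integrand. -/
theorem hasFDerivAt_integral_unitInterval [FiniteDimensional ℝ E] [CompleteSpace F]
    {f : E × ℝ → F} (hf : ContDiff ℝ 1 f) (x : E) :
    HasFDerivAt (fun y => ∫ l in (0 : ℝ)..1, f (y, l))
      (∫ l in (0 : ℝ)..1, (fderiv ℝ f (x, l)).comp (ContinuousLinearMap.inl ℝ E ℝ)) x := by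
  have hc : Continuous fun p : E × ℝ =>
      (fderiv ℝ f p).comp (ContinuousLinearMap.inl ℝ E ℝ) :=
    (hf.continuous_fderiv one_ne_zero).clm_comp continuous_const
  have : ProperSpace E := FiniteDimensional.proper ℝ E
  -- The constant dominating function: the derivative is continuous, hence bounded on the compact
  -- set ball × [0, 1].
  obtain ⟨C, hC⟩ := ((isCompact_closedBall x 1).prod (isCompact_Icc (a := (0 : ℝ)) (b := 1))
    ).exists_bound_of_continuousOn hc.continuousOn
  refine (intervalIntegral.hasFDerivAt_integral_of_dominated_of_fderiv_le
    (F := fun y l => f (y, l))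
    (F' := fun y l => (fderiv ℝ f (y, l)).comp (ContinuousLinearMap.inl ℝ E ℝ))
    (bound := fun _ => C) (s := Metric.closedBall x 1)
    (Metric.closedBall_mem_nhds x one_pos) ?_ ?_ ?_ ?_ ?_ ?_)
  · exact .of_forall fun y => (hf.continuous.comp (by fun_prop)).aestronglyMeasurable
  · exact (hf.continuous.comp (by fun_prop)).intervalIntegrable _ _
  · exact (hc.comp (by fun_prop : Continuous fun l : ℝ => (x, l))).aestronglyMeasurable
  · refine .of_forall fun l hl y hy => hC (y, l) ⟨hy, ?_⟩
    rw [Set.uIoc_of_le zero_le_one] at hl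
    exact Set.Ioc_subset_Icc_self hl
  · simp
  · refine .of_forall fun l _ y _ => ?_
    have h := (hf.differentiable one_ne_zero (y, l)).hasFDerivAt
    exact h.comp y (hasFDerivAt_prodMk_left y l)

/-- The derivative of the integral is again such an integral, but with values in a space of linear
maps; the induction therefore has to run over all target spaces at once. -/
theorem contDiff_nat_integral_unitInterval [FiniteDimensional ℝ E] (m : ℕ) :
    ∀ {F : Type} [NormedAddCommGroup F] [NormedSpace ℝ F] [CompleteSpace F] {f : E × ℝ → F},
    ContDiff ℝ ∞ f → ContDiff ℝ m (fun y => ∫ l in (0 : ℝ)..1, f (y, l)) := by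
  induction m with
  | zero =>
    intro F _ _ _ f hf
    rw [Nat.cast_zero, contDiff_zero]
    exact intervalIntegral.continuous_parametric_intervalIntegral_of_continuous'
      (f := fun y l => f (y, l)) hf.continuous 0 1
  | succ m ih =>
    intro F _ _ _ f hf
    have hd := hasFDerivAt_integral_unitInterval (hf.of_le (by exact_mod_cast le_top))
    rw [Nat.cast_succ, contDiff_succ_iff_fderiv]
    refine ⟨fun x => (hd x).differentiableAt, by simp, ?_⟩
    rw [show fderiv ℝ (fun y => ∫ l in (0 : ℝ)..1, f (y, l)) = _ from
      funext fun x => (hd x).fderiv]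
    exact ih (f := fun p => (fderiv ℝ f p).comp (ContinuousLinearMap.inl ℝ E ℝ))
      ((hf.fderiv_right (m := ∞) (by simp)).clm_comp contDiff_const)

/-- The integral over `[0, 1]` of a smooth function is smooth in the parameters. -/
theorem contDiff_integral_unitInterval [FiniteDimensional ℝ E] [CompleteSpace F]
    {f : E × ℝ → F} (hf : ContDiff ℝ ∞ f) :
    ContDiff ℝ ∞ (fun y => ∫ l in (0 : ℝ)..1, f (y, l)) :=
  contDiff_infty.2 fun m => contDiff_nat_integral_unitInterval m hf

theorem hasDerivAt_integral_unitInterval [CompleteSpace F] {G : ℝ × ℝ → F}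
    (hG : ContDiff ℝ 1 G) (s : ℝ) :
    HasDerivAt (fun s => ∫ l in (0 : ℝ)..1, G (s, l))
      (∫ l in (0 : ℝ)..1, deriv (fun s => G (s, l)) s) s := by
  have h := (hasFDerivAt_integral_unitInterval hG s).hasDerivAt
  have hc : Continuous fun l : ℝ =>
      (fderiv ℝ G (s, l)).comp (ContinuousLinearMap.inl ℝ ℝ ℝ) :=
    ((hG.continuous_fderiv one_ne_zero).comp (by fun_prop)).clm_comp continuous_const
  rw [ContinuousLinearMap.intervalIntegral_apply (hc.intervalIntegrable _ _)] at h
  convert h using 3 with l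
  have h1 := HasFDerivAt.comp (f := fun e : ℝ => (e, l)) s
    ((hG.differentiable one_ne_zero (s, l)).hasFDerivAt) (hasFDerivAt_prodMk_left s l)
  exact h1.hasDerivAt.deriv

/-- Fubini on the unit square, for a continuous integrand. -/
theorem integral_unitInterval_swap [CompleteSpace F] {G : ℝ × ℝ → F} (hG : Continuous G) :
    ∫ x in (0 : ℝ)..1, ∫ l in (0 : ℝ)..1, G (x, l) =
      ∫ l in (0 : ℝ)..1, ∫ x in (0 : ℝ)..1, G (x, l) := by
  simp only [intervalIntegral.integral_of_le zero_le_one]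
  refine MeasureTheory.integral_integral_swap (f := fun x l => G (x, l)) ?_
  rw [MeasureTheory.Measure.prod_restrict]
  exact (hG.continuousOn.integrableOn_compact (isCompact_Icc.prod isCompact_Icc)).mono_set
    (Set.prod_mono Set.Ioc_subset_Icc_self Set.Ioc_subset_Icc_self)

end ParametricIntegrals

/-! ### Loops: closure properties. -/

section Loops

open Filter Topology

variable {n : ℕ} {E : Type} [NormedAddCommGroup E] [NormedSpace ℝ E]

theorem Function.Periodic.iteratedDeriv {f : ℝ → E} {c : ℝ} (hf : Function.Periodic f c) (k : ℕ) :
    Function.Periodic (iteratedDeriv k f) c := by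
  intro x
  have h := congrFun (iteratedDeriv_comp_add_const k f c) x
  rw [show (fun z => f (z + c)) = f from funext hf] at h
  exact h.symm

theorem ContDiff.iteratedDeriv_infty {f : ℝ → E} (hf : ContDiff ℝ ∞ f) (k : ℕ) :
    ContDiff ℝ ∞ (iteratedDeriv k f) := by
  induction k with
  | zero => simpa using hf
  | succ k ih =>
    rw [iteratedDeriv_succ]
    exact (contDiff_infty_iff_deriv.1 ih).2

namespace IsLoop

variable {u v w : ℝ → Fin n → ℝ}

theorem contDiff (hu : IsLoop u) : ContDiff ℝ ∞ u := hu.1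

theorem continuous (hu : IsLoop u) : Continuous u := hu.1.continuous

theorem differentiableAt (hu : IsLoop u) (x : ℝ) : DifferentiableAt ℝ u x :=
  hu.1.differentiable (by simp) x

theorem periodic (hu : IsLoop u) : Function.Periodic u 1 := hu.2

theorem add (hu : IsLoop u) (hv : IsLoop v) : IsLoop (u + v) :=
  ⟨hu.1.add hv.1, hu.2.add hv.2⟩

theorem sub (hu : IsLoop u) (hv : IsLoop v) : IsLoop (u - v) :=
  ⟨hu.1.sub hv.1, hu.2.sub hv.2⟩

theorem neg (hu : IsLoop u) : IsLoop (-u) :=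
  ⟨hu.1.neg, fun x => by simp [hu.2 x]⟩

theorem smul (c : ℝ) (hu : IsLoop u) : IsLoop (c • u) :=
  ⟨hu.1.const_smul c, fun x => by simp [hu.2 x]⟩

theorem const (c : Fin n → ℝ) : IsLoop (fun _ => c) :=
  ⟨contDiff_const, fun _ => rfl⟩

theorem zero : IsLoop (0 : ℝ → Fin n → ℝ) := const 0

theorem iteratedDeriv (hu : IsLoop u) (k : ℕ) : IsLoop (iteratedDeriv k u) :=
  ⟨hu.1.iteratedDeriv_infty k, hu.2.iteratedDeriv k⟩

theorem deriv (hu : IsLoop u) : IsLoop (deriv u) := by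
  simpa using hu.iteratedDeriv 1

theorem mulVec (M : Matrix (Fin n) (Fin n) ℝ) (hu : IsLoop u) : IsLoop (fun x => M *ᵥ u x) :=
  ⟨(M.mulVecLin.toContinuousLinearMap.contDiff).comp hu.1, fun x => by simp [hu.2 x]⟩

theorem smul_fun {f : ℝ → ℝ} (hf : ContDiff ℝ ∞ f) (hp : Function.Periodic f 1) (hu : IsLoop u) :
    IsLoop (fun x => f x • u x) :=
  ⟨hf.smul hu.1, fun x => by simp [hp x, hu.2 x]⟩

theorem of_components (h : ∀ a, ContDiff ℝ ∞ (fun x => u x a) ∧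
    Function.Periodic (fun x => u x a) 1) : IsLoop u :=
  ⟨contDiff_pi.2 fun a => (h a).1, fun x => funext fun a => (h a).2 x⟩

theorem component (hu : IsLoop u) (a : Fin n) :
    ContDiff ℝ ∞ (fun x => u x a) ∧ Function.Periodic (fun x => u x a) 1 :=
  ⟨contDiff_pi.1 hu.1 a, fun x => congrFun (hu.2 x) a⟩

end IsLoop

/-! ### The pairing: integration by parts and nondegeneracy. -/

section Pairing

variable {u v w : ℝ → Fin n → ℝ}

theorem continuous_dotProduct (hu : Continuous u) (hv : Continuous v) :
    Continuous fun x => u x ⬝ᵥ v x := by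
  unfold dotProduct
  fun_prop

theorem pairing_comm (u v : ℝ → Fin n → ℝ) : pairing u v = pairing v u := by
  simp only [pairing, dotProduct_comm]

theorem pairing_add_right (hu : Continuous u) (hv : Continuous v) (hw : Continuous w) :
    pairing u (v + w) = pairing u v + pairing u w := by
  simp only [pairing, Pi.add_apply, dotProduct_add]
  exact intervalIntegral.integral_add ((continuous_dotProduct hu hv).intervalIntegrable _ _)
    ((continuous_dotProduct hu hw).intervalIntegrable _ _)

theorem pairing_add_left (hu : Continuous u) (hv : Continuous v) (hw : Continuous w) :
    pairing (u + v) w = pairing u w + pairing v w := by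
  rw [pairing_comm, pairing_add_right hw hu hv, pairing_comm w u, pairing_comm w v]

theorem pairing_smul_right (c : ℝ) (u v : ℝ → Fin n → ℝ) :
    pairing u (c • v) = c * pairing u v := by
  simp [pairing, dotProduct_smul, intervalIntegral.integral_const_mul]

theorem pairing_neg_right (u v : ℝ → Fin n → ℝ) : pairing u (-v) = -pairing u v := by
  simp [pairing, dotProduct_neg]

theorem pairing_sub_right (hu : Continuous u) (hv : Continuous v) (hw : Continuous w) :
    pairing u (v - w) = pairing u v - pairing u w := by
  rw [sub_eq_add_neg, pairing_add_right hu hv hw.neg, pairing_neg_right, sub_eq_add_neg]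

theorem pairing_mulVec (M : ℝ → Matrix (Fin n) (Fin n) ℝ) (u v : ℝ → Fin n → ℝ) :
    pairing u (fun x => M x *ᵥ v x) = pairing (fun x => (M x)ᵀ *ᵥ u x) v := by
  simp only [pairing, Matrix.dotProduct_mulVec, Matrix.mulVec_transpose]

theorem pairing_eq_zero_of_disjoint (h : ∀ x, u x = 0 ∨ v x = 0) : pairing u v = 0 := by
  have : (fun x => u x ⬝ᵥ v x) = fun _ => 0 := by
    funext x
    rcases h x with h | h <;> simp [h]
  simp [pairing, this]

/-- Integration by parts on the circle. -/
theorem pairing_deriv_right (hu : IsLoop u) (hv : IsLoop v) :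
    pairing u (deriv v) = -pairing (deriv u) v := by
  have hd : ∀ x, HasDerivAt (fun x => u x ⬝ᵥ v x) (deriv u x ⬝ᵥ v x + u x ⬝ᵥ deriv v x) x := by
    intro x
    have h1 := hasDerivAt_pi.1 (hu.differentiableAt x).hasDerivAt
    have h2 := hasDerivAt_pi.1 (hv.differentiableAt x).hasDerivAt
    simp only [dotProduct, ← Finset.sum_add_distrib]
    exact HasDerivAt.fun_sum fun i _ => (h1 i).mul (h2 i)
  have hc1 := continuous_dotProduct hu.deriv.continuous hv.continuous
  have hc2 := continuous_dotProduct hu.continuous hv.deriv.continuous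
  have h := intervalIntegral.integral_eq_sub_of_hasDerivAt (a := 0) (b := 1) (fun x _ => hd x)
    ((hc1.add hc2).intervalIntegrable _ _)
  have hu1 : u 1 = u 0 := by simpa using hu.2 0
  have hv1 : v 1 = v 0 := by simpa using hv.2 0
  rw [hu1, hv1, sub_self, intervalIntegral.integral_add (hc1.intervalIntegrable _ _)
    (hc2.intervalIntegrable _ _)] at h
  simp only [pairing]
  linarith

theorem pairing_iteratedDeriv_right (k : ℕ) : ∀ {u v : ℝ → Fin n → ℝ}, IsLoop u → IsLoop v →
    pairing u (iteratedDeriv k v) = (-1) ^ k * pairing (iteratedDeriv k u) v := by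
  induction k with
  | zero => intro u v _ _; simp
  | succ k ih =>
    intro u v hu hv
    rw [iteratedDeriv_succ, pairing_deriv_right hu (hv.iteratedDeriv k), ih hu.deriv hv,
      iteratedDeriv_succ']
    ring

/-- The pairing of loops is nondegenerate. -/
theorem eq_zero_of_pairing_eq_zero (hv : IsLoop v) (h : ∀ β, IsLoop β → pairing β v = 0) (x : ℝ) :
    v x = 0 := by
  by_contra hx
  obtain ⟨y, hy, hxy⟩ := hv.2.exists_mem_Ico₀ one_pos x
  rw [hxy] at hx
  -- Testing `v` against itself; periodicity has moved the point of nonvanishing into the interval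
  -- of integration.
  have hpos : 0 < ∫ x in (0 : ℝ)..1, v x ⬝ᵥ v x := by
    refine intervalIntegral.integral_pos one_pos
      (continuous_dotProduct hv.continuous hv.continuous).continuousOn
      (fun x _ => Finset.sum_nonneg fun i _ => mul_self_nonneg _) ⟨y, Set.Ico_subset_Icc_self hy, ?_⟩
    refine lt_of_le_of_ne (Finset.sum_nonneg fun i _ => mul_self_nonneg _) fun h0 => hx ?_
    exact dotProduct_self_eq_zero.1 h0.symm
  exact hpos.ne' (h v hv)

theorem eq_of_pairing_eq (hv : IsLoop v) (hw : IsLoop w)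
    (h : ∀ β, IsLoop β → pairing β v = pairing β w) (x : ℝ) : v x = w x := by
  have := eq_zero_of_pairing_eq_zero (hv.sub hw) (fun β hβ => by
    rw [pairing_sub_right hβ.continuous hv.continuous hw.continuous, h β hβ, sub_self]) x
  exact sub_eq_zero.1 this

end Pairing

/-! ### Cutoffs and the locality principle. -/

section Localization

/-- A loop of mean zero is the derivative of a loop. -/
theorem exists_deriv_eq_of_integral_eq_zero {b : ℝ → Fin n → ℝ} (hb : IsLoop b)
    (h0 : ∫ x in (0 : ℝ)..1, b x = 0) : ∃ c, IsLoop c ∧ deriv c = b := by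
  have hd : ∀ x, HasDerivAt (fun x => ∫ y in (0 : ℝ)..x, b y) (b x) x := fun x =>
    (hb.continuous.integral_hasStrictDerivAt 0 x).hasDerivAt
  have hd' : deriv (fun x => ∫ y in (0 : ℝ)..x, b y) = b := funext fun x => (hd x).deriv
  refine ⟨fun x => ∫ y in (0 : ℝ)..x, b y, ⟨?_, fun x => ?_⟩, hd'⟩
  · rw [contDiff_infty_iff_deriv, hd']
    exact ⟨fun x => (hd x).differentiableAt, hb.1⟩
  -- The primitive is periodic because its increment over one period is the mean of `b`.
  · have h1 := hb.2.intervalIntegral_add_eq 0 x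
    simp only [zero_add, h0] at h1
    have h2 := intervalIntegral.integral_add_adjacent_intervals
      (hb.continuous.intervalIntegrable (μ := MeasureTheory.volume) 0 x)
      (hb.continuous.intervalIntegrable x (x + 1))
    rw [← h1, add_zero] at h2
    exact h2.symm

/-- A smooth one-periodic function, equal to `1` where `cos (2 π x)` is at least `1 - c` and to `0`
where it is at most `-c`. -/
noncomputable def cosCutoff (c x : ℝ) : ℝ := Real.smoothTransition (Real.cos (2 * Real.pi * x) + c)

theorem cosCutoff_contDiff (c : ℝ) : ContDiff ℝ ∞ (cosCutoff c) :=
  Real.smoothTransition.contDiff.comp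
    ((Real.contDiff_cos.comp (contDiff_const.mul contDiff_id)).add contDiff_const)

theorem cosCutoff_periodic (c : ℝ) : Function.Periodic (cosCutoff c) 1 := by
  intro x
  simp only [cosCutoff, mul_add, mul_one, Real.cos_add_two_pi]

theorem cosCutoff_eventually_zero {c x : ℝ} (h : Real.cos (2 * Real.pi * x) < -c) :
    ∀ᶠ y in 𝓝 x, cosCutoff c y = 0 := by
  have hc : Continuous fun y => Real.cos (2 * Real.pi * y) := by fun_prop
  filter_upwards [hc.continuousAt.eventually_lt continuousAt_const h] with y hy
  exact Real.smoothTransition.zero_of_nonpos (by linarith)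

theorem cosCutoff_eventually_one {c x : ℝ} (h : 1 - c < Real.cos (2 * Real.pi * x)) :
    ∀ᶠ y in 𝓝 x, cosCutoff c y = 1 := by
  have hc : Continuous fun y => Real.cos (2 * Real.pi * y) := by fun_prop
  filter_upwards [continuousAt_const.eventually_lt hc.continuousAt h] with y hy
  exact Real.smoothTransition.one_of_one_le (by linarith)

theorem integral_cosCutoff_pos {c : ℝ} (hc : -1 < c) : 0 < ∫ x in (0 : ℝ)..1, cosCutoff c x :=
  intervalIntegral.integral_pos one_pos (cosCutoff_contDiff c).continuous.continuousOn
    (fun x _ => Real.smoothTransition.nonneg _)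
    ⟨0, by simp, Real.smoothTransition.pos_of_pos (by simp; linarith)⟩

/-- The value at `x` of a local functional is determined by loops vanishing near `x + 1/2`. -/
theorem exists_isLoop_eventuallyEq {u : ℝ → Fin n → ℝ} (hu : IsLoop u) (x : ℝ) :
    ∃ w, IsLoop w ∧ w =ᶠ[𝓝 x] u ∧ w =ᶠ[𝓝 (x + 1 / 2)] 0 := by
  have hτ : ∀ y, Tendsto (fun z : ℝ => z - x) (𝓝 y) (𝓝 (y - x)) := fun y =>
    (continuous_id.sub continuous_const).tendsto y
  refine ⟨fun y => cosCutoff 2⁻¹ (y - x) • u y, IsLoop.smul_fun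
    ((cosCutoff_contDiff _).comp (contDiff_id.sub contDiff_const)) (fun y => ?_) hu, ?_, ?_⟩
  · rw [← cosCutoff_periodic 2⁻¹ (y - x)]
    ring_nf
  · filter_upwards [(hτ x).eventually (cosCutoff_eventually_one (c := 2⁻¹) (by norm_num))]
      with y hy
    simp [hy]
  · have : Real.cos (2 * Real.pi * (x + 1 / 2 - x)) < -2⁻¹ := by
      rw [show 2 * Real.pi * (x + 1 / 2 - x) = Real.pi by ring, Real.cos_pi]
      norm_num
    filter_upwards [(hτ (x + 1 / 2)).eventually (cosCutoff_eventually_zero this)] with y hy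
    simp [hy]

/-- A local biadditive form on loops which vanishes on derivatives in the second argument
vanishes. -/
theorem local_biadditive_eq_zero (T : (ℝ → Fin n → ℝ) → (ℝ → Fin n → ℝ) → ℝ)
    (add_left : ∀ a b c, IsLoop a → IsLoop b → IsLoop c → T (a + b) c = T a c + T b c)
    (add_right : ∀ a b c, IsLoop a → IsLoop b → IsLoop c → T a (b + c) = T a b + T a c)
    (loc : ∀ a b, IsLoop a → IsLoop b → (∀ x, a =ᶠ[𝓝 x] 0 ∨ b =ᶠ[𝓝 x] 0) → T a b = 0)
    (h : ∀ a b, IsLoop a → IsLoop b → T a (deriv b) = 0) (a b : ℝ → Fin n → ℝ) (ha : IsLoop a)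
    (hb : IsLoop b) : T a b = 0 := by
  -- If a bump `ρ` has support disjoint from that of `a`, subtracting a multiple of `ρ` from `b`
  -- makes its mean zero, hence makes it a derivative, at no cost in `T a b`.
  have key : ∀ (a : ℝ → Fin n → ℝ) (ρ : ℝ → ℝ), IsLoop a → ContDiff ℝ ∞ ρ →
      Function.Periodic ρ 1 → (0 < ∫ x in (0 : ℝ)..1, ρ x) →
      (∀ x, a =ᶠ[𝓝 x] 0 ∨ ρ =ᶠ[𝓝 x] 0) → T a b = 0 := by
    intro a ρ ha hρ hρp hpos hdis
    set m : Fin n → ℝ := (∫ x in (0 : ℝ)..1, ρ x)⁻¹ • ∫ x in (0 : ℝ)..1, b x with hm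
    have hr : IsLoop (fun x => ρ x • m) := IsLoop.smul_fun hρ hρp (IsLoop.const m)
    obtain ⟨c, hc, hcb⟩ := exists_deriv_eq_of_integral_eq_zero (hb.sub hr) (by
      simp only [Pi.sub_apply]
      rw [intervalIntegral.integral_sub (hb.continuous.intervalIntegrable _ _)
        (hr.continuous.intervalIntegrable _ _), intervalIntegral.integral_smul_const, hm,
        smul_inv_smul₀ hpos.ne', sub_self])
    rw [show b = deriv c + fun x => ρ x • m by rw [hcb, sub_add_cancel],
      add_right _ _ _ ha hc.deriv hr, h a c ha hc, zero_add]
    refine loc _ _ ha hr fun x => (hdis x).imp id fun hx => ?_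
    filter_upwards [hx] with y hy
    simp [hy]
  -- A general `a` is cut into two pieces, each leaving room for a bump: `χ a` vanishes where
  -- cos(2πx) ≤ -1/2, and `(1 - χ) a` where cos(2πx) ≥ 1/2.
  have hχ := cosCutoff_contDiff 2⁻¹
  have hχp := cosCutoff_periodic 2⁻¹
  have h1 : IsLoop (fun x => cosCutoff 2⁻¹ x • a x) := IsLoop.smul_fun hχ hχp ha
  have h2 : IsLoop (fun x => (1 - cosCutoff 2⁻¹ x) • a x) :=
    IsLoop.smul_fun (contDiff_const.sub hχ) (fun x => by simp [hχp x]) ha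
  rw [show a = (fun x => cosCutoff 2⁻¹ x • a x) + fun x => (1 - cosCutoff 2⁻¹ x) • a x by
    funext x; simp [← add_smul], add_left _ _ _ h1 h2 hb]
  have hshift : ∀ x, Real.cos (2 * Real.pi * (x + 1 / 2)) = -Real.cos (2 * Real.pi * x) :=
    fun x => by rw [← Real.cos_add_pi]; ring_nf
  -- The bumps live where cos(2πx) < -3/4 and where cos(2πx) > 3/4; the gap between 1/2 and 3/4
  -- makes disjointness hold on neighbourhoods.
  rw [key _ (fun x => cosCutoff (-3 / 4) (x + 1 / 2)) h1
      ((cosCutoff_contDiff _).comp (contDiff_id.add contDiff_const))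
      (fun x => by
        simp only [add_right_comm x 1]
        exact cosCutoff_periodic _ _) ?_ ?_,
    key _ (cosCutoff (-3 / 4)) h2 (cosCutoff_contDiff _) (cosCutoff_periodic _)
      (integral_cosCutoff_pos (by norm_num)) ?_, add_zero]
  · intro x
    rcases lt_or_ge (Real.cos (2 * Real.pi * x)) (3 / 4) with hx | hx
    · exact .inr (cosCutoff_eventually_zero (by linarith))
    · left
      filter_upwards [cosCutoff_eventually_one (c := 2⁻¹) (x := x) (by linarith)] with y hy
      simp [hy]
  · have h3 := (cosCutoff_periodic (-3 / 4)).intervalIntegral_add_eq 0 (1 / 2)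
    rw [intervalIntegral.integral_comp_add_right (fun x => cosCutoff (-3 / 4) x),
      show (1 : ℝ) + 1 / 2 = 1 / 2 + 1 by ring, zero_add, ← h3, zero_add]
    exact integral_cosCutoff_pos (by norm_num)
  · intro x
    rcases lt_or_ge (-3 / 4) (Real.cos (2 * Real.pi * x)) with hx | hx
    · right
      have ht : Tendsto (fun z : ℝ => z + 1 / 2) (𝓝 x) (𝓝 (x + 1 / 2)) :=
        (continuous_id.add continuous_const).tendsto x
      exact ht.eventually (cosCutoff_eventually_zero (by rw [hshift]; linarith))
    · left
      filter_upwards [cosCutoff_eventually_zero (c := 2⁻¹) (x := x) (by linarith)] with y hy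
      simp [hy]

end Localization

end Loops

/-! ### The calculus of differential functions and linear differential operators. -/

section DifferentialFunctions

variable {n : ℕ}

/-- The first `N` entries `u, u_x, …, u_{N-1}` of the jet of `u` at `x`. -/
noncomputable def jet (N : ℕ) (u : ℝ → Fin n → ℝ) (x : ℝ) : Fin N → Fin n → ℝ :=
  fun k => iteratedDeriv k u x

theorem jet_add_smul_add_smul {N : ℕ} {u v w : ℝ → Fin n → ℝ} (hu : IsLoop u) (hv : IsLoop v)
    (hw : IsLoop w) (s t x : ℝ) :
    jet N (u + s • v + t • w) x = jet N u x + s • jet N v x + t • jet N w x := by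
  funext k
  have h : ∀ {f : ℝ → Fin n → ℝ}, IsLoop f → ContDiffAt ℝ (k : ℕ) f x := fun hf =>
    (hf.contDiff.of_le (by exact_mod_cast le_top)).contDiffAt
  simp only [jet, Pi.add_apply, Pi.smul_apply]
  rw [iteratedDeriv_add (h (hu.add (hv.smul s))) (h (hw.smul t)),
    iteratedDeriv_add (h hu) (h (hv.smul s)), iteratedDeriv_const_smul_field,
    iteratedDeriv_const_smul_field]

theorem contDiff_jet {N : ℕ} {u : ℝ → Fin n → ℝ} (hu : IsLoop u) : ContDiff ℝ ∞ (jet N u) :=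
  contDiff_pi.2 fun k => (hu.iteratedDeriv k).contDiff

theorem jet_periodic {N : ℕ} {u : ℝ → Fin n → ℝ} (hu : IsLoop u) :
    Function.Periodic (jet N u) 1 :=
  fun x => funext fun k => (hu.iteratedDeriv k).periodic x

theorem jet_congr {N : ℕ} {u v : ℝ → Fin n → ℝ} {x : ℝ} (h : u =ᶠ[nhds x] v) :
    jet N u x = jet N v x :=
  funext fun k => h.iteratedDeriv_eq k

/-- A functional which is given, along loops, by a differential function. -/
def IsDiffFun (F : (ℝ → Fin n → ℝ) → ℝ → ℝ) : Prop :=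
  ∃ f : DiffFun n, ∀ u, IsLoop u → ∀ x, F u x = f.eval u x

/-- The Gateaux derivative `d/ds F(u + s v)` at `s = 0`. -/
noncomputable def gateaux {E : Type} [NormedAddCommGroup E] [NormedSpace ℝ E]
    (F : (ℝ → Fin n → ℝ) → ℝ → E) (u v : ℝ → Fin n → ℝ) (x : ℝ) : E :=
  deriv (fun s : ℝ => F (u + s • v) x) 0

/-- Superfluous jet variables are harmless; this brings two differential functions to a common jet
length. -/
theorem DiffFun.exists_eval_eq (f : DiffFun n) {N : ℕ} (h : f.len ≤ N) :
    ∃ g : (Fin N → Fin n → ℝ) → ℝ, ContDiff ℝ ∞ g ∧ ∀ u x, f.eval u x = g (jet N u x) :=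
  ⟨fun j => f.toFun fun k => j (Fin.castLE h k),
    f.smooth.comp (contDiff_pi.2 fun k => contDiff_apply ℝ (Fin n → ℝ) (Fin.castLE h k)),
    fun _ _ => rfl⟩

namespace IsDiffFun

variable {F G : (ℝ → Fin n → ℝ) → ℝ → ℝ}

theorem of_jet {N : ℕ} {g : (Fin N → Fin n → ℝ) → ℝ} (hg : ContDiff ℝ ∞ g)
    (h : ∀ u, IsLoop u → ∀ x, F u x = g (jet N u x)) : IsDiffFun F :=
  ⟨⟨N, g, hg⟩, h⟩

theorem congr (hF : IsDiffFun F) (h : ∀ u, IsLoop u → ∀ x, G u x = F u x) : IsDiffFun G := by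
  obtain ⟨f, hf⟩ := hF
  exact ⟨f, fun u hu x => (h u hu x).trans (hf u hu x)⟩

theorem eval (f : DiffFun n) : IsDiffFun f.eval := ⟨f, fun _ _ _ => rfl⟩

theorem comp₂ {Φ : ℝ × ℝ → ℝ} (hΦ : ContDiff ℝ ∞ Φ) (hF : IsDiffFun F) (hG : IsDiffFun G) :
    IsDiffFun fun u x => Φ (F u x, G u x) := by
  obtain ⟨f, hf⟩ := hF
  obtain ⟨g, hg⟩ := hG
  obtain ⟨f', hf', hff⟩ := f.exists_eval_eq (le_max_left f.len g.len)
  obtain ⟨g', hg', hgg⟩ := g.exists_eval_eq (le_max_right f.len g.len)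
  exact of_jet (hΦ.comp (hf'.prodMk hg')) fun u hu x => by
    simp [hf u hu, hg u hu, hff, hgg]

theorem const (c : ℝ) : IsDiffFun fun (_ : ℝ → Fin n → ℝ) _ => c :=
  ⟨DiffFun.const c, fun _ _ _ => rfl⟩

theorem add (hF : IsDiffFun F) (hG : IsDiffFun G) : IsDiffFun fun u x => F u x + G u x :=
  comp₂ (contDiff_fst.add contDiff_snd) hF hG

theorem mul (hF : IsDiffFun F) (hG : IsDiffFun G) : IsDiffFun fun u x => F u x * G u x :=
  comp₂ (contDiff_fst.mul contDiff_snd) hF hG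

theorem neg (hF : IsDiffFun F) : IsDiffFun fun u x => -F u x :=
  ((const (-1)).mul hF).congr fun u _ x => by ring

theorem sum {ι : Type} (s : Finset ι) {F : ι → (ℝ → Fin n → ℝ) → ℝ → ℝ}
    (hF : ∀ i ∈ s, IsDiffFun (F i)) : IsDiffFun fun u x => ∑ i ∈ s, F i u x := by
  classical
  induction s using Finset.induction_on with
  | empty => simpa using const 0
  | insert i s hi ih =>
    simp only [Finset.sum_insert hi]
    exact (hF i (by simp)).add (ih fun j hj => hF j (by simp [hj]))

theorem iteratedDeriv_apply (k : ℕ) (b : Fin n) :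
    IsDiffFun fun (u : ℝ → Fin n → ℝ) x => iteratedDeriv k u x b :=
  of_jet (N := k + 1) (g := fun j => j (Fin.last k) b) (by fun_prop) fun _ _ _ => rfl

theorem contDiff (hF : IsDiffFun F) {u : ℝ → Fin n → ℝ} (hu : IsLoop u) :
    ContDiff ℝ ∞ (F u) := by
  obtain ⟨f, hf⟩ := hF
  rw [show F u = fun x => f.toFun (jet f.len u x) from funext (hf u hu)]
  exact f.smooth.comp (contDiff_jet hu)

theorem periodic (hF : IsDiffFun F) {u : ℝ → Fin n → ℝ} (hu : IsLoop u) :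
    Function.Periodic (F u) 1 := by
  obtain ⟨f, hf⟩ := hF
  rw [show F u = fun x => f.toFun (jet f.len u x) from funext (hf u hu)]
  intro x
  simp only [jet_periodic hu x]

theorem differentiableAt (hF : IsDiffFun F) {u : ℝ → Fin n → ℝ} (hu : IsLoop u) (x : ℝ) :
    DifferentiableAt ℝ (F u) x :=
  (hF.contDiff hu).differentiable (by simp) x

/-- A differential function sees only the jet at the point, and germs determine jets. -/
theorem local_eq (hF : IsDiffFun F) {u v : ℝ → Fin n → ℝ} (hu : IsLoop u) (hv : IsLoop v) {x : ℝ}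
    (h : u =ᶠ[nhds x] v) : F u x = F v x := by
  obtain ⟨f, hf⟩ := hF
  rw [hf u hu, hf v hv]
  exact congrArg f.toFun (jet_congr h)

/-- The total derivative of a differential function is a differential function. -/
theorem deriv (hF : IsDiffFun F) : IsDiffFun fun u x => deriv (F u) x := by
  obtain ⟨f, hf⟩ := hF
  -- By the chain rule, the differential of `f` at (u, …, u_{N-1}) is applied to the shifted jet
  -- (u_x, …, u_N), so one more jet variable is needed.
  refine of_jet (N := f.len + 1)
    (g := fun j => fderiv ℝ f.toFun (fun k => j k.castSucc) fun k => j k.succ) ?_ fun u hu x => ?_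
  · exact ((f.smooth.fderiv_right (m := ∞) (by simp)).comp
      (contDiff_pi.2 fun k => contDiff_apply ℝ (Fin n → ℝ) (Fin.castSucc k))).clm_apply
      (contDiff_pi.2 fun k => contDiff_apply ℝ (Fin n → ℝ) (Fin.succ k))
  · rw [show F u = fun x => f.toFun (jet f.len u x) from funext (hf u hu)]
    have hj : HasDerivAt (jet f.len u) (fun k => iteratedDeriv (k + 1) u x) x := by
      refine hasDerivAt_pi.2 fun k => ?_
      rw [iteratedDeriv_succ]
      exact ((hu.iteratedDeriv k).differentiableAt x).hasDerivAt
    exact (((f.smooth.differentiable (by simp) _).hasFDerivAt).comp_hasDerivAt x hj).deriv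

theorem pd (f : DiffFun n) (k : Fin f.len) (c : Fin n) : IsDiffFun (f.pd k c) :=
  of_jet (N := f.len) ((f.smooth.fderiv_right (m := ∞) (by simp)).clm_apply contDiff_const)
    fun _ _ _ => rfl

/-- The average of a differential function along the homotopy `λ ↦ λ u`. -/
theorem homotopy (hF : IsDiffFun F) :
    IsDiffFun fun u x => ∫ l in (0 : ℝ)..1, F (l • u) x := by
  obtain ⟨f, hf⟩ := hF
  refine of_jet (N := f.len)
    (contDiff_integral_unitInterval (f := fun p => f.toFun (p.2 • p.1))
      (f.smooth.comp (contDiff_snd.smul contDiff_fst))) fun u hu x => ?_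
  refine intervalIntegral.integral_congr fun l _ => ?_
  simp only
  rw [hf _ (hu.smul l), DiffFun.eval]
  congr 1
  funext k
  exact iteratedDeriv_const_smul_field l u ▸ rfl

end IsDiffFun

/-- Along loops, `(s, t, x) ↦ F (u + s v + t w) x` is smooth. -/
def IsSmoothFamily {E : Type} [NormedAddCommGroup E] [NormedSpace ℝ E]
    (F : (ℝ → Fin n → ℝ) → ℝ → E) : Prop :=
  ∀ u v w, IsLoop u → IsLoop v → IsLoop w →
    ContDiff ℝ ∞ fun p : ℝ × ℝ × ℝ => F (u + p.1 • v + p.2.1 • w) p.2.2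

theorem IsDiffFun.isSmoothFamily {F : (ℝ → Fin n → ℝ) → ℝ → ℝ} (hF : IsDiffFun F) :
    IsSmoothFamily F := by
  obtain ⟨f, hf⟩ := hF
  intro u v w hu hv hw
  have h : (fun p : ℝ × ℝ × ℝ => F (u + p.1 • v + p.2.1 • w) p.2.2) = fun p =>
      f.toFun (jet f.len u p.2.2 + p.1 • jet f.len v p.2.2 + p.2.1 • jet f.len w p.2.2) := by
    funext p
    rw [hf _ ((hu.add (hv.smul _)).add (hw.smul _)), ← jet_add_smul_add_smul hu hv hw]
    rfl
  rw [h]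
  have hx : ContDiff ℝ ∞ fun p : ℝ × ℝ × ℝ => p.2.2 := contDiff_snd.comp contDiff_snd
  exact f.smooth.comp ((((contDiff_jet hu).comp hx).add
    (contDiff_fst.smul ((contDiff_jet hv).comp hx))).add
    ((contDiff_fst.comp contDiff_snd).smul ((contDiff_jet hw).comp hx)))

theorem DiffFun.gateaux_eval (f : DiffFun n) {u v : ℝ → Fin n → ℝ} (hu : IsLoop u)
    (hv : IsLoop v) (x : ℝ) :
    gateaux f.eval u v x = fderiv ℝ f.toFun (jet f.len u x) (jet f.len v x) := by
  have h : (fun s : ℝ => f.eval (u + s • v) x) =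
      fun s => f.toFun (jet f.len u x + s • jet f.len v x) := by
    funext s
    have := jet_add_smul_add_smul (N := f.len) hu hv IsLoop.zero s 0 x
    simp only [zero_smul, add_zero] at this
    rw [← this]
    rfl
  rw [gateaux, h]
  exact HasDerivAt.deriv
    ((f.smooth.differentiable (by simp) (jet f.len u x)).hasFDerivAt.hasLineDerivAt _)

theorem DiffFun.gateaux_eval_eq_sum (f : DiffFun n) {u v : ℝ → Fin n → ℝ} (hu : IsLoop u)
    (hv : IsLoop v) (x : ℝ) :
    gateaux f.eval u v x = ∑ k : Fin f.len, ∑ c, f.pd k c u x * iteratedDeriv k v x c := by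
  rw [f.gateaux_eval hu hv]
  have h : jet f.len v x = ∑ k : Fin f.len, ∑ c, iteratedDeriv k v x c •
      (Pi.single k (Pi.single c 1) : Fin f.len → Fin n → ℝ) := by
    funext k c
    simp [Finset.sum_apply, Pi.single_apply, jet, apply_ite, ite_apply]
  rw [h]
  simp only [map_sum, map_smul, smul_eq_mul]
  exact Finset.sum_congr rfl fun k _ => Finset.sum_congr rfl fun c _ => mul_comm _ _

/-- Along loops, the scalar linear operator `ℓ_u` has the form
`φ ↦ ∑_{k, b} c_{kb}(u, u_x, …) ∂^k φ_b`. -/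
def IsLinDiffOp (ℓ : (ℝ → Fin n → ℝ) → (ℝ → Fin n → ℝ) → ℝ → ℝ) : Prop :=
  ∃ (N : ℕ) (c : ℕ → Fin n → (ℝ → Fin n → ℝ) → ℝ → ℝ), (∀ k b, IsDiffFun (c k b)) ∧
    (∀ k, N ≤ k → ∀ b u x, c k b u x = 0) ∧
    ∀ u φ, IsLoop u → IsLoop φ → ∀ x,
      ℓ u φ x = ∑ k ∈ Finset.range N, ∑ b, c k b u x * iteratedDeriv k φ x b

namespace IsLinDiffOp

variable {ℓ m : (ℝ → Fin n → ℝ) → (ℝ → Fin n → ℝ) → ℝ → ℝ}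

theorem congr (hl : IsLinDiffOp ℓ)
    (h : ∀ u φ, IsLoop u → IsLoop φ → ∀ x, m u φ x = ℓ u φ x) : IsLinDiffOp m := by
  obtain ⟨N, c, hc, h0, hN⟩ := hl
  exact ⟨N, c, hc, h0, fun u φ hu hφ x => (h u φ hu hφ x).trans (hN u φ hu hφ x)⟩

/-- The order of the operator may be replaced by any larger number. -/
theorem sum_range_eq {N M : ℕ} (h : N ≤ M) {c : ℕ → Fin n → (ℝ → Fin n → ℝ) → ℝ → ℝ}
    (h0 : ∀ k, N ≤ k → ∀ b u x, c k b u x = 0) (u φ : ℝ → Fin n → ℝ) (x : ℝ) :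
    ∑ k ∈ Finset.range N, ∑ b, c k b u x * iteratedDeriv k φ x b =
      ∑ k ∈ Finset.range M, ∑ b, c k b u x * iteratedDeriv k φ x b := by
  refine Finset.sum_subset (Finset.range_mono h) fun k _ hk => ?_
  simp [h0 k (by simpa using hk)]

theorem add (hl : IsLinDiffOp ℓ) (hm : IsLinDiffOp m) :
    IsLinDiffOp fun u φ x => ℓ u φ x + m u φ x := by
  obtain ⟨N, c, hc, h0, hN⟩ := hl
  obtain ⟨M, d, hd, h1, hM⟩ := hm
  refine ⟨max N M, fun k b u x => c k b u x + d k b u x, fun k b => (hc k b).add (hd k b),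
    fun k hk b u x => ?_, fun u φ hu hφ x => ?_⟩
  · beta_reduce
    rw [h0 k (le_trans (le_max_left _ _) hk), h1 k (le_trans (le_max_right _ _) hk), add_zero]
  · beta_reduce
    rw [hN u φ hu hφ, hM u φ hu hφ, sum_range_eq (le_max_left N M) h0,
      sum_range_eq (le_max_right N M) h1]
    simp only [add_mul, Finset.sum_add_distrib]

theorem zero : IsLinDiffOp fun (_ _ : ℝ → Fin n → ℝ) _ => 0 :=
  ⟨0, fun _ _ _ _ => 0, fun _ _ => .const 0, fun _ _ _ _ _ => rfl, by simp⟩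

theorem sum {ι : Type} (s : Finset ι) {ℓ : ι → (ℝ → Fin n → ℝ) → (ℝ → Fin n → ℝ) → ℝ → ℝ}
    (hl : ∀ i ∈ s, IsLinDiffOp (ℓ i)) : IsLinDiffOp fun u φ x => ∑ i ∈ s, ℓ i u φ x := by
  classical
  induction s using Finset.induction_on with
  | empty => simpa using zero
  | insert i s hi ih =>
    simp only [Finset.sum_insert hi]
    exact (hl i (by simp)).add (ih fun j hj => hl j (by simp [hj]))

theorem mul {F : (ℝ → Fin n → ℝ) → ℝ → ℝ} (hF : IsDiffFun F) (hl : IsLinDiffOp ℓ) :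
    IsLinDiffOp fun u φ x => F u x * ℓ u φ x := by
  obtain ⟨N, c, hc, h0, hN⟩ := hl
  refine ⟨N, fun k b u x => F u x * c k b u x, fun k b => hF.mul (hc k b),
    fun k hk b u x => ?_, fun u φ hu hφ x => ?_⟩
  · beta_reduce
    rw [h0 k hk, mul_zero]
  · simp only [hN u φ hu hφ, Finset.mul_sum, mul_assoc]

theorem neg (hl : IsLinDiffOp ℓ) : IsLinDiffOp fun u φ x => -ℓ u φ x :=
  (mul (IsDiffFun.const (-1)) hl).congr fun _ _ _ _ _ => by ring

theorem iteratedDeriv_apply (k : ℕ) (b : Fin n) :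
    IsLinDiffOp fun (_ φ : ℝ → Fin n → ℝ) x => iteratedDeriv k φ x b := by
  refine ⟨k + 1, fun j a _ _ => if j = k ∧ a = b then 1 else 0, fun j a => .const _,
    fun j hj a u x => if_neg (by omega), fun u φ _ _ x => ?_⟩
  simp [ite_and, Finset.sum_ite_irrel]

theorem apply (b : Fin n) : IsLinDiffOp fun (_ φ : ℝ → Fin n → ℝ) x => φ x b := by
  simpa using iteratedDeriv_apply (n := n) 0 b

/-- To prove a property of all operators, prove it for `c ∂^k φ_b` and for sums. -/
theorem induction {p : ((ℝ → Fin n → ℝ) → (ℝ → Fin n → ℝ) → ℝ → ℝ) → Prop}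
    (h_congr : ∀ ℓ m, p ℓ → (∀ u φ, IsLoop u → IsLoop φ → ∀ x, m u φ x = ℓ u φ x) → p m)
    (h_zero : p fun _ _ _ => 0) (h_add : ∀ ℓ m, p ℓ → p m → p fun u φ x => ℓ u φ x + m u φ x)
    (h_basic : ∀ (k : ℕ) (b : Fin n) (c : (ℝ → Fin n → ℝ) → ℝ → ℝ), IsDiffFun c →
      p fun u φ x => c u x * iteratedDeriv k φ x b) (hl : IsLinDiffOp ℓ) : p ℓ := by
  classical
  have hs : ∀ {ι : Type} (s : Finset ι) (q : ι → (ℝ → Fin n → ℝ) → (ℝ → Fin n → ℝ) → ℝ → ℝ),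
      (∀ i, p (q i)) → p fun u φ x => ∑ i ∈ s, q i u φ x := by
    intro ι s q hq
    induction s using Finset.induction_on with
    | empty => simpa using h_zero
    | insert i s hi ih =>
      simp only [Finset.sum_insert hi]
      exact h_add _ _ (hq i) ih
  obtain ⟨N, c, hc, _, hN⟩ := hl
  exact h_congr _ _ (hs (Finset.range N) _ fun k => hs Finset.univ _ fun b =>
    h_basic k b (c k b) (hc k b)) hN

theorem contDiff_and_periodic (hl : IsLinDiffOp ℓ) {u φ : ℝ → Fin n → ℝ} (hu : IsLoop u)
    (hφ : IsLoop φ) : ContDiff ℝ ∞ (ℓ u φ) ∧ Function.Periodic (ℓ u φ) 1 := by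
  refine induction (p := fun ℓ => ContDiff ℝ ∞ (ℓ u φ) ∧ Function.Periodic (ℓ u φ) 1)
    (fun ℓ m h hm => ?_) ⟨contDiff_const, fun _ => rfl⟩
    (fun ℓ m h1 h2 => ⟨h1.1.add h2.1, h1.2.add h2.2⟩) (fun k b c hc => ?_) hl
  · rwa [show m u φ = ℓ u φ from funext (hm u φ hu hφ)]
  · have := (hφ.iteratedDeriv k).component b
    exact ⟨(hc.contDiff hu).mul this.1, (hc.periodic hu).mul this.2⟩

theorem differentiableAt (hl : IsLinDiffOp ℓ) {u φ : ℝ → Fin n → ℝ} (hu : IsLoop u)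
    (hφ : IsLoop φ) (x : ℝ) : DifferentiableAt ℝ (ℓ u φ) x :=
  (hl.contDiff_and_periodic hu hφ).1.differentiable (by simp) x

theorem deriv_basic {c : (ℝ → Fin n → ℝ) → ℝ → ℝ} (hc : IsDiffFun c) (k : ℕ) (b : Fin n)
    {u φ : ℝ → Fin n → ℝ} (hu : IsLoop u) (hφ : IsLoop φ) (x : ℝ) :
    deriv (fun x => c u x * iteratedDeriv k φ x b) x =
      deriv (c u) x * iteratedDeriv k φ x b + c u x * iteratedDeriv (k + 1) φ x b := by
  have h : HasDerivAt (fun x => iteratedDeriv k φ x b) (iteratedDeriv (k + 1) φ x b) x := by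
    rw [iteratedDeriv_succ]
    exact hasDerivAt_pi.1 ((hφ.iteratedDeriv k).differentiableAt x).hasDerivAt b
  exact ((hc.differentiableAt hu x).hasDerivAt.mul h).deriv

theorem deriv (hl : IsLinDiffOp ℓ) : IsLinDiffOp fun u φ x => deriv (ℓ u φ) x := by
  -- The property carries `IsLinDiffOp ℓ` along because the sum rule needs the summands to be
  -- differentiable.
  refine (induction (p := fun ℓ => IsLinDiffOp ℓ ∧ IsLinDiffOp fun u φ x => _root_.deriv (ℓ u φ) x)
    ?_ ?_ ?_ ?_ hl).2
  · exact fun ℓ m h hm => ⟨h.1.congr hm, h.2.congr fun u φ hu hφ x => by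
      rw [show m u φ = ℓ u φ from funext (hm u φ hu hφ)]⟩
  · exact ⟨zero, by simpa using zero⟩
  · exact fun ℓ m h1 h2 => ⟨h1.1.add h2.1, (h1.2.add h2.2).congr fun u φ hu hφ x =>
      deriv_add (h1.1.differentiableAt hu hφ x) (h2.1.differentiableAt hu hφ x)⟩
  · exact fun k b c hc => ⟨mul hc (iteratedDeriv_apply k b),
      ((mul hc.deriv (iteratedDeriv_apply k b)).add (mul hc (iteratedDeriv_apply (k + 1) b))).congr
        fun u φ hu hφ x => deriv_basic hc k b hu hφ x⟩

theorem iteratedDeriv (hl : IsLinDiffOp ℓ) (k : ℕ) :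
    IsLinDiffOp fun u φ x => iteratedDeriv k (ℓ u φ) x := by
  induction k with
  | zero => simpa using hl
  | succ k ih => simpa only [iteratedDeriv_succ] using ih.deriv

/-- Division by `∂` from the left: `ℓ φ = ∑_b M_b φ_b + ∂ (R φ)`. -/
theorem exists_left_division (hl : IsLinDiffOp ℓ) :
    ∃ (M : Fin n → (ℝ → Fin n → ℝ) → ℝ → ℝ) (r : (ℝ → Fin n → ℝ) → (ℝ → Fin n → ℝ) → ℝ → ℝ),
      (∀ b, IsDiffFun (M b)) ∧ IsLinDiffOp r ∧ ∀ u φ, IsLoop u → IsLoop φ → ∀ x,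
        ℓ u φ x = ∑ b, M b u x * φ x b + _root_.deriv (r u φ) x := by
  refine induction (p := fun ℓ => ∃ (M : Fin n → (ℝ → Fin n → ℝ) → ℝ → ℝ)
    (r : (ℝ → Fin n → ℝ) → (ℝ → Fin n → ℝ) → ℝ → ℝ), (∀ b, IsDiffFun (M b)) ∧ IsLinDiffOp r ∧
      ∀ u φ, IsLoop u → IsLoop φ → ∀ x,
        ℓ u φ x = ∑ b, M b u x * φ x b + _root_.deriv (r u φ) x) ?_ ?_ ?_ ?_ hl
  · rintro ℓ m ⟨M, r, hM, hr, h⟩ hm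
    exact ⟨M, r, hM, hr, fun u φ hu hφ x => (hm u φ hu hφ x).trans (h u φ hu hφ x)⟩
  · exact ⟨fun _ _ _ => 0, fun _ _ _ => 0, fun _ => .const 0, zero, by simp⟩
  · rintro ℓ m ⟨M, r, hM, hr, h⟩ ⟨M', r', hM', hr', h'⟩
    refine ⟨fun b u x => M b u x + M' b u x, _, fun b => (hM b).add (hM' b), hr.add hr',
      fun u φ hu hφ x => ?_⟩
    have hd : _root_.deriv (fun x => r u φ x + r' u φ x) x = _ :=
      deriv_add (hr.differentiableAt hu hφ x) (hr'.differentiableAt hu hφ x)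
    beta_reduce
    rw [hd, h u φ hu hφ, h' u φ hu hφ]
    simp only [add_mul, Finset.sum_add_distrib]
    ring
  · intro k b
    induction k with
    | zero =>
      intro c hc
      refine ⟨fun a u x => if a = b then c u x else 0, fun _ _ _ => 0, fun a => ?_, zero,
        fun u φ _ _ x => by simp⟩
      by_cases h : a = b
      · simpa [h] using hc
      · simpa [h] using IsDiffFun.const 0
    | succ k ih =>
      intro c hc
      -- c ∂^{k+1}φ = ∂(c ∂^kφ) - c_x ∂^kφ, and the second term has lower order with the new
      -- coefficient c_x; hence the induction over all coefficients.
      obtain ⟨M, r, hM, hr, h⟩ := ih (fun u x => _root_.deriv (c u) x) hc.deriv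
      have hb := mul hc (iteratedDeriv_apply k b)
      refine ⟨fun a u x => -M a u x, _, fun a => (hM a).neg, hb.add hr.neg, fun u φ hu hφ x => ?_⟩
      have hd : _root_.deriv (fun x => c u x * _root_.iteratedDeriv k φ x b + -r u φ x) x = _ :=
        deriv_add (hb.differentiableAt hu hφ x) (hr.neg.differentiableAt hu hφ x)
      have hn : _root_.deriv (fun x => -r u φ x) x = -_root_.deriv (r u φ) x := deriv.fun_neg
      beta_reduce at h ⊢
      rw [hd, deriv_basic hc k b hu hφ, hn, h u φ hu hφ]
      simp only [neg_mul, Finset.sum_neg_distrib]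
      ring

theorem isSmoothFamily (hl : IsLinDiffOp ℓ) {φ : ℝ → Fin n → ℝ} (hφ : IsLoop φ) :
    IsSmoothFamily fun u => ℓ u φ := by
  refine induction (p := fun ℓ => IsSmoothFamily fun u => ℓ u φ) (fun ℓ m h hm => ?_)
    (fun _ _ _ _ _ _ => contDiff_const)
    (fun ℓ m h1 h2 u v w hu hv hw => (h1 u v w hu hv hw).add (h2 u v w hu hv hw))
    (fun k b c hc u v w hu hv hw => ?_) hl
  · intro u v w hu hv hw
    convert h u v w hu hv hw using 2 with p
    exact hm _ φ ((hu.add (hv.smul _)).add (hw.smul _)) hφ _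
  · exact (hc.isSmoothFamily u v w hu hv hw).mul
      (((hφ.iteratedDeriv k).component b).1.comp (contDiff_snd.comp contDiff_snd))

theorem isDiffFun_self (hl : IsLinDiffOp ℓ) : IsDiffFun fun u => ℓ u u :=
  induction (p := fun ℓ => IsDiffFun fun u => ℓ u u)
    (fun _ _ h hm => h.congr fun u hu => hm u u hu hu) (.const 0) (fun _ _ h1 h2 => h1.add h2)
    (fun k b _ hc => hc.mul (.iteratedDeriv_apply k b)) hl

theorem isDiffFun_const (hl : IsLinDiffOp ℓ) (e : Fin n → ℝ) : IsDiffFun fun u => ℓ u fun _ => e :=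
  induction (p := fun ℓ => IsDiffFun fun u => ℓ u fun _ => e)
    (fun _ _ h hm => h.congr fun u hu => hm u _ hu (.const e)) (.const 0)
    (fun _ _ h1 h2 => h1.add h2)
    (fun k b _ hc => hc.mul (by
      simp only [iteratedDeriv_const]
      exact .const _)) hl

theorem apply_add (hl : IsLinDiffOp ℓ) {u φ ψ : ℝ → Fin n → ℝ} (hu : IsLoop u) (hφ : IsLoop φ)
    (hψ : IsLoop ψ) (x : ℝ) : ℓ u (φ + ψ) x = ℓ u φ x + ℓ u ψ x := by
  refine induction (p := fun ℓ => ℓ u (φ + ψ) x = ℓ u φ x + ℓ u ψ x) (fun ℓ m h hm => ?_)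
    (by simp) (fun ℓ m h1 h2 => by beta_reduce; rw [h1, h2]; ring) (fun k b c hc => ?_) hl
  · rw [hm _ _ hu (hφ.add hψ), hm _ _ hu hφ, hm _ _ hu hψ, h]
  · have h : ∀ {f : ℝ → Fin n → ℝ}, IsLoop f → ContDiffAt ℝ (k : ℕ) f x := fun hf =>
      (hf.contDiff.of_le (by exact_mod_cast le_top)).contDiffAt
    beta_reduce
    rw [iteratedDeriv_add (h hφ) (h hψ), Pi.add_apply, mul_add]

theorem apply_smul (hl : IsLinDiffOp ℓ) {u φ : ℝ → Fin n → ℝ} (hu : IsLoop u) (hφ : IsLoop φ)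
    (r x : ℝ) : ℓ u (r • φ) x = r * ℓ u φ x := by
  refine induction (p := fun ℓ => ℓ u (r • φ) x = r * ℓ u φ x) (fun ℓ m h hm => ?_)
    (by simp) (fun ℓ m h1 h2 => by beta_reduce; rw [h1, h2]; ring) (fun k b c hc => ?_) hl
  · rw [hm _ _ hu (hφ.smul r), hm _ _ hu hφ, h]
  · beta_reduce
    rw [iteratedDeriv_const_smul_field, Pi.smul_apply, smul_eq_mul]
    ring

theorem local_eq (hl : IsLinDiffOp ℓ) {u v φ ψ : ℝ → Fin n → ℝ} (hu : IsLoop u) (hv : IsLoop v)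
    (hφ : IsLoop φ) (hψ : IsLoop ψ) {x : ℝ} (huv : u =ᶠ[nhds x] v) (h : φ =ᶠ[nhds x] ψ) :
    ℓ u φ x = ℓ v ψ x := by
  refine induction (p := fun ℓ => ℓ u φ x = ℓ v ψ x) (fun ℓ m h hm => ?_) rfl
    (fun ℓ m h1 h2 => by beta_reduce; rw [h1, h2]) (fun k b c hc => ?_) hl
  · rw [hm _ _ hu hφ, hm _ _ hv hψ, h]
  · beta_reduce
    rw [hc.local_eq hu hv huv, h.iteratedDeriv_eq k]

end IsLinDiffOp

theorem IsDiffFun.gateaux {F : (ℝ → Fin n → ℝ) → ℝ → ℝ} (hF : IsDiffFun F) :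
    IsLinDiffOp (gateaux F) := by
  obtain ⟨f, hf⟩ := hF
  refine (IsLinDiffOp.sum Finset.univ fun k _ => IsLinDiffOp.sum Finset.univ fun c _ =>
    IsLinDiffOp.mul (IsDiffFun.pd f k c) (.iteratedDeriv_apply k c)).congr fun u φ hu hφ x => ?_
  rw [← f.gateaux_eval_eq_sum hu hφ]
  exact congrArg (fun g => _root_.deriv g 0) (funext fun s => hf _ (hu.add (hφ.smul s)) x)

/-- Both sides are the second differential of a smooth function on a finite jet space, which is
symmetric. This is what makes L_Z(P) drop out of the cocycle condition. -/
theorem gateaux_gateaux_comm {F : (ℝ → Fin n → ℝ) → ℝ → ℝ} (hF : IsDiffFun F)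
    {u v w : ℝ → Fin n → ℝ} (hu : IsLoop u) (hv : IsLoop v) (hw : IsLoop w) (x : ℝ) :
    gateaux (fun u => gateaux F u v) u w x = gateaux (fun u => gateaux F u w) u v x := by
  obtain ⟨f, hf⟩ := hF
  have key : ∀ v w : ℝ → Fin n → ℝ, IsLoop v → IsLoop w →
      gateaux (fun u => gateaux F u v) u w x =
        fderiv ℝ (fderiv ℝ f.toFun) (jet f.len u x) (jet f.len w x) (jet f.len v x) := by
    intro v w hv hw
    have h : (fun s : ℝ => gateaux F (u + s • w) v x) =
        fun s => fderiv ℝ f.toFun (jet f.len u x + s • jet f.len w x) (jet f.len v x) := by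
      funext s
      have hus := hu.add (hw.smul s)
      have hj := jet_add_smul_add_smul (N := f.len) hu hw IsLoop.zero s 0 x
      simp only [zero_smul, add_zero] at hj
      rw [← hj, ← f.gateaux_eval hus hv]
      exact congrArg (fun g => deriv g 0) (funext fun r => hf _ (hus.add (hv.smul r)) x)
    rw [gateaux, h]
    have hd : HasDerivAt (fun s : ℝ => fderiv ℝ f.toFun (jet f.len u x + s • jet f.len w x))
        (fderiv ℝ (fderiv ℝ f.toFun) (jet f.len u x) (jet f.len w x)) 0 :=
      ((f.smooth.fderiv_right (m := ∞) (by simp)).differentiable (by simp)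
        (jet f.len u x)).hasFDerivAt.hasLineDerivAt _
    rw [(hd.clm_apply (hasDerivAt_const (0 : ℝ) (jet f.len v x))).deriv, map_zero, add_zero]
  rw [key v w hv hw, key w v hw hv]
  exact ((contDiff_infty.1 f.smooth 2).contDiffAt.isSymmSndFDerivAt (by simp)).eq _ _

end DifferentialFunctions

/-! ### Gateaux derivatives of smooth functionals and their averages along rays. -/

section SmoothFamilies

variable {n : ℕ} {E : Type} [NormedAddCommGroup E] [NormedSpace ℝ E]

namespace IsSmoothFamily

variable {F : (ℝ → Fin n → ℝ) → ℝ → E} {u v w : ℝ → Fin n → ℝ}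

theorem contDiff_line (hF : IsSmoothFamily F) (hu : IsLoop u) (hv : IsLoop v) :
    ContDiff ℝ ∞ fun p : ℝ × ℝ => F (u + p.1 • v) p.2 := by
  have h := (hF u v 0 hu hv IsLoop.zero).comp
    (contDiff_fst.prodMk (contDiff_const.prodMk contDiff_snd) :
      ContDiff ℝ ∞ fun p : ℝ × ℝ => (p.1, (0 : ℝ), p.2))
  simpa [Function.comp_def] using h

theorem contDiff (hF : IsSmoothFamily F) (hu : IsLoop u) : ContDiff ℝ ∞ (F u) := by
  have h := (hF.contDiff_line hu IsLoop.zero).comp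
    (contDiff_const.prodMk contDiff_id : ContDiff ℝ ∞ fun x : ℝ => ((0 : ℝ), x))
  simpa [Function.comp_def] using h

/-- Reduces Gateaux derivatives to the Fréchet derivative of a function on ℝ³, from which linearity
and smoothness are then read off. -/
theorem hasDerivAt_plane (hF : IsSmoothFamily F) (hu : IsLoop u) (hv : IsLoop v) (hw : IsLoop w)
    (a b s t x : ℝ) :
    HasDerivAt (fun r : ℝ => F (u + (s + r * a) • v + (t + r * b) • w) x)
      (fderiv ℝ (fun p : ℝ × ℝ × ℝ => F (u + p.1 • v + p.2.1 • w) p.2.2) (s, t, x) (a, b, 0)) 0 := by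
  have h := (((hF u v w hu hv hw).differentiable (by simp) (s, t, x)).hasFDerivAt).hasLineDerivAt
    (a, b, 0)
  simpa [HasLineDerivAt] using h

theorem hasDerivAt_line (hF : IsSmoothFamily F) (hu : IsLoop u) (hv : IsLoop v) (s x : ℝ) :
    HasDerivAt (fun r : ℝ => F (u + r • v) x) (gateaux F (u + s • v) v x) s := by
  have h := ((hF.contDiff_line hu hv).comp
    (contDiff_id.prodMk contDiff_const : ContDiff ℝ ∞ fun r : ℝ => (r, x))).differentiable
    (by simp) s
  have h' : gateaux F (u + s • v) v x = deriv (fun r : ℝ => F (u + r • v) x) s := by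
    have := deriv_comp_add_const (fun r : ℝ => F (u + r • v) x) s 0
    rw [zero_add] at this
    rw [gateaux, ← this]
    simp only [add_assoc, ← add_smul, add_comm s]
  rw [h']
  exact h.hasDerivAt

theorem gateaux_eq_fderiv (hF : IsSmoothFamily F) (hu : IsLoop u) (hv : IsLoop v) (hw : IsLoop w)
    (s x : ℝ) :
    gateaux F (u + s • v) w x = fderiv ℝ (fun p : ℝ × ℝ × ℝ => F (u + p.1 • v + p.2.1 • w) p.2.2)
      (s, 0, x) (0, 1, 0) := by
  have h := (hF.hasDerivAt_plane hu hv hw 0 1 s 0 x).deriv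
  simpa [gateaux] using h

/-- The second parameter of a smooth family is spent on the direction of differentiation, leaving
the first one to move the base point. -/
theorem contDiff_gateaux_line (hF : IsSmoothFamily F) (hu : IsLoop u) (hv : IsLoop v)
    (hw : IsLoop w) : ContDiff ℝ ∞ fun p : ℝ × ℝ => gateaux F (u + p.1 • v) w p.2 := by
  simp only [hF.gateaux_eq_fderiv hu hv hw]
  exact (((hF u v w hu hv hw).fderiv_right (m := ∞) (by simp)).comp
    (contDiff_fst.prodMk (contDiff_const.prodMk contDiff_snd))).clm_apply contDiff_const

theorem contDiff_gateaux (hF : IsSmoothFamily F) (hu : IsLoop u) (hv : IsLoop v) :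
    ContDiff ℝ ∞ (gateaux F u v) := by
  have h := (hF.contDiff_gateaux_line hu IsLoop.zero hv).comp
    (contDiff_const.prodMk contDiff_id : ContDiff ℝ ∞ fun x : ℝ => ((0 : ℝ), x))
  simpa [Function.comp_def] using h

/-- The directions (1,1), (1,0) and (0,1) in the plane spanned by `v` and `w` are compared through
one linear differential. -/
theorem gateaux_add (hF : IsSmoothFamily F) (hu : IsLoop u) (hv : IsLoop v) (hw : IsLoop w)
    (x : ℝ) : gateaux F u (v + w) x = gateaux F u v x + gateaux F u w x := by
  have h11 := (hF.hasDerivAt_plane hu hv hw 1 1 0 0 x).deriv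
  have h10 := (hF.hasDerivAt_plane hu hv hw 1 0 0 0 x).deriv
  have h01 := (hF.hasDerivAt_plane hu hv hw 0 1 0 0 x).deriv
  simp only [mul_one, mul_zero, zero_add, zero_smul, add_zero] at h11 h10 h01
  simp only [gateaux, smul_add, ← add_assoc, h11, h10, h01, ← map_add]
  simp

theorem gateaux_smul (F : (ℝ → Fin n → ℝ) → ℝ → E) (u v : ℝ → Fin n → ℝ) (c x : ℝ) :
    gateaux F u (c • v) x = c • gateaux F u v x := by
  have h := deriv_comp_mul_left c (fun s : ℝ => F (u + s • v) x) 0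
  rw [mul_zero] at h
  rw [gateaux, gateaux, ← h]
  simp only [smul_smul, mul_comm]

/-- The point λ(u + sv) lies in the plane through the zero loop spanned by `u` and `v`, with
coordinates λ and λs. -/
theorem contDiff_cone (hF : IsSmoothFamily F) (hu : IsLoop u) (hv : IsLoop v) (x : ℝ) :
    ContDiff ℝ ∞ fun p : ℝ × ℝ => F (p.2 • (u + p.1 • v)) x := by
  have h := (hF 0 u v IsLoop.zero hu hv).comp
    (contDiff_snd.prodMk ((contDiff_snd.mul contDiff_fst).prodMk contDiff_const) :
      ContDiff ℝ ∞ fun p : ℝ × ℝ => (p.2, p.2 * p.1, x))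
  simpa [Function.comp_def, smul_add, smul_smul] using h

theorem contDiff_ray (hF : IsSmoothFamily F) (hu : IsLoop u) :
    ContDiff ℝ ∞ fun p : ℝ × ℝ => F (p.1 • u) p.2 := by
  simpa using hF.contDiff_line IsLoop.zero hu

theorem contDiff_gateaux_ray (hF : IsSmoothFamily F) (hu : IsLoop u) (hv : IsLoop v) :
    ContDiff ℝ ∞ fun p : ℝ × ℝ => gateaux F (p.1 • u) v p.2 := by
  simpa using hF.contDiff_gateaux_line IsLoop.zero hu hv

/-- The Gateaux derivative of the average along the homotopy `λ ↦ λ u`. -/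
theorem gateaux_homotopy [CompleteSpace E] (hF : IsSmoothFamily F) (hu : IsLoop u) (hv : IsLoop v)
    (x : ℝ) :
    gateaux (fun u x => ∫ l in (0 : ℝ)..1, F (l • u) x) u v x =
      ∫ l in (0 : ℝ)..1, l • gateaux F (l • u) v x := by
  have h := (hasDerivAt_integral_unitInterval
    ((hF.contDiff_cone hu hv x).of_le (by exact_mod_cast le_top)) 0).deriv
  rw [gateaux, h]
  refine intervalIntegral.integral_congr fun l _ => ?_
  simp only
  rw [← gateaux_smul, gateaux]
  simp only [smul_add, smul_smul, mul_comm]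

end IsSmoothFamily

/-- A smooth functional on loops whose values are loops. -/
def IsLoopMap (F : (ℝ → Fin n → ℝ) → ℝ → Fin n → ℝ) : Prop :=
  IsSmoothFamily F ∧ ∀ u, IsLoop u → Function.Periodic (F u) 1

namespace IsLoopMap

variable {F : (ℝ → Fin n → ℝ) → ℝ → Fin n → ℝ} {u v w β : ℝ → Fin n → ℝ}

theorem isLoop (hF : IsLoopMap F) (hu : IsLoop u) : IsLoop (F u) :=
  ⟨hF.1.contDiff hu, hF.2 u hu⟩

theorem isLoop_gateaux (hF : IsLoopMap F) (hu : IsLoop u) (hv : IsLoop v) :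
    IsLoop (gateaux F u v) :=
  ⟨hF.1.contDiff_gateaux hu hv, fun x => by
    simp only [gateaux, hF.2 _ (hu.add (hv.smul _)) x]⟩

theorem gateaux_add (hF : IsLoopMap F) (hu : IsLoop u) (hv : IsLoop v) (hw : IsLoop w) :
    gateaux F u (v + w) = gateaux F u v + gateaux F u w :=
  funext fun x => hF.1.gateaux_add hu hv hw x

theorem contDiff_dotProduct {X : Type} [NormedAddCommGroup X] [NormedSpace ℝ X]
    {f g : X → Fin n → ℝ} (hf : ContDiff ℝ ∞ f) (hg : ContDiff ℝ ∞ g) :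
    ContDiff ℝ ∞ fun p => f p ⬝ᵥ g p :=
  ContDiff.sum fun i _ => (contDiff_pi.1 hf i).mul (contDiff_pi.1 hg i)

theorem hasDerivAt_dotProduct_right (b : Fin n → ℝ) {f : ℝ → Fin n → ℝ} {f' : Fin n → ℝ} {s : ℝ}
    (h : HasDerivAt f f' s) : HasDerivAt (fun s => b ⬝ᵥ f s) (b ⬝ᵥ f') s :=
  HasDerivAt.fun_sum fun i _ => (hasDerivAt_pi.1 h i).const_mul (b i)

/-- Differentiation of the pairing with a fixed loop. -/
theorem hasDerivAt_pairing (hF : IsLoopMap F) (hβ : IsLoop β) (hu : IsLoop u) (hv : IsLoop v)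
    (s : ℝ) :
    HasDerivAt (fun s : ℝ => pairing β (F (u + s • v))) (pairing β (gateaux F (u + s • v) v)) s := by
  have hG : ContDiff ℝ ∞ fun p : ℝ × ℝ => β p.2 ⬝ᵥ F (u + p.1 • v) p.2 :=
    contDiff_dotProduct (hβ.contDiff.comp contDiff_snd) (hF.1.contDiff_line hu hv)
  have h := hasDerivAt_integral_unitInterval (hG.of_le (by exact_mod_cast le_top)) s
  have hd : ∀ x, deriv (fun s : ℝ => β x ⬝ᵥ F (u + s • v) x) s =
      β x ⬝ᵥ gateaux F (u + s • v) v x := fun x =>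
    (hasDerivAt_dotProduct_right _ (hF.1.hasDerivAt_line hu hv s x)).deriv
  simp only [hd] at h
  exact h

theorem hasDerivAt_pairing_zero (hF : IsLoopMap F) (hβ : IsLoop β) (hu : IsLoop u)
    (hv : IsLoop v) :
    HasDerivAt (fun s : ℝ => pairing β (F (u + s • v))) (pairing β (gateaux F u v)) 0 := by
  simpa using hF.hasDerivAt_pairing hβ hu hv 0

theorem hasDerivAt_pairing_ray (hF : IsLoopMap F) (hβ : IsLoop β) (hu : IsLoop u) (s : ℝ) :
    HasDerivAt (fun s : ℝ => pairing β (F (s • u))) (pairing β (gateaux F (s • u) u)) s := by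
  simpa using hF.hasDerivAt_pairing hβ IsLoop.zero hu s

theorem continuous_pairing_of_continuous {G : ℝ → ℝ → Fin n → ℝ} (hβ : IsLoop β)
    (hG : Continuous fun p : ℝ × ℝ => G p.1 p.2) : Continuous fun l => pairing β (G l) := by
  refine intervalIntegral.continuous_parametric_intervalIntegral_of_continuous' ?_ 0 1
  have hb := hβ.continuous
  simp only [Function.uncurry_def, dotProduct]
  fun_prop

theorem continuous_pairing_ray (hF : IsLoopMap F) (hβ : IsLoop β) (hu : IsLoop u) :
    Continuous fun l : ℝ => pairing β (F (l • u)) :=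
  continuous_pairing_of_continuous hβ (hF.1.contDiff_ray hu).continuous

theorem continuous_pairing_gateaux_ray (hF : IsLoopMap F) (hβ : IsLoop β) (hu : IsLoop u)
    (hv : IsLoop v) : Continuous fun l : ℝ => pairing β (gateaux F (l • u) v) :=
  continuous_pairing_of_continuous hβ (hF.1.contDiff_gateaux_ray hu hv).continuous

/-- Fubini. It lets homotopy integrals be treated as scalar integrals in λ, to which the fundamental
theorem of calculus applies. -/
theorem pairing_integral {G : ℝ → ℝ → Fin n → ℝ} (hβ : IsLoop β)
    (hG : Continuous fun p : ℝ × ℝ => G p.1 p.2) :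
    pairing β (fun x => ∫ l in (0 : ℝ)..1, G l x) = ∫ l in (0 : ℝ)..1, pairing β (G l) := by
  have hb := hβ.continuous
  have hc : Continuous fun p : ℝ × ℝ => β p.1 ⬝ᵥ G p.2 p.1 := by
    have : Continuous fun p : ℝ × ℝ => G p.2 p.1 := hG.comp continuous_swap
    simp only [dotProduct]
    fun_prop
  rw [show (∫ l in (0 : ℝ)..1, pairing β (G l)) = _ from (integral_unitInterval_swap hc).symm]
  refine intervalIntegral.integral_congr fun x _ => ?_
  have hx : Continuous fun l => G l x := hG.comp (by fun_prop : Continuous fun l : ℝ => (l, x))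
  simp only [dotProduct]
  rw [intervalIntegral.integral_finsetSum fun i _ =>
    (by fun_prop : Continuous fun l => β x i * G l x i).intervalIntegrable _ _]
  refine Finset.sum_congr rfl fun i _ => ?_
  rw [intervalIntegral.integral_const_mul]
  congr 1
  have := (ContinuousLinearMap.proj (R := ℝ) (φ := fun _ : Fin n => ℝ) i
    ).intervalIntegral_comp_comm (hx.intervalIntegrable (μ := MeasureTheory.volume) 0 1)
  exact this.symm

theorem pairing_homotopy (hF : IsLoopMap F) (hβ : IsLoop β) (hu : IsLoop u) :
    pairing β (fun x => ∫ l in (0 : ℝ)..1, F (l • u) x) =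
      ∫ l in (0 : ℝ)..1, pairing β (F (l • u)) :=
  pairing_integral (G := fun l => F (l • u)) hβ (hF.1.contDiff_ray hu).continuous

theorem pairing_gateaux_homotopy (hF : IsLoopMap F) (hβ : IsLoop β) (hu : IsLoop u)
    (hv : IsLoop v) :
    pairing β (gateaux (fun u x => ∫ l in (0 : ℝ)..1, F (l • u) x) u v) =
      ∫ l in (0 : ℝ)..1, l * pairing β (gateaux F (l • u) v) := by
  rw [show gateaux (fun u x => ∫ l in (0 : ℝ)..1, F (l • u) x) u v = _ from
    funext fun x => hF.1.gateaux_homotopy hu hv x]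
  have h := pairing_integral (G := fun l => l • gateaux F (l • u) v) hβ
    (continuous_fst.smul (hF.1.contDiff_gateaux_ray hu hv).continuous)
  simp only [pairing_smul_right] at h
  exact h

end IsLoopMap

/-- A vector of functionals given, along loops, by differential functions. -/
def IsDiffVec (F : (ℝ → Fin n → ℝ) → ℝ → Fin n → ℝ) : Prop :=
  ∀ a, IsDiffFun fun u x => F u x a

/-- A matrix of linear differential operators whose coefficients are differential functions. -/
def IsMatDiffOp (L : (ℝ → Fin n → ℝ) → (ℝ → Fin n → ℝ) → ℝ → Fin n → ℝ) : Prop :=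
  ∀ a, IsLinDiffOp fun u φ x => L u φ x a

namespace IsDiffVec

variable {F : (ℝ → Fin n → ℝ) → ℝ → Fin n → ℝ}

theorem isLoopMap (hF : IsDiffVec F) : IsLoopMap F :=
  ⟨fun u v w hu hv hw => contDiff_pi.2 fun a => (hF a).isSmoothFamily u v w hu hv hw,
    fun _ hu x => funext fun a => (hF a).periodic hu x⟩

theorem isLoop (hF : IsDiffVec F) {u : ℝ → Fin n → ℝ} (hu : IsLoop u) : IsLoop (F u) :=
  hF.isLoopMap.isLoop hu

theorem eval (X : DiffVec n) : IsDiffVec X.eval := fun a => .eval (X a)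

theorem exists_eval (hF : IsDiffVec F) :
    ∃ X : DiffVec n, ∀ u, IsLoop u → ∀ x, X.eval u x = F u x := by
  choose X hX using hF
  exact ⟨X, fun u hu x => funext fun a => (hX a u hu x).symm⟩

theorem gateaux_apply (hF : IsDiffVec F) {u v : ℝ → Fin n → ℝ} (hu : IsLoop u) (hv : IsLoop v)
    (x : ℝ) (a : Fin n) : gateaux F u v x a = gateaux (fun u x => F u x a) u v x := by
  have h := hF.isLoopMap.1.hasDerivAt_line hu hv 0 x
  rw [zero_smul, add_zero] at h
  exact (hasDerivAt_pi.1 h a).deriv.symm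

theorem gateaux (hF : IsDiffVec F) : IsMatDiffOp (gateaux F) := fun a =>
  (hF a).gateaux.congr fun _ _ hu hφ x => hF.gateaux_apply hu hφ x a

end IsDiffVec

namespace IsMatDiffOp

variable {L : (ℝ → Fin n → ℝ) → (ℝ → Fin n → ℝ) → ℝ → Fin n → ℝ}
  {u v w φ ψ : ℝ → Fin n → ℝ}

theorem isLoopMap (hL : IsMatDiffOp L) (hφ : IsLoop φ) : IsLoopMap fun u => L u φ :=
  ⟨fun u v w hu hv hw => contDiff_pi.2 fun a => (hL a).isSmoothFamily hφ u v w hu hv hw,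
    fun _ hu x => funext fun a => ((hL a).contDiff_and_periodic hu hφ).2 x⟩

theorem isLoop (hL : IsMatDiffOp L) (hu : IsLoop u) (hφ : IsLoop φ) : IsLoop (L u φ) :=
  (hL.isLoopMap hφ).isLoop hu

theorem map_add (hL : IsMatDiffOp L) (hu : IsLoop u) (hφ : IsLoop φ) (hψ : IsLoop ψ) :
    L u (φ + ψ) = L u φ + L u ψ :=
  funext fun x => funext fun a => (hL a).apply_add hu hφ hψ x

theorem map_smul (hL : IsMatDiffOp L) (hu : IsLoop u) (hφ : IsLoop φ) (r : ℝ) :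
    L u (r • φ) = r • L u φ :=
  funext fun x => funext fun a => (hL a).apply_smul hu hφ r x

theorem map_zero (hL : IsMatDiffOp L) (hu : IsLoop u) : L u 0 = 0 := by
  simpa using hL.map_smul hu IsLoop.zero 0

theorem local_eq (hL : IsMatDiffOp L) (hu : IsLoop u) (hv : IsLoop v) (hφ : IsLoop φ)
    (hψ : IsLoop ψ) {x : ℝ} (huv : u =ᶠ[nhds x] v) (h : φ =ᶠ[nhds x] ψ) : L u φ x = L v ψ x :=
  funext fun a => (hL a).local_eq hu hv hφ hψ huv h

theorem local_zero (hL : IsMatDiffOp L) (hu : IsLoop u) (hφ : IsLoop φ) {x : ℝ}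
    (h : φ =ᶠ[nhds x] 0) : L u φ x = 0 := by
  rw [hL.local_eq hu hu hφ IsLoop.zero .rfl h, hL.map_zero hu]
  rfl

theorem isDiffVec_self (hL : IsMatDiffOp L) : IsDiffVec fun u => L u u :=
  fun a => (hL a).isDiffFun_self

theorem isDiffVec_const (hL : IsMatDiffOp L) (e : Fin n → ℝ) : IsDiffVec fun u => L u fun _ => e :=
  fun a => (hL a).isDiffFun_const e

theorem add {M : (ℝ → Fin n → ℝ) → (ℝ → Fin n → ℝ) → ℝ → Fin n → ℝ} (hL : IsMatDiffOp L)
    (hM : IsMatDiffOp M) : IsMatDiffOp fun u φ x => L u φ x + M u φ x :=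
  fun a => (hL a).add (hM a)

theorem neg (hL : IsMatDiffOp L) : IsMatDiffOp fun u φ x => -L u φ x :=
  fun a => (hL a).neg

theorem mulVec {A : (ℝ → Fin n → ℝ) → ℝ → Matrix (Fin n) (Fin n) ℝ}
    (hA : ∀ a b, IsDiffFun fun u x => A u x a b) (hL : IsMatDiffOp L) :
    IsMatDiffOp fun u φ x => A u x *ᵥ L u φ x :=
  fun a => (IsLinDiffOp.sum Finset.univ fun b _ => IsLinDiffOp.mul (hA a b) (hL b)).congr
    fun _ _ _ _ _ => rfl

theorem id : IsMatDiffOp fun (_ φ : ℝ → Fin n → ℝ) => φ :=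
  fun a => .apply a

theorem app (Q : DiffOp n) : IsMatDiffOp Q.app := fun a =>
  (IsLinDiffOp.sum Finset.univ fun k _ => IsLinDiffOp.sum Finset.univ fun b _ =>
    IsLinDiffOp.mul (IsDiffFun.eval (Q.coeff k a b)) (.iteratedDeriv_apply (k : ℕ) b)).congr
      fun u φ _ _ x => by
        simp [DiffOp.app, Finset.sum_apply, Matrix.mulVec, dotProduct, DiffMat.eval]

/-- Every operator of this kind comes from a matrix differential operator. -/
theorem exists_app (hL : IsMatDiffOp L) :
    ∃ R : DiffOp n, ∀ u φ, IsLoop u → IsLoop φ → R.app u φ = L u φ := by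
  choose N c hc h0 hN using hL
  choose f hf using hc
  -- The rows may have different orders; all are padded with zero coefficients up to the largest.
  refine ⟨⟨Finset.univ.sup N, fun k => Matrix.of fun a b => f a k b⟩, fun u φ hu hφ => ?_⟩
  funext x a
  rw [show L u φ x a = _ from hN a u φ hu hφ x, IsLinDiffOp.sum_range_eq (Finset.le_sup (Finset.mem_univ a)) (h0 a),
    Finset.sum_range]
  simp [DiffOp.app, Finset.sum_apply, Matrix.mulVec, dotProduct, DiffMat.eval, hf _ _ _ _ hu]

/-- Division by `∂` from the left: `L φ = M φ + ∂ (R φ)`. -/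
theorem exists_left_division (hL : IsMatDiffOp L) :
    ∃ (M : DiffMat n) (R : DiffOp n), ∀ u φ, IsLoop u → IsLoop φ → ∀ x,
      L u φ x = DiffMat.eval M u x *ᵥ φ x + deriv (R.app u φ) x := by
  choose M r hM hr h using fun a => (hL a).exists_left_division
  choose f hf using hM
  have hr' : IsMatDiffOp fun u φ x a => r a u φ x := hr
  obtain ⟨R, hR⟩ := hr'.exists_app
  refine ⟨Matrix.of f, R, fun u φ hu hφ x => funext fun a => ?_⟩
  have hd := hasDerivAt_pi.1 (((hr'.isLoop hu hφ).differentiableAt x).hasDerivAt) a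
  rw [h a u φ hu hφ x, hR u φ hu hφ, Pi.add_apply, ← hd.deriv]
  simp [Matrix.mulVec, dotProduct, DiffMat.eval, hf _ _ _ hu]

end IsMatDiffOp

namespace DiffMat

theorem isDiffFun (A : DiffMat n) (a b : Fin n) : IsDiffFun fun u x => A.eval u x a b :=
  .eval (A a b)

theorem isMatDiffOp (A : DiffMat n) : IsMatDiffOp fun u φ x => A.eval u x *ᵥ φ x :=
  IsMatDiffOp.mulVec A.isDiffFun .id

theorem isMatDiffOp_transpose (A : DiffMat n) : IsMatDiffOp fun u φ x => (A.eval u x)ᵀ *ᵥ φ x :=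
  IsMatDiffOp.mulVec (A := fun u x => (A.eval u x)ᵀ) (fun a b => A.isDiffFun b a) .id

end DiffMat

end SmoothFamilies

/-! ### Formal adjoints, the operator g∂ and the weak form of Q = L_X(P). -/

section Adjoints

variable {n : ℕ}

theorem pairing_sum_right {ι : Type} (s : Finset ι) {u : ℝ → Fin n → ℝ} {f : ι → ℝ → Fin n → ℝ}
    (hu : Continuous u) (hf : ∀ i, Continuous (f i)) :
    pairing u (fun x => ∑ i ∈ s, f i x) = ∑ i ∈ s, pairing u (f i) := by
  simp only [pairing, dotProduct_sum]
  exact intervalIntegral.integral_finsetSum fun i _ =>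
    (continuous_dotProduct hu (hf i)).intervalIntegrable _ _

theorem pairing_const_deriv (e : Fin n → ℝ) {v : ℝ → Fin n → ℝ} (hv : IsLoop v) :
    pairing (fun _ => e) (deriv v) = 0 := by
  rw [pairing_deriv_right (.const e) hv]
  simp [pairing]

theorem IsLoop.sum {ι : Type} (s : Finset ι) {f : ι → ℝ → Fin n → ℝ} (hf : ∀ i, IsLoop (f i)) :
    IsLoop fun x => ∑ i ∈ s, f i x :=
  ⟨ContDiff.sum fun i _ => (hf i).contDiff, fun x => by
    exact Finset.sum_congr rfl fun i _ => (hf i).periodic x⟩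

theorem deriv_apply_of_isLoop {f : ℝ → Fin n → ℝ} (hf : IsLoop f) (x : ℝ) (c : Fin n) :
    deriv f x c = deriv (fun y => f y c) x :=
  (hasDerivAt_pi.1 (hf.differentiableAt x).hasDerivAt c).deriv.symm

theorem iteratedDeriv_apply_of_isLoop {f : ℝ → Fin n → ℝ} (hf : IsLoop f) (k : ℕ) (x : ℝ)
    (c : Fin n) : iteratedDeriv k f x c = iteratedDeriv k (fun y => f y c) x := by
  induction k generalizing x with
  | zero => simp
  | succ k ih =>
    rw [iteratedDeriv_succ, iteratedDeriv_succ, deriv_apply_of_isLoop (hf.iteratedDeriv k)]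
    exact congrArg (fun h => deriv h x) (funext ih)

theorem intervalIntegral_apply {f : ℝ → Fin n → ℝ} (hf : Continuous f) (a : Fin n) :
    (∫ l in (0 : ℝ)..1, f l) a = ∫ l in (0 : ℝ)..1, f l a :=
  ((ContinuousLinearMap.proj (R := ℝ) (φ := fun _ : Fin n => ℝ) a).intervalIntegral_comp_comm
    (hf.intervalIntegrable (μ := MeasureTheory.volume) 0 1)).symm

theorem IsMatDiffOp.iteratedDeriv_comp
    {L : (ℝ → Fin n → ℝ) → (ℝ → Fin n → ℝ) → ℝ → Fin n → ℝ} (hL : IsMatDiffOp L) (k : ℕ) :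
    IsMatDiffOp fun u φ => _root_.iteratedDeriv k (L u φ) := fun a =>
  ((hL a).iteratedDeriv k).congr fun _ _ hu hφ x =>
    iteratedDeriv_apply_of_isLoop (hL.isLoop hu hφ) k x a

namespace DiffOp

theorem isMatDiffOp_adj (Q : DiffOp n) : IsMatDiffOp Q.adj := fun a =>
  (IsLinDiffOp.sum Finset.univ fun (k : Fin Q.len) _ =>
    IsLinDiffOp.mul (IsDiffFun.const ((-1) ^ (k : ℕ)))
    ((Q.coeff k).isMatDiffOp_transpose.iteratedDeriv_comp k a)).congr fun u φ _ _ x => by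
      simp [DiffOp.adj, Finset.sum_apply]

/-- Repeated integration by parts; periodicity removes the boundary terms. This justifies the name
of the formal adjoint. -/
theorem pairing_app (Q : DiffOp n) {u v w : ℝ → Fin n → ℝ} (hu : IsLoop u) (hv : IsLoop v)
    (hw : IsLoop w) : pairing v (Q.app u w) = pairing w (Q.adj u v) := by
  have h1 : ∀ k : Fin Q.len, IsLoop fun x => (Q.coeff k).eval u x *ᵥ iteratedDeriv (k : ℕ) w x :=
    fun k => (Q.coeff k).isMatDiffOp.isLoop hu (hw.iteratedDeriv k)
  have h2 : ∀ k : Fin Q.len, IsLoop fun x => ((Q.coeff k).eval u x)ᵀ *ᵥ v x :=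
    fun k => (Q.coeff k).isMatDiffOp_transpose.isLoop hu hv
  have h3 : ∀ k : Fin Q.len, IsLoop ((-1 : ℝ) ^ (k : ℕ) •
      iteratedDeriv (k : ℕ) fun x => ((Q.coeff k).eval u x)ᵀ *ᵥ v x) :=
    fun k => ((h2 k).iteratedDeriv k).smul _
  calc pairing v (Q.app u w) = ∑ k : Fin Q.len,
        pairing v fun x => (Q.coeff k).eval u x *ᵥ iteratedDeriv (k : ℕ) w x :=
        pairing_sum_right _ hv.continuous fun k => (h1 k).continuous
    _ = ∑ k : Fin Q.len, pairing w ((-1 : ℝ) ^ (k : ℕ) •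
          iteratedDeriv (k : ℕ) fun x => ((Q.coeff k).eval u x)ᵀ *ᵥ v x) := by
        refine Finset.sum_congr rfl fun k _ => ?_
        rw [pairing_mulVec, pairing_iteratedDeriv_right _ (h2 k) hw, pairing_smul_right,
          pairing_comm w]
    _ = pairing w (Q.adj u v) :=
        (pairing_sum_right _ hw.continuous fun k => (h3 k).continuous).symm

/-- Skewness in terms of the pairing. -/
theorem isSkew_iff (Q : DiffOp n) : Q.IsSkew ↔ ∀ u v w : ℝ → Fin n → ℝ, IsLoop u → IsLoop v →
    IsLoop w → pairing v (Q.app u w) = -pairing w (Q.app u v) := by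
  constructor
  · intro h u v w hu hv hw
    rw [Q.pairing_app hu hv hw, show Q.adj u v = -Q.app u v from funext (h u v hu hv),
      pairing_neg_right]
  · intro h u β hu hβ x
    have := eq_of_pairing_eq (Q.isMatDiffOp_adj.isLoop hu hβ)
      ((IsMatDiffOp.app Q).isLoop hu hβ).neg (fun γ hγ => by
        rw [← Q.pairing_app hu hβ hγ, pairing_neg_right, h u β γ hu hβ hγ]) x
    exact this

end DiffOp

/-- The map `α ↦ g ∂α`. -/
noncomputable def hydroMap (g : Matrix (Fin n) (Fin n) ℝ) (α : ℝ → Fin n → ℝ) : ℝ → Fin n → ℝ :=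
  fun x => g *ᵥ deriv α x

theorem hydro_app (g : Matrix (Fin n) (Fin n) ℝ) (u α : ℝ → Fin n → ℝ) :
    (DiffOp.hydro g).app u α = hydroMap g α := by
  funext x
  change ∑ k : Fin 2, _ = _
  have h1 : DiffMat.eval (g.map DiffFun.const) u x = g := by
    ext a b
    rfl
  have h0 : DiffMat.eval (Matrix.of fun _ _ => DiffFun.const 0) u x = 0 := by
    ext a b
    rfl
  simp [Fin.sum_univ_two, DiffOp.hydro, h1, h0, hydroMap]

section HydroMap

variable {g : Matrix (Fin n) (Fin n) ℝ}

theorem IsLoop.hydroMap {α : ℝ → Fin n → ℝ} (hα : IsLoop α) : IsLoop (hydroMap g α) :=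
  hα.deriv.mulVec g

theorem pairing_hydroMap (hg : g.IsSymm) {α β : ℝ → Fin n → ℝ} (hα : IsLoop α) (hβ : IsLoop β) :
    pairing α (hydroMap g β) = -pairing (hydroMap g α) β := by
  change pairing α (fun x => g *ᵥ deriv β x) = _
  rw [pairing_mulVec, hg.eq, pairing_deriv_right (hα.mulVec g) hβ]
  congr 2
  funext x
  have h := (Matrix.mulVecLin g).toContinuousLinearMap.hasFDerivAt.comp_hasDerivAt x
    (hα.differentiableAt x).hasDerivAt
  exact h.deriv

theorem hydroMap_const (e : Fin n → ℝ) : hydroMap g (fun _ => e) = 0 := by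
  funext x
  simp [hydroMap]

theorem deriv_const_mulVec (M : Matrix (Fin n) (Fin n) ℝ) {α : ℝ → Fin n → ℝ} (hα : IsLoop α)
    (x : ℝ) : deriv (fun y => M *ᵥ α y) x = M *ᵥ deriv α x :=
  ((Matrix.mulVecLin M).toContinuousLinearMap.hasFDerivAt.comp_hasDerivAt x
    (hα.differentiableAt x).hasDerivAt).deriv

/-- Invertibility of `g` makes every derivative of a loop a value of P. Identities known on the
image of P thereby become accessible to the locality principle. -/
theorem hydroMap_inv_mulVec (hreg : IsUnit g.det) {b : ℝ → Fin n → ℝ} (hb : IsLoop b) :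
    hydroMap g (fun x => g⁻¹ *ᵥ b x) = deriv b := by
  funext x
  rw [hydroMap, deriv_const_mulVec _ hb, Matrix.mulVec_mulVec, Matrix.mul_nonsing_inv _ hreg,
    Matrix.one_mulVec]

theorem gateaux_hydro (u α v : ℝ → Fin n → ℝ) :
    (DiffOp.hydro g).frechet u α v = 0 := by
  funext x
  simp [DiffOp.frechet, hydro_app]

/-- The cocycle condition for the operator `g ∂`. -/
theorem IsCocycle.cyclic_sum {Q : DiffOp n} (hQ : IsCocycle (DiffOp.hydro g) Q)
    {u α β γ : ℝ → Fin n → ℝ} (hu : IsLoop u) (hα : IsLoop α) (hβ : IsLoop β) (hγ : IsLoop γ) :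
    pairing α (gateaux (fun u => Q.app u β) u (hydroMap g γ)) +
      pairing β (gateaux (fun u => Q.app u γ) u (hydroMap g α)) +
      pairing γ (gateaux (fun u => Q.app u α) u (hydroMap g β)) = 0 := by
  have h := hQ u α β γ hu hα hβ hγ
  have h0 : ∀ v : ℝ → Fin n → ℝ, pairing v 0 = 0 := fun v => by simp [pairing]
  simp only [schouten, gateaux_hydro, hydro_app, h0] at h
  change 1 / 2 * (0 + pairing α (gateaux (fun u => Q.app u β) u (hydroMap g γ)) + 0 +
    pairing β (gateaux (fun u => Q.app u γ) u (hydroMap g α)) + 0 +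
    pairing γ (gateaux (fun u => Q.app u α) u (hydroMap g β))) = 0 at h
  linarith

end HydroMap

namespace DiffVec

theorem frechetAdj_eq (X : DiffVec n) {u β : ℝ → Fin n → ℝ} (hu : IsLoop u) (hβ : IsLoop β) :
    (∀ (a : Fin n) (k : Fin (X a).len), IsLoop fun y c => (X a).pd k c u y * β y a) ∧
    X.frechetAdj u β = fun x => ∑ a : Fin n, ∑ k : Fin (X a).len, ((-1 : ℝ) ^ (k : ℕ) •
      iteratedDeriv (k : ℕ) (fun y c => (X a).pd k c u y * β y a)) x := by
  have h : ∀ (a : Fin n) (k : Fin (X a).len), IsLoop fun y c => (X a).pd k c u y * β y a :=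
    fun a k => .of_components fun c =>
      ⟨((IsDiffFun.pd (X a) k c).contDiff hu).mul (hβ.component a).1,
        ((IsDiffFun.pd (X a) k c).periodic hu).mul (hβ.component a).2⟩
  refine ⟨h, ?_⟩
  funext x c
  simp only [frechetAdj, Finset.sum_apply, Pi.smul_apply, smul_eq_mul,
    iteratedDeriv_apply_of_isLoop (h _ _)]

theorem isLoop_frechetAdj (X : DiffVec n) {u β : ℝ → Fin n → ℝ} (hu : IsLoop u) (hβ : IsLoop β) :
    IsLoop (X.frechetAdj u β) := by
  obtain ⟨h, h'⟩ := X.frechetAdj_eq hu hβ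
  rw [h']
  exact IsLoop.sum _ fun a => IsLoop.sum _ fun k => ((h a k).iteratedDeriv k).smul _

/-- `X'_u^*` is the adjoint of the Fréchet derivative `X'_u`. -/
theorem pairing_frechetAdj (X : DiffVec n) {u β v : ℝ → Fin n → ℝ} (hu : IsLoop u)
    (hβ : IsLoop β) (hv : IsLoop v) :
    pairing v (X.frechetAdj u β) = pairing β (gateaux X.eval u v) := by
  obtain ⟨h, h'⟩ := X.frechetAdj_eq hu hβ
  have hl := fun a k => ((h a k).iteratedDeriv k).smul ((-1 : ℝ) ^ (k : ℕ))
  have h1 : ∀ a (k : Fin (X a).len), pairing v ((-1 : ℝ) ^ (k : ℕ) •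
      iteratedDeriv (k : ℕ) fun y c => (X a).pd k c u y * β y a) =
      pairing (fun y c => (X a).pd k c u y * β y a) (iteratedDeriv (k : ℕ) v) := by
    intro a k
    rw [pairing_smul_right, pairing_iteratedDeriv_right _ (h a k) hv, pairing_comm v]
  have hsum : pairing v (X.frechetAdj u β) = ∑ a : Fin n, ∑ k : Fin (X a).len,
      pairing (fun y c => (X a).pd k c u y * β y a) (iteratedDeriv (k : ℕ) v) := by
    rw [h', pairing_sum_right _ hv.continuous fun a => (IsLoop.sum _ (hl a)).continuous]
    refine Finset.sum_congr rfl fun a _ => ?_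
    rw [pairing_sum_right _ hv.continuous fun k => (hl a k).continuous]
    exact Finset.sum_congr rfl fun k _ => h1 a k
  rw [hsum]
  simp only [pairing]
  have hi : ∀ a (k : Fin (X a).len), IntervalIntegrable (fun x => (fun c => (X a).pd k c u x * β x a) ⬝ᵥ
      iteratedDeriv (k : ℕ) v x) MeasureTheory.volume 0 1 := fun a k =>
    (continuous_dotProduct (h a k).continuous
      (hv.iteratedDeriv k).continuous).intervalIntegrable _ _
  simp only [← intervalIntegral.integral_finsetSum fun k _ => hi _ k]
  rw [← intervalIntegral.integral_finsetSum fun a _ =>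
    (continuous_finsetSum _ fun k _ => continuous_dotProduct (h a k).continuous
      (hv.iteratedDeriv (k : ℕ)).continuous).intervalIntegrable _ _]
  refine intervalIntegral.integral_congr fun x _ => ?_
  simp only [dotProduct]
  refine Finset.sum_congr rfl fun a _ => ?_
  rw [(IsDiffVec.eval X).gateaux_apply hu hv,
    show gateaux (fun u x => X.eval u x a) u v x = _ from (X a).gateaux_eval_eq_sum hu hv x,
    Finset.mul_sum]
  refine Finset.sum_congr rfl fun k _ => ?_
  rw [Finset.mul_sum]
  exact Finset.sum_congr rfl fun c _ => by ring

end DiffVec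

/-- `Q = L_X(g ∂)` in terms of the pairing. -/
theorem isPotential_of_pairing {g : Matrix (Fin n) (Fin n) ℝ} (hg : g.IsSymm) {Q : DiffOp n}
    {X : DiffVec n}
    (h : ∀ u α β : ℝ → Fin n → ℝ, IsLoop u → IsLoop α → IsLoop β → pairing β (Q.app u α) =
      pairing α (gateaux X.eval u (hydroMap g β)) - pairing β (gateaux X.eval u (hydroMap g α))) :
    IsPotential (DiffOp.hydro g) Q X := by
  intro u α hu hα x
  have hX := IsDiffVec.eval X
  have h1 : IsLoop (gateaux X.eval u (hydroMap g α)) := hX.isLoopMap.isLoop_gateaux hu hα.hydroMap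
  have h2 := X.isLoop_frechetAdj hu hα
  rw [lieDeriv, gateaux_hydro, hydro_app, hydro_app]
  -- The leading 0 is the term P'(α; X) of the Lie derivative, absent because P has constant
  -- coefficients.
  refine eq_of_pairing_eq (w := 0 - gateaux X.eval u (hydroMap g α) -
    hydroMap g (X.frechetAdj u α)) ((IsMatDiffOp.app Q).isLoop hu hα)
    ((IsLoop.zero.sub h1).sub h2.hydroMap) (fun β hβ => ?_) x
  rw [zero_sub, pairing_sub_right hβ.continuous h1.neg.continuous h2.hydroMap.continuous,
    pairing_neg_right, pairing_hydroMap hg hβ h2, X.pairing_frechetAdj hu hα hβ.hydroMap,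
    h u α β hu hα hβ]
  ring

end Adjoints

/-! ### Differential functions with vanishing integrals are total derivatives. -/

section Primitives

variable {n : ℕ}

/-- The jet of the zero loop is the same at every point. -/
theorem IsDiffFun.apply_zero {F : (ℝ → Fin n → ℝ) → ℝ → ℝ} (hF : IsDiffFun F) (x y : ℝ) :
    F 0 x = F 0 y := by
  obtain ⟨f, hf⟩ := hF
  rw [hf 0 .zero, hf 0 .zero]
  exact congrArg f.toFun (funext fun k => by simp)

/-- The argument `u` is not scaled, so λ enters only through the coefficients, and each of these is
averaged separately. -/
theorem IsLinDiffOp.homotopy {ℓ : (ℝ → Fin n → ℝ) → (ℝ → Fin n → ℝ) → ℝ → ℝ}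
    (hl : IsLinDiffOp ℓ) : IsDiffFun fun u x => ∫ l in (0 : ℝ)..1, ℓ (l • u) u x := by
  have hc : ∀ {ℓ : (ℝ → Fin n → ℝ) → (ℝ → Fin n → ℝ) → ℝ → ℝ}, IsLinDiffOp ℓ →
      ∀ {u}, IsLoop u → ∀ x, Continuous fun l : ℝ => ℓ (l • u) u x := fun hl _ hu x =>
    ((hl.isSmoothFamily hu).contDiff_ray hu).continuous.comp
      (by fun_prop : Continuous fun l : ℝ => (l, x))
  refine (induction (p := fun ℓ => IsLinDiffOp ℓ ∧
    IsDiffFun fun u x => ∫ l in (0 : ℝ)..1, ℓ (l • u) u x) ?_ ?_ ?_ ?_ hl).2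
  · exact fun ℓ m h hm => ⟨h.1.congr hm, h.2.congr fun u hu x =>
      intervalIntegral.integral_congr fun l _ => hm _ _ (hu.smul l) hu x⟩
  · exact ⟨zero, by simpa using IsDiffFun.const 0⟩
  · exact fun ℓ m h1 h2 => ⟨h1.1.add h2.1, (h1.2.add h2.2).congr fun u hu x =>
      intervalIntegral.integral_add ((hc h1.1 hu x).intervalIntegrable _ _)
        ((hc h2.1 hu x).intervalIntegrable _ _)⟩
  · exact fun k b c h => ⟨mul h (iteratedDeriv_apply k b),
      (h.homotopy.mul (.iteratedDeriv_apply k b)).congr fun u _ x =>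
        intervalIntegral.integral_mul_const _ _⟩

theorem pairing_const_const (e c : Fin n → ℝ) : pairing (fun _ => e) (fun _ => c) = e ⬝ᵥ c := by
  simp [pairing]

theorem eq_zero_of_dotProduct_eq_zero {c : Fin n → ℝ} (h : ∀ e : Fin n → ℝ, e ⬝ᵥ c = 0) : c = 0 :=
  dotProduct_self_eq_zero.1 (h c)

/-- A matrix `M` vanishes if all the integrals of `M v` do. -/
theorem mulVec_eq_zero_of_pairing_const {M : DiffMat n} {u : ℝ → Fin n → ℝ} (hu : IsLoop u)
    (h : ∀ (e : Fin n → ℝ) (v : ℝ → Fin n → ℝ), IsLoop v →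
      pairing (fun _ => e) (fun x => M.eval u x *ᵥ v x) = 0) (x : ℝ) : M.eval u x = 0 := by
  have h1 : ∀ e : Fin n → ℝ, (M.eval u x)ᵀ *ᵥ e = 0 := fun e =>
    eq_zero_of_pairing_eq_zero (M.isMatDiffOp_transpose.isLoop hu (.const e)) (fun v hv => by
      rw [pairing_comm, ← pairing_mulVec, h e v hv]) x
  have h2 : (M.eval u x)ᵀ = 0 := Matrix.ext_of_mulVec_single fun i => by
    rw [h1, Matrix.zero_mulVec]
  simpa using congrArg Matrix.transpose h2

/-- A differential function whose integrals vanish is a total derivative. -/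
theorem IsDiffVec.exists_primitive {F : (ℝ → Fin n → ℝ) → ℝ → Fin n → ℝ} (hF : IsDiffVec F)
    (h : ∀ u, IsLoop u → ∀ e : Fin n → ℝ, pairing (fun _ => e) (F u) = 0) :
    ∃ B, IsDiffVec B ∧ ∀ u, IsLoop u → deriv (B u) = F u := by
  obtain ⟨M, R, hMR⟩ := hF.gateaux.exists_left_division
  have hR := IsMatDiffOp.app R
  have hG : ∀ u v, IsLoop u → IsLoop v → _root_.gateaux F u v = deriv (R.app u v) := by
    intro u v hu hv
    -- Differentiating the vanishing integrals in the direction `w` gives ∫ e · F'w = 0; the part ∂R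
    -- of F' integrates to zero by itself, leaving ∫ e · Mw = 0.
    have hM : ∀ x, M.eval u x = 0 := mulVec_eq_zero_of_pairing_const hu fun e w hw => by
      have h1 := (hF.isLoopMap.hasDerivAt_pairing_zero (.const e) hu hw).deriv
      simp only [h _ (hu.add (hw.smul _)), deriv_const] at h1
      have h2 := hR.isLoop hu hw
      rw [show _root_.gateaux F u w = (fun x => M.eval u x *ᵥ w x) + deriv (R.app u w) from
        funext (hMR u w hu hw), pairing_add_right continuous_const
        (M.isMatDiffOp.isLoop hu hw).continuous h2.deriv.continuous,
        pairing_const_deriv e h2, add_zero] at h1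
      exact h1.symm
    funext x
    rw [hMR u v hu hv, hM x, Matrix.zero_mulVec, zero_add]
  -- F(0) does not depend on x, and its mean is zero.
  have hF0 : F 0 = 0 := by
    have h1 : F 0 = fun _ => F 0 0 := funext fun x => funext fun a => (hF a).apply_zero x 0
    have h2 : F 0 0 = 0 := eq_zero_of_dotProduct_eq_zero fun e => by
      rw [← pairing_const_const, ← h1, h 0 .zero e]
    rw [h1, h2]
    rfl
  have hcont : ∀ {u}, IsLoop u → Continuous fun p : ℝ × ℝ => R.app (p.1 • u) u p.2 := fun hu =>
    ((hR.isLoopMap hu).1.contDiff_ray hu).continuous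
  have hB : IsDiffVec fun u x => ∫ l in (0 : ℝ)..1, R.app (l • u) u x := fun a =>
    (hR a).homotopy.congr fun u hu x => intervalIntegral_apply
      ((hcont hu).comp (by fun_prop : Continuous fun l : ℝ => (l, x))) a
  -- F(u) = F(u) - F(0) = ∫ F'_{λu}u dλ = ∂ ∫ R_{λu}u dλ. Pairing with `β` moves ∂ through the
  -- λ-integral.
  refine ⟨_, hB, fun u hu => funext fun x => ?_⟩
  refine eq_of_pairing_eq (hB.isLoop hu).deriv (hF.isLoop hu) (fun β hβ => ?_) x
  rw [pairing_deriv_right hβ (hB.isLoop hu),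
    IsLoopMap.pairing_integral (G := fun l => R.app (l • u) u) hβ.deriv (hcont hu),
    ← intervalIntegral.integral_neg]
  have h3 : ∀ l : ℝ, -pairing (deriv β) (R.app (l • u) u) =
      pairing β (_root_.gateaux F (l • u) u) := fun l => by
    rw [hG _ _ (hu.smul l) hu, pairing_deriv_right hβ (hR.isLoop (hu.smul l) hu)]
  simp only [h3]
  rw [intervalIntegral.integral_eq_sub_of_hasDerivAt
    (fun l _ => hF.isLoopMap.hasDerivAt_pairing_ray hβ hu l)
    ((hF.isLoopMap.continuous_pairing_gateaux_ray hβ hu hu).intervalIntegrable _ _), one_smul,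
    zero_smul, hF0]
  simp [pairing]

end Primitives

/-! ### The representation Q = AᵗP + PA + PΓP. -/

section Representation

variable {n : ℕ}

theorem DiffFun.euler_coord (a : Fin n) (u : ℝ → Fin n → ℝ) :
    (DiffFun.coord a).euler u = fun _ => Pi.single a 1 := by
  funext x c
  have hpd : ∀ (k : Fin 1) y, (DiffFun.coord a).pd k c u y = (Pi.single a 1 : Fin n → ℝ) c := by
    intro k y
    have hd : HasFDerivAt (fun j : Fin 1 → Fin n → ℝ => j 0 a)
        ((ContinuousLinearMap.proj (R := ℝ) (φ := fun _ : Fin n => ℝ) a).comp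
          (ContinuousLinearMap.proj (R := ℝ) (φ := fun _ : Fin 1 => Fin n → ℝ) 0))
        (fun k => iteratedDeriv (k : ℕ) u y) :=
      ((ContinuousLinearMap.proj (R := ℝ) (φ := fun _ : Fin n => ℝ) a).comp
        (ContinuousLinearMap.proj (R := ℝ) (φ := fun _ : Fin 1 => Fin n → ℝ) 0)).hasFDerivAt
    change fderiv ℝ (fun j : Fin 1 → Fin n → ℝ => j 0 a) (fun k => iteratedDeriv (k : ℕ) u y)
      (Pi.single k (Pi.single c 1) : Fin 1 → Fin n → ℝ) = _
    rw [hd.fderiv, Subsingleton.elim k 0]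
    simp [Pi.single_apply, eq_comm]
  change ∑ k : Fin 1, (-1) ^ (k : ℕ) *
    iteratedDeriv (k : ℕ) (fun y => (DiffFun.coord a).pd k c u y) x = _
  simp [hpd]

/-- The variational derivatives of the C^a are the constant basis covectors; linearity passes to
every constant `e`. -/
theorem CasimirsCommute.pairing_eq_zero {Q : DiffOp n} (hQ : CasimirsCommute Q)
    {u : ℝ → Fin n → ℝ} (hu : IsLoop u) (b : Fin n) (e : Fin n → ℝ) :
    pairing (fun _ => e) (Q.app u fun _ => Pi.single b 1) = 0 := by
  have hl := (IsMatDiffOp.app Q).isLoop hu (.const (Pi.single b 1))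
  have he : (fun _ : ℝ => e) =
      fun _ => ∑ a, (e a • fun _ : ℝ => (Pi.single a 1 : Fin n → ℝ)) 0 := by
    funext _ c
    simp [Finset.sum_apply, Pi.single_apply]
  rw [he, pairing_comm, pairing_sum_right (f := fun a _ =>
    (e a • fun _ : ℝ => (Pi.single a 1 : Fin n → ℝ)) 0) _ hl.continuous fun _ => continuous_const]
  refine Finset.sum_eq_zero fun a _ => ?_
  have h := hQ a b u hu
  rw [functionalBracket, DiffFun.euler_coord, DiffFun.euler_coord] at h
  rw [show (fun _ : ℝ => (e a • fun _ : ℝ => (Pi.single a 1 : Fin n → ℝ)) 0) =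
    e a • fun _ : ℝ => (Pi.single a 1 : Fin n → ℝ) from rfl, pairing_smul_right, pairing_comm, h,
    mul_zero]

/-- Division by `∂` from the right. -/
theorem IsLinDiffOp.exists_right_division {ℓ : (ℝ → Fin n → ℝ) → (ℝ → Fin n → ℝ) → ℝ → ℝ}
    (hl : IsLinDiffOp ℓ) :
    ∃ r, IsLinDiffOp r ∧ ∀ u φ, IsLoop u → IsLoop φ → ∀ x,
      ℓ u φ x = ∑ b, ℓ u (fun _ => Pi.single b 1) x * φ x b + r u (_root_.deriv φ) x := by
  refine induction (p := fun ℓ => ∃ r, IsLinDiffOp r ∧ ∀ u φ, IsLoop u → IsLoop φ → ∀ x,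
      ℓ u φ x = ∑ b, ℓ u (fun _ => Pi.single b 1) x * φ x b + r u (_root_.deriv φ) x)
    ?_ ?_ ?_ ?_ hl
  · rintro ℓ m ⟨r, hr, h⟩ hm
    refine ⟨r, hr, fun u φ hu hφ x => ?_⟩
    simp only [hm _ _ hu hφ, hm _ _ hu (.const _), h u φ hu hφ x]
  · exact ⟨_, zero, by simp⟩
  · rintro ℓ m ⟨r, hr, h⟩ ⟨r', hr', h'⟩
    refine ⟨_, hr.add hr', fun u φ hu hφ x => ?_⟩
    simp only [add_mul, Finset.sum_add_distrib]
    rw [h u φ hu hφ x, h' u φ hu hφ x]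
    ring
  -- A term of positive order kills constants and factors through ∂φ; a term of order zero is its
  -- own value on constants.
  · rintro (_ | k) b c hc
    · refine ⟨_, zero, fun u φ hu hφ x => ?_⟩
      simp [Pi.single_apply]
    · refine ⟨_, mul hc (iteratedDeriv_apply k b), fun u φ hu hφ x => ?_⟩
      simp [iteratedDeriv_const, iteratedDeriv_succ']

theorem iteratedDeriv_const_mulVec (M : Matrix (Fin n) (Fin n) ℝ) {α : ℝ → Fin n → ℝ}
    (hα : IsLoop α) (k : ℕ) :
    iteratedDeriv k (fun y => M *ᵥ α y) = fun x => M *ᵥ iteratedDeriv k α x := by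
  induction k with
  | zero => simp
  | succ k ih =>
    funext x
    rw [iteratedDeriv_succ, ih, deriv_const_mulVec M (hα.iteratedDeriv k), iteratedDeriv_succ]

theorem IsMatDiffOp.comp_mulVec {L : (ℝ → Fin n → ℝ) → (ℝ → Fin n → ℝ) → ℝ → Fin n → ℝ}
    (hL : IsMatDiffOp L) (M : Matrix (Fin n) (Fin n) ℝ) :
    IsMatDiffOp fun u φ => L u fun y => M *ᵥ φ y := fun a => by
  refine IsLinDiffOp.induction
    (p := fun ℓ => IsLinDiffOp fun u φ x => ℓ u (fun y => M *ᵥ φ y) x)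
    (fun ℓ m h hm => h.congr fun u φ hu hφ x => hm _ _ hu (hφ.mulVec M) x) .zero
    (fun _ _ h1 h2 => h1.add h2) (fun k b c hc => ?_) (hL a)
  refine (IsLinDiffOp.mul hc (IsLinDiffOp.sum Finset.univ fun j _ =>
    IsLinDiffOp.mul (.const (M b j)) (.iteratedDeriv_apply k j))).congr fun u φ _ hφ x => ?_
  beta_reduce
  rw [iteratedDeriv_const_mulVec M hφ]
  rfl

theorem IsMatDiffOp.pairing_eq_zero_of_disjoint
    {L : (ℝ → Fin n → ℝ) → (ℝ → Fin n → ℝ) → ℝ → Fin n → ℝ} (hL : IsMatDiffOp L)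
    {u a b : ℝ → Fin n → ℝ} (hu : IsLoop u) (hb : IsLoop b)
    (h : ∀ x, a =ᶠ[nhds x] 0 ∨ b =ᶠ[nhds x] 0) : pairing a (L u b) = 0 :=
  _root_.pairing_eq_zero_of_disjoint fun x => (h x).imp (fun h => h.eq_of_nhds) fun h =>
    hL.local_zero hu hb h

theorem deriv_eventuallyEq_zero {a : ℝ → Fin n → ℝ} {x : ℝ} (h : a =ᶠ[nhds x] 0) :
    deriv a =ᶠ[nhds x] 0 := by
  have := h.deriv
  rwa [show deriv (0 : ℝ → Fin n → ℝ) = 0 by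
    funext y
    exact deriv_const y (0 : Fin n → ℝ)] at this

/-- A differential function whose total derivative vanishes is constant. -/
theorem IsDiffVec.eq_const_of_deriv_eq_zero {F : (ℝ → Fin n → ℝ) → ℝ → Fin n → ℝ}
    (hF : IsDiffVec F) (h : ∀ u, IsLoop u → ∀ x, deriv (F u) x = 0) {u : ℝ → Fin n → ℝ}
    (hu : IsLoop u) (x : ℝ) : F u x = F 0 0 := by
  have hc : ∀ {u}, IsLoop u → ∀ x y, F u x = F u y := fun hu =>
    is_const_of_deriv_eq_zero (fun x => (hF.isLoop hu).differentiableAt x) (h _ hu)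
  have hloc : ∀ {u v : ℝ → Fin n → ℝ} {x}, IsLoop u → IsLoop v → u =ᶠ[nhds x] v →
      F u x = F v x := fun hu hv he => funext fun a => (hF a).local_eq hu hv he
  -- F(w) is constant along the circle; it equals F(u) at x and F(0) at x + 1/2, so `u` has no
  -- influence.
  obtain ⟨w, hw, h1, h2⟩ := exists_isLoop_eventuallyEq hu x
  rw [← hloc hw hu h1, hc hw x (x + 1 / 2), hloc hw .zero h2, hc .zero (x + 1 / 2) 0]

theorem exists_diffMat {A : (ℝ → Fin n → ℝ) → ℝ → Matrix (Fin n) (Fin n) ℝ}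
    (hA : ∀ a b, IsDiffFun fun u x => A u x a b) :
    ∃ M : DiffMat n, ∀ u, IsLoop u → ∀ x, M.eval u x = A u x := by
  choose f hf using hA
  exact ⟨Matrix.of f, fun u hu x => Matrix.ext fun a b => (hf a b u hu x).symm⟩

/-- If the functionals `C^a` commute, then `Q = ∂ B + Bᵗ ∂ + C ∂ + ∂ S ∂`. -/
theorem CasimirsCommute.exists_decomposition {Q : DiffOp n} (hQ : CasimirsCommute Q) :
    ∃ (B C : DiffMat n) (S : DiffOp n), ∀ u φ, IsLoop u → IsLoop φ → ∀ x,
      Q.app u φ x = deriv (fun y => B.eval u y *ᵥ φ y) x + (B.eval u x)ᵀ *ᵥ deriv φ x +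
        C.eval u x *ᵥ deriv φ x + deriv (S.app u (deriv φ)) x := by
  have hQ' := IsMatDiffOp.app Q
  -- The columns of B are primitives of the images Q e_c of the constant basis covectors.
  choose b hb hbQ using fun c : Fin n => (hQ'.isDiffVec_const (Pi.single c 1)).exists_primitive
    fun u hu e => hQ.pairing_eq_zero hu c e
  obtain ⟨B, hB⟩ := exists_diffMat (A := fun u x => Matrix.of fun a c => b c u x a)
    fun a c => hb c a
  choose r hr hrQ using fun a => (hQ' a).exists_right_division
  have hr' : IsMatDiffOp fun u φ x a => r a u φ x := hr
  -- Q = (∂B) + r∂ with ∂B taken entrywise, and (∂B)φ = ∂(Bφ) - B∂φ; splitting off the skew operator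
  -- ∂B + Bᵗ∂ leaves (r - B - Bᵗ)∂, whose first factor is divided by ∂ from the left.
  obtain ⟨C, S, hCS⟩ := (hr'.add ((B.isMatDiffOp.neg).add
    B.isMatDiffOp_transpose.neg)).exists_left_division
  refine ⟨B, C, S, fun u φ hu hφ x => ?_⟩
  have hd : HasDerivAt (fun y => B.eval u y *ᵥ φ y)
      ((Matrix.of fun a c => Q.app u (fun _ => Pi.single c 1) x a) *ᵥ φ x +
        B.eval u x *ᵥ deriv φ x) x := by
    refine hasDerivAt_pi.2 fun a => ?_
    simp only [Matrix.mulVec, dotProduct, Pi.add_apply, ← Finset.sum_add_distrib, hB u hu,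
      Matrix.of_apply, ← hbQ _ u hu]
    exact HasDerivAt.fun_sum fun c _ =>
      (hasDerivAt_pi.1 (((hb c).isLoop hu).differentiableAt x).hasDerivAt a).mul
        (hasDerivAt_pi.1 (hφ.differentiableAt x).hasDerivAt c)
  have h1 : Q.app u φ x = (Matrix.of fun a c => Q.app u (fun _ => Pi.single c 1) x a) *ᵥ φ x +
      fun a => r a u (deriv φ) x := funext fun a => hrQ a u φ hu hφ x
  have h2 := hCS u (deriv φ) hu hφ.deriv x
  rw [hd.deriv, h1, add_assoc _ _ (deriv _ x), add_assoc _ _ (_ + deriv _ x), ← h2]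
  abel

/-- The remaining constant and operator in the decomposition of a skewsymmetric operator are
symmetric and skewsymmetric. -/
theorem DiffOp.IsSkew.decomposition_symm {Q : DiffOp n} (hQ : Q.IsSkew) {B C : DiffMat n}
    {S : DiffOp n} (h : ∀ u φ, IsLoop u → IsLoop φ → ∀ x,
      Q.app u φ x = deriv (fun y => B.eval u y *ᵥ φ y) x + (B.eval u x)ᵀ *ᵥ deriv φ x +
        C.eval u x *ᵥ deriv φ x + deriv (S.app u (deriv φ)) x) :
    (∀ u, IsLoop u → ∀ x, C.eval u x = C.eval 0 0) ∧ (C.eval 0 0)ᵀ = C.eval 0 0 ∧ S.IsSkew := by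
  have hS := IsMatDiffOp.app S
  have weak : ∀ {u β φ : ℝ → Fin n → ℝ}, IsLoop u → IsLoop β → IsLoop φ →
      pairing β (Q.app u φ) = -pairing (deriv β) (fun x => B.eval u x *ᵥ φ x) +
        pairing (deriv φ) (fun x => B.eval u x *ᵥ β x) +
        pairing β (fun x => C.eval u x *ᵥ deriv φ x) -
        pairing (deriv β) (S.app u (deriv φ)) := by
    intro u β φ hu hβ hφ
    have h1 := B.isMatDiffOp.isLoop hu hφ
    have h2 := B.isMatDiffOp_transpose.isLoop hu hφ.deriv
    have h3 := C.isMatDiffOp.isLoop hu hφ.deriv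
    have h4 := hS.isLoop hu hφ.deriv
    rw [show Q.app u φ = ((deriv fun y => B.eval u y *ᵥ φ y) +
      (fun x => (B.eval u x)ᵀ *ᵥ deriv φ x) + fun x => C.eval u x *ᵥ deriv φ x) +
      deriv (S.app u (deriv φ)) from funext (h u φ hu hφ),
      pairing_add_right hβ.continuous ((h1.deriv.add h2).add h3).continuous h4.deriv.continuous,
      pairing_add_right hβ.continuous (h1.deriv.add h2).continuous h3.continuous,
      pairing_add_right hβ.continuous h1.deriv.continuous h2.continuous,
      pairing_deriv_right hβ h1, pairing_deriv_right hβ h4, pairing_mulVec (fun x => (B.eval u x)ᵀ)]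
    simp only [Matrix.transpose_transpose]
    rw [pairing_comm (fun x => B.eval u x *ᵥ β x)]
    ring
  have skew : ∀ {u β φ : ℝ → Fin n → ℝ}, IsLoop u → IsLoop β → IsLoop φ →
      pairing β (fun x => C.eval u x *ᵥ deriv φ x) +
        pairing φ (fun x => C.eval u x *ᵥ deriv β x) =
      pairing (deriv β) (S.app u (deriv φ)) + pairing (deriv φ) (S.app u (deriv β)) := by
    intro u β φ hu hβ hφ
    have := (Q.isSkew_iff.1 hQ) u β φ hu hβ hφ
    rw [weak hu hβ hφ, weak hu hφ hβ] at this
    linarith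
  have hd0 : ∀ e : Fin n → ℝ, deriv (fun _ : ℝ => e) = 0 := fun e =>
    funext fun x => deriv_const x e
  have h0 : ∀ v : ℝ → Fin n → ℝ, pairing v 0 = 0 ∧ pairing 0 v = 0 := fun v => by
    simp [pairing]
  have hconst : ∀ u, IsLoop u → ∀ x, C.eval u x = C.eval 0 0 := by
    intro u hu x
    -- Against a constant `e` the terms with S disappear, and skewness reduces to ∂(Cᵗe) = 0; a
    -- differential function with zero total derivative is a constant.
    have key : ∀ e : Fin n → ℝ, (C.eval u x)ᵀ *ᵥ e = (C.eval 0 0)ᵀ *ᵥ e := by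
      intro e
      refine IsDiffVec.eq_const_of_deriv_eq_zero (F := fun u x => (C.eval u x)ᵀ *ᵥ e)
        (C.isMatDiffOp_transpose.isDiffVec_const e) (fun u hu x => ?_) hu x
      have hl := C.isMatDiffOp_transpose.isLoop hu (.const e)
      refine eq_zero_of_pairing_eq_zero hl.deriv (fun φ hφ => ?_) x
      have := skew hu (.const e) hφ
      simp only [hd0, hS.map_zero hu, Pi.zero_apply, Matrix.mulVec_zero] at this
      rw [show (fun _ : ℝ => (0 : Fin n → ℝ)) = 0 from rfl, (h0 _).1, (h0 _).1, (h0 _).2,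
        pairing_mulVec, add_zero, add_zero] at this
      rw [pairing_deriv_right hφ hl, pairing_comm, this, neg_zero]
    have h2 : (C.eval u x)ᵀ = (C.eval 0 0)ᵀ := Matrix.ext_of_mulVec_single fun i => key _
    simpa using congrArg Matrix.transpose h2
  set N := C.eval 0 0 - (C.eval 0 0)ᵀ with hN
  have hmix : ∀ {u β φ : ℝ → Fin n → ℝ}, IsLoop u → IsLoop β → IsLoop φ →
      pairing β (fun x => N *ᵥ deriv φ x) =
        pairing (deriv β) (S.app u (deriv φ)) + pairing (deriv φ) (S.app u (deriv β)) := by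
    intro u β φ hu hβ hφ
    rw [← skew hu hβ hφ]
    simp only [hconst u hu]
    rw [show (fun x => N *ᵥ deriv φ x) = (fun x => C.eval 0 0 *ᵥ deriv φ x) -
      fun x => (C.eval 0 0)ᵀ *ᵥ deriv φ x by funext x; simp [hN, Matrix.sub_mulVec],
      pairing_sub_right hβ.continuous (hφ.deriv.mulVec _).continuous
        (hφ.deriv.mulVec _).continuous, pairing_mulVec (fun _ => (C.eval 0 0)ᵀ)]
    simp only [Matrix.transpose_transpose]
    rw [show (fun x => C.eval 0 0 *ᵥ deriv β x) = deriv (fun x => C.eval 0 0 *ᵥ β x) from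
      funext fun x => (deriv_const_mulVec _ hβ x).symm, pairing_deriv_right hφ (hβ.mulVec _),
      pairing_comm (deriv φ)]
    ring
  have hmulVec : ∀ M : Matrix (Fin n) (Fin n) ℝ,
      IsMatDiffOp fun (_ φ : ℝ → Fin n → ℝ) x => M *ᵥ φ x := fun M =>
    IsMatDiffOp.mulVec (A := fun _ _ => M) (fun a b => .const _) .id
  -- Locality replaces the derivative ∂φ by an arbitrary `w`, in particular by constants.
  have hext : ∀ {u β w : ℝ → Fin n → ℝ}, IsLoop u → IsLoop β → IsLoop w →
      pairing β (fun x => N *ᵥ w x) - (pairing (deriv β) (S.app u w) +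
        pairing w (S.app u (deriv β))) = 0 := by
    intro u β w hu hβ hw
    refine local_biadditive_eq_zero (fun β w => pairing β (fun x => N *ᵥ w x) -
      (pairing (deriv β) (S.app u w) + pairing w (S.app u (deriv β)))) ?_ ?_ ?_ ?_ β w hβ hw
    · intro a b c ha hb hc
      have hab : deriv (a + b) = deriv a + deriv b := funext fun x =>
        deriv_add (ha.differentiableAt x) (hb.differentiableAt x)
      have hSc := (hS.isLoop hu hc).continuous
      rw [hab, hS.map_add hu ha.deriv hb.deriv, pairing_add_left ha.continuous hb.continuous
        (hc.mulVec N).continuous, pairing_add_left ha.deriv.continuous hb.deriv.continuous hSc,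
        pairing_add_right hc.continuous (hS.isLoop hu ha.deriv).continuous
          (hS.isLoop hu hb.deriv).continuous]
      ring
    · intro a b c ha hb hc
      rw [show (fun x => N *ᵥ (b + c) x) = (fun x => N *ᵥ b x) + fun x => N *ᵥ c x by
        funext x; simp [Matrix.mulVec_add], pairing_add_right ha.continuous
        (hb.mulVec N).continuous (hc.mulVec N).continuous, hS.map_add hu hb hc,
        pairing_add_right ha.deriv.continuous (hS.isLoop hu hb).continuous
          (hS.isLoop hu hc).continuous,
        pairing_add_left hb.continuous hc.continuous (hS.isLoop hu ha.deriv).continuous]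
      ring
    · intro a b ha hb hab
      rw [(hmulVec N).pairing_eq_zero_of_disjoint (L := fun _ φ x => N *ᵥ φ x) hu hb hab,
        hS.pairing_eq_zero_of_disjoint hu hb fun x => (hab x).imp_left deriv_eventuallyEq_zero,
        hS.pairing_eq_zero_of_disjoint hu ha.deriv fun x =>
          ((hab x).imp_left deriv_eventuallyEq_zero).symm]
      simp
    · intro a b ha hb
      rw [hmix hu ha hb, sub_self]
  -- With both arguments constant only e · N e_i survives.
  have hN0 : N = 0 := Matrix.ext_of_mulVec_single fun i => by
    rw [Matrix.zero_mulVec]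
    refine eq_zero_of_dotProduct_eq_zero fun e => ?_
    have := hext IsLoop.zero (.const e) (.const (Pi.single i 1))
    rwa [hd0, hS.map_zero .zero, (h0 _).1, (h0 _).2, add_zero, sub_zero, pairing_const_const]
      at this
  refine ⟨hconst, (sub_eq_zero.1 hN0).symm, S.isSkew_iff.2 fun u v w hu hv hw => ?_⟩
  -- Now that N = 0, `hext` is skewness of S with one argument a derivative; a second use of
  -- locality frees that argument as well.
  rw [← add_eq_zero_iff_eq_neg]
  refine local_biadditive_eq_zero (fun v w => pairing v (S.app u w) + pairing w (S.app u v))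
    ?_ ?_ ?_ ?_ v w hv hw
  · intro a b c ha hb hc
    rw [hS.map_add hu ha hb, pairing_add_left ha.continuous hb.continuous
      (hS.isLoop hu hc).continuous, pairing_add_right hc.continuous (hS.isLoop hu ha).continuous
      (hS.isLoop hu hb).continuous]
    ring
  · intro a b c ha hb hc
    rw [hS.map_add hu hb hc, pairing_add_left hb.continuous hc.continuous
      (hS.isLoop hu ha).continuous, pairing_add_right ha.continuous (hS.isLoop hu hb).continuous
      (hS.isLoop hu hc).continuous]
    ring
  · intro a b ha hb hab
    rw [hS.pairing_eq_zero_of_disjoint hu hb hab,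
      hS.pairing_eq_zero_of_disjoint hu ha fun x => (hab x).symm, add_zero]
  · intro a b ha hb
    have := hext hu hb ha
    rw [hN0] at this
    simp only [Matrix.zero_mulVec] at this
    rw [show (fun _ : ℝ => (0 : Fin n → ℝ)) = 0 from rfl, (h0 _).1] at this
    linarith

/-- If the functionals `C^a` commute, then `Q = Aᵗ P + P A + P Γ P`. -/
theorem exists_isRepresentation {g : Matrix (Fin n) (Fin n) ℝ} (hg : g.IsSymm)
    (hreg : IsUnit g.det) {Q : DiffOp n} (hskew : Q.IsSkew) (hQ : CasimirsCommute Q) :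
    ∃ (A : DiffMat n) (Γ : DiffOp n), IsRepresentation (DiffOp.hydro g) Q A Γ := by
  obtain ⟨B, C, S, h⟩ := hQ.exists_decomposition
  obtain ⟨hC, hCt, hS⟩ := hskew.decomposition_symm h
  -- The constant symmetric C is shared equally: AᵗP and PA each contribute (1/2) C∂.
  obtain ⟨A, hA⟩ := exists_diffMat (A := fun u x => g⁻¹ * (B.eval u x + (1 / 2 : ℝ) • C.eval u x))
    fun a b => IsDiffFun.congr (IsDiffFun.sum Finset.univ fun j _ => (IsDiffFun.const (g⁻¹ a j)).mul
      ((B.isDiffFun j b).add ((IsDiffFun.const (1 / 2)).mul (C.isDiffFun j b))))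
      fun u _ x => by simp [Matrix.mul_apply]
  have hSop := IsMatDiffOp.app S
  have hΓop : IsMatDiffOp fun u φ x => g⁻¹ *ᵥ S.app u (fun y => g⁻¹ *ᵥ φ y) x :=
    IsMatDiffOp.mulVec (A := fun _ _ => g⁻¹) (fun a b => .const _) (hSop.comp_mulVec g⁻¹)
  obtain ⟨Γ, hΓ⟩ := hΓop.exists_app
  have hgt : (g⁻¹)ᵀ = g⁻¹ := by rw [Matrix.transpose_nonsing_inv, hg.eq]
  refine ⟨A, Γ, Γ.isSkew_iff.2 fun u v w hu hv hw => ?_, fun u α hu hα x => ?_⟩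
  · rw [hΓ u w hu hw, hΓ u v hu hv, pairing_mulVec, pairing_mulVec, hgt]
    exact (S.isSkew_iff.1 hS) u _ _ hu (hv.mulVec _) (hw.mulVec _)
  · have h1 : (A.eval u x)ᵀ *ᵥ hydroMap g α x =
        (B.eval u x)ᵀ *ᵥ deriv α x + (1 / 2 : ℝ) • (C.eval 0 0 *ᵥ deriv α x) := by
      rw [hA u hu, hC u hu, hydroMap, Matrix.mulVec_mulVec, Matrix.transpose_mul, hgt,
        Matrix.mul_assoc, Matrix.nonsing_inv_mul _ hreg, Matrix.mul_one, Matrix.transpose_add,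
        Matrix.transpose_smul, hCt, Matrix.add_mulVec, Matrix.smul_mulVec]
    have hB := B.isMatDiffOp.isLoop hu hα
    have h2 : hydroMap g (fun y => A.eval u y *ᵥ α y) x =
        deriv (fun y => B.eval u y *ᵥ α y) x + (1 / 2 : ℝ) • (C.eval 0 0 *ᵥ deriv α x) := by
      have hl := hB.add ((hα.mulVec (C.eval 0 0)).smul (1 / 2))
      have he : (fun y => A.eval u y *ᵥ α y) = fun y => g⁻¹ *ᵥ ((fun y => B.eval u y *ᵥ α y) +
          (1 / 2 : ℝ) • fun y => C.eval 0 0 *ᵥ α y) y := by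
        funext y
        rw [hA u hu, hC u hu, ← Matrix.mulVec_mulVec, Matrix.add_mulVec, Matrix.smul_mulVec]
        rfl
      rw [he, hydroMap_inv_mulVec hreg hl, deriv_add (hB.differentiableAt x)
        (((hα.mulVec _).smul _).differentiableAt x),
        deriv_const_smul _ ((hα.mulVec _).differentiableAt x), deriv_const_mulVec _ hα]
    have h3 : hydroMap g (Γ.app u (hydroMap g α)) x = deriv (S.app u (deriv α)) x := by
      rw [hΓ u _ hu hα.hydroMap, show (fun y => g⁻¹ *ᵥ hydroMap g α y) = deriv α by
        funext y
        rw [hydroMap, Matrix.mulVec_mulVec, Matrix.nonsing_inv_mul _ hreg, Matrix.one_mulVec],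
        hydroMap_inv_mulVec hreg (hSop.isLoop hu hα.deriv)]
    rw [hydro_app, hydro_app, hydro_app, h1, h2, h3, h u α hu hα, hC u hu]
    have h4 : C.eval 0 0 *ᵥ deriv α x = (1 / 2 : ℝ) • (C.eval 0 0 *ᵥ deriv α x) +
        (1 / 2 : ℝ) • (C.eval 0 0 *ᵥ deriv α x) := by
      rw [← add_smul]
      norm_num
    nth_rewrite 1 [h4]
    abel

end Representation

/-! ### Local bilinear forms and the closedness of the columns of A. -/

section Closedness

variable {n : ℕ}

/-- A local additive map on loops. -/
structure IsLocalMap (L : (ℝ → Fin n → ℝ) → ℝ → Fin n → ℝ) : Prop where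
  isLoop : ∀ a, IsLoop a → IsLoop (L a)
  map_add : ∀ a b, IsLoop a → IsLoop b → L (a + b) = L a + L b
  local_zero : ∀ a x, IsLoop a → a =ᶠ[nhds x] 0 → L a x = 0

namespace IsLocalMap

variable {L M : (ℝ → Fin n → ℝ) → ℝ → Fin n → ℝ}

theorem sub (hL : IsLocalMap L) (hM : IsLocalMap M) : IsLocalMap fun a => L a - M a where
  isLoop a ha := (hL.isLoop a ha).sub (hM.isLoop a ha)
  map_add a b ha hb := by
    rw [hL.map_add a b ha hb, hM.map_add a b ha hb]
    abel
  local_zero a x ha h := by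
    rw [Pi.sub_apply, hL.local_zero a x ha h, hM.local_zero a x ha h, sub_zero]

theorem neg (hL : IsLocalMap L) : IsLocalMap fun a => -L a where
  isLoop a ha := (hL.isLoop a ha).neg
  map_add a b ha hb := by
    rw [hL.map_add a b ha hb]
    abel
  local_zero a x ha h := by rw [Pi.neg_apply, hL.local_zero a x ha h, neg_zero]

theorem pairing_eq_zero (hL : IsLocalMap L) {a b : ℝ → Fin n → ℝ} (hb : IsLoop b)
    (h : ∀ x, a =ᶠ[nhds x] 0 ∨ b =ᶠ[nhds x] 0) : pairing a (L b) = 0 :=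
  pairing_eq_zero_of_disjoint fun x => (h x).imp (fun h => h.eq_of_nhds) (hL.local_zero b x hb)

/-- A local bilinear form which vanishes on derivatives of loops vanishes. -/
theorem form_eq_zero (hL : IsLocalMap L) (hM : IsLocalMap M)
    (h : ∀ a b, IsLoop a → IsLoop b →
      pairing (deriv a) (L (deriv b)) + pairing (deriv b) (M (deriv a)) = 0)
    {v w : ℝ → Fin n → ℝ} (hv : IsLoop v) (hw : IsLoop w) :
    pairing v (L w) + pairing w (M v) = 0 := by
  have add₁ : ∀ a b c, IsLoop a → IsLoop b → IsLoop c → pairing (a + b) (L c) +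
      pairing c (M (a + b)) = (pairing a (L c) + pairing c (M a)) +
        (pairing b (L c) + pairing c (M b)) := by
    intro a b c ha hb hc
    rw [hM.map_add a b ha hb, pairing_add_left ha.continuous hb.continuous
      (hL.isLoop c hc).continuous, pairing_add_right hc.continuous (hM.isLoop a ha).continuous
      (hM.isLoop b hb).continuous]
    ring
  have add₂ : ∀ a b c, IsLoop a → IsLoop b → IsLoop c → pairing a (L (b + c)) +
      pairing (b + c) (M a) = (pairing a (L b) + pairing b (M a)) +
        (pairing a (L c) + pairing c (M a)) := by
    intro a b c ha hb hc
    rw [hL.map_add b c hb hc, pairing_add_left hb.continuous hc.continuous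
      (hM.isLoop a ha).continuous, pairing_add_right ha.continuous (hL.isLoop b hb).continuous
      (hL.isLoop c hc).continuous]
    ring
  have loc : ∀ a b, IsLoop a → IsLoop b → (∀ x, a =ᶠ[nhds x] 0 ∨ b =ᶠ[nhds x] 0) →
      pairing a (L b) + pairing b (M a) = 0 := fun a b ha hb hab => by
    rw [hL.pairing_eq_zero hb hab, hM.pairing_eq_zero ha fun x => (hab x).symm, add_zero]
  -- Locality is applied to one argument at a time: here the second is freed with the first still a
  -- derivative.
  have half : ∀ a w, IsLoop a → IsLoop w →
      pairing (deriv a) (L w) + pairing w (M (deriv a)) = 0 := by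
    refine local_biadditive_eq_zero (fun a w => pairing (deriv a) (L w) + pairing w (M (deriv a)))
      (fun a b c ha hb hc => ?_) (fun a b c ha hb hc => add₂ _ b c ha.deriv hb hc)
      (fun a b ha hb hab => loc _ b ha.deriv hb fun x => (hab x).imp_left deriv_eventuallyEq_zero) h
    have hab : deriv (a + b) = deriv a + deriv b := funext fun x =>
      deriv_add (ha.differentiableAt x) (hb.differentiableAt x)
    rw [hab, add₁ _ _ c ha.deriv hb.deriv hc]
  exact local_biadditive_eq_zero (fun w v => pairing v (L w) + pairing w (M v))
    (fun a b c ha hb hc => add₂ c a b hc ha hb) (fun a b c ha hb hc => add₁ b c a hb hc ha)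
    (fun a b ha hb hab => loc b a hb ha fun x => (hab x).symm)
    (fun a b ha hb => half b a hb ha) w v hw hv

end IsLocalMap

theorem HasDerivAt.eq_of_forall_eq {f g : ℝ → ℝ} {f' g' x : ℝ} (hf : HasDerivAt f f' x)
    (hg : HasDerivAt g g' x) (h : ∀ s, f s = g s) : f' = g' := by
  obtain rfl : f = g := funext h
  exact hf.unique hg

theorem gateaux_zero {F : (ℝ → Fin n → ℝ) → ℝ → Fin n → ℝ} (u : ℝ → Fin n → ℝ) :
    gateaux F u 0 = 0 := by
  funext x
  simp [gateaux]

namespace IsLoopMap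

variable {F : (ℝ → Fin n → ℝ) → ℝ → Fin n → ℝ}

theorem hasDerivAt_gateaux (hF : IsLoopMap F) {u v : ℝ → Fin n → ℝ} (hu : IsLoop u)
    (hv : IsLoop v) (x : ℝ) :
    HasDerivAt (fun s : ℝ => F (u + s • v) x) (gateaux F u v x) 0 := by
  simpa using hF.1.hasDerivAt_line hu hv 0 x

theorem gateaux_apply (hF : IsLoopMap F) {u v : ℝ → Fin n → ℝ} (hu : IsLoop u)
    (hv : IsLoop v) (x : ℝ) (a : Fin n) :
    gateaux F u v x a = gateaux (fun u x => F u x a) u v x :=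
  (hasDerivAt_pi.1 (hF.hasDerivAt_gateaux hu hv x) a).deriv.symm

end IsLoopMap

namespace IsMatDiffOp

variable {L : (ℝ → Fin n → ℝ) → (ℝ → Fin n → ℝ) → ℝ → Fin n → ℝ} {u v w : ℝ → Fin n → ℝ}

theorem isLocalMap (hL : IsMatDiffOp L) (hu : IsLoop u) : IsLocalMap (L u) where
  isLoop _ ha := hL.isLoop hu ha
  map_add _ _ ha hb := hL.map_add hu ha hb
  local_zero _ _ ha h := hL.local_zero hu ha h

/-- `z ↦ L'_u(w; z)` is local. -/
theorem isLocalMap_gateaux_direction (hL : IsMatDiffOp L) (hu : IsLoop u) (hw : IsLoop w) :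
    IsLocalMap fun z => gateaux (fun u => L u w) u z where
  isLoop _ hz := (hL.isLoopMap hw).isLoop_gateaux hu hz
  map_add _ _ ha hb := (hL.isLoopMap hw).gateaux_add hu ha hb
  local_zero z x hz h := by
    have : (fun s : ℝ => L (u + s • z) w x) = fun _ => L u w x := funext fun s =>
      hL.local_eq (hu.add (hz.smul s)) hu hw hw (by
        filter_upwards [h] with y hy
        simp [hy]) .rfl
    rw [gateaux, this, deriv_const]

/-- `v ↦ L'_u(v; w)` is local. -/
theorem isLocalMap_gateaux_argument (hL : IsMatDiffOp L) (hu : IsLoop u) (hw : IsLoop w) :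
    IsLocalMap fun v => gateaux (fun u => L u v) u w where
  isLoop _ hv := (hL.isLoopMap hv).isLoop_gateaux hu hw
  map_add a b ha hb := by
    funext x
    have h := ((hL.isLoopMap ha).hasDerivAt_gateaux hu hw x).add
      ((hL.isLoopMap hb).hasDerivAt_gateaux hu hw x)
    refine Eq.trans ?_ h.deriv
    exact congrArg (fun f => deriv f 0) (funext fun s =>
      congrFun (hL.map_add (hu.add (hw.smul s)) ha hb) x)
  local_zero v x hv h := by
    have : (fun s : ℝ => L (u + s • w) v x) = fun _ => 0 := funext fun s =>
      hL.local_zero (hu.add (hw.smul s)) hv h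
    rw [gateaux, this, deriv_const]

theorem gateaux_smul_argument (hL : IsMatDiffOp L) (hu : IsLoop u) (hv : IsLoop v)
    (hw : IsLoop w) (r : ℝ) :
    gateaux (fun u => L u (r • v)) u w = r • gateaux (fun u => L u v) u w := by
  funext x
  have h := ((hL.isLoopMap hv).hasDerivAt_gateaux hu hw x).const_smul r
  refine Eq.trans ?_ h.deriv
  exact congrArg (fun f => deriv f 0) (funext fun s =>
    congrFun (hL.map_smul (hu.add (hw.smul s)) hv r) x)

/-- The derivative of `u ↦ L_u u`. -/
theorem gateaux_self (hL : IsMatDiffOp L) (hu : IsLoop u) (hv : IsLoop v) :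
    gateaux (fun u => L u u) u v = gateaux (fun w => L w u) u v + L u v := by
  funext x
  -- L_{u+sv}(u + sv) = L_{u+sv}u + s L_{u+sv}v, and the explicit factor s leaves L_u v at s = 0.
  have h := ((hL.isLoopMap hu).hasDerivAt_gateaux hu hv x).add
    ((hasDerivAt_id (0 : ℝ)).smul ((hL.isLoopMap hv).hasDerivAt_gateaux hu hv x))
  simp only [zero_smul, add_zero, one_smul] at h
  refine Eq.trans ?_ (h.deriv.trans (by simp))
  refine congrArg (fun f => deriv f 0) (funext fun s => ?_)
  have hs := hu.add (hv.smul s)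
  beta_reduce
  rw [hL.map_add hs hu (hv.smul s), hL.map_smul hs hv]
  rfl

end IsMatDiffOp

theorem IsDiffVec.gateaux_gateaux_comm {F : (ℝ → Fin n → ℝ) → ℝ → Fin n → ℝ} (hF : IsDiffVec F)
    {u v w : ℝ → Fin n → ℝ} (hu : IsLoop u) (hv : IsLoop v) (hw : IsLoop w) :
    _root_.gateaux (fun u => _root_.gateaux F u v) u w =
      _root_.gateaux (fun u => _root_.gateaux F u w) u v := by
  have key : ∀ {v w}, IsLoop v → IsLoop w → ∀ x a,
      _root_.gateaux (fun u => _root_.gateaux F u v) u w x a =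
        _root_.gateaux (fun u => _root_.gateaux (fun u x => F u x a) u v) u w x := by
    intro v w hv hw x a
    rw [(hF.gateaux.isLoopMap hv).gateaux_apply hu hw]
    exact congrArg (fun f => deriv f 0) (funext fun s =>
      hF.gateaux_apply (hu.add (hw.smul s)) hv x a)
  funext x a
  rw [key hv hw, key hw hv, _root_.gateaux_gateaux_comm (hF a) hu hv hw]

section

variable {g : Matrix (Fin n) (Fin n) ℝ} {Q Γ : DiffOp n} {A : DiffMat n}

/-- The representation `Q = Aᵗ P + P A + P Γ P` in terms of the pairing. -/
theorem IsRepresentation.pairing_app (h : IsRepresentation (DiffOp.hydro g) Q A Γ) (hg : g.IsSymm)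
    {u α β : ℝ → Fin n → ℝ} (hu : IsLoop u) (hα : IsLoop α) (hβ : IsLoop β) :
    pairing β (Q.app u α) = pairing (hydroMap g α) (fun x => A.eval u x *ᵥ β x) -
      pairing (hydroMap g β) (fun x => A.eval u x *ᵥ α x) -
      pairing (hydroMap g β) (Γ.app u (hydroMap g α)) := by
  have h1 := A.isMatDiffOp_transpose.isLoop hu (hα.hydroMap (g := g))
  have h2 := A.isMatDiffOp.isLoop hu hα
  have h3 := (IsMatDiffOp.app Γ).isLoop hu (hα.hydroMap (g := g))
  have hQ : Q.app u α = ((fun x => (A.eval u x)ᵀ *ᵥ hydroMap g α x) +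
      hydroMap g (fun y => A.eval u y *ᵥ α y)) + hydroMap g (Γ.app u (hydroMap g α)) := by
    funext x
    rw [h.2 u α hu hα x]
    simp only [hydro_app]
    rfl
  rw [hQ, pairing_add_right hβ.continuous (h1.add h2.hydroMap).continuous h3.hydroMap.continuous,
    pairing_add_right hβ.continuous h1.continuous h2.hydroMap.continuous,
    pairing_hydroMap hg hβ h2, pairing_hydroMap hg hβ h3,
    pairing_mulVec (fun x => (A.eval u x)ᵀ)]
  simp only [Matrix.transpose_transpose]
  rw [pairing_comm (fun x => A.eval u x *ᵥ β x)]
  ring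

/-- The columns of `A` are closed `1`-forms. -/
theorem IsRepresentation.closed (h : IsRepresentation (DiffOp.hydro g) Q A Γ) (hg : g.IsSymm)
    (hreg : IsUnit g.det) (hQ : IsCocycle (DiffOp.hydro g) Q) (e : Fin n → ℝ)
    {u v w : ℝ → Fin n → ℝ} (hu : IsLoop u) (hv : IsLoop v) (hw : IsLoop w) :
    pairing v (gateaux (fun u x => A.eval u x *ᵥ e) u w) =
      pairing w (gateaux (fun u x => A.eval u x *ᵥ e) u v) := by
  set a : (ℝ → Fin n → ℝ) → ℝ → Fin n → ℝ := fun u x => A.eval u x *ᵥ e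
  have ha : IsDiffVec a := A.isMatDiffOp.isDiffVec_const e
  have hΓ := IsMatDiffOp.app Γ
  have h0 : ∀ v : ℝ → Fin n → ℝ, pairing v 0 = 0 ∧ pairing 0 v = 0 := fun v => by
    simp [pairing]
  have hP : ∀ β γ : ℝ → Fin n → ℝ, IsLoop β → IsLoop γ →
      pairing (hydroMap g β) (gateaux a u (hydroMap g γ)) =
        pairing (hydroMap g γ) (gateaux a u (hydroMap g β)) := by
    intro β γ hβ hγ
    -- Since Pe = 0, one cyclic term vanishes; in the other two, ⟨e, Qβ⟩ and ⟨γ, Qe⟩ involve only `A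
    -- e`, because every other term contains Pe.
    have hc := hQ.cyclic_sum hu (.const e) hβ hγ
    rw [hydroMap_const, gateaux_zero, (h0 _).1, add_zero] at hc
    have h1 : pairing (fun _ => e) (gateaux (fun u => Q.app u β) u (hydroMap g γ)) =
        pairing (hydroMap g β) (gateaux a u (hydroMap g γ)) := by
      refine (((IsMatDiffOp.app Q).isLoopMap hβ).hasDerivAt_pairing_zero (.const e) hu
        hγ.hydroMap).eq_of_forall_eq
        (ha.isLoopMap.hasDerivAt_pairing_zero (hβ.hydroMap (g := g)) hu hγ.hydroMap) fun s => ?_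
      rw [h.pairing_app hg (hu.add (hγ.hydroMap.smul s)) hβ (.const e), hydroMap_const,
        (h0 _).2, (h0 _).2, sub_zero, sub_zero]
    have h2 : pairing γ (gateaux (fun u => Q.app u fun _ => e) u (hydroMap g β)) =
        -pairing (hydroMap g γ) (gateaux a u (hydroMap g β)) := by
      refine (((IsMatDiffOp.app Q).isLoopMap (.const e)).hasDerivAt_pairing_zero hγ hu
        hβ.hydroMap).eq_of_forall_eq
        (ha.isLoopMap.hasDerivAt_pairing_zero (hγ.hydroMap (g := g)) hu hβ.hydroMap).neg
        fun s => ?_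
      have hs := hu.add ((hβ.hydroMap (g := g)).smul s)
      rw [h.pairing_app hg hs (.const e) hγ, hydroMap_const, hΓ.map_zero hs, (h0 _).1, (h0 _).2,
        sub_zero, zero_sub]
      rfl
    rw [h1, h2] at hc
    linarith
  have hl := ha.gateaux.isLocalMap hu
  -- The symmetry just found holds on the image of P, that is, on derivatives; locality extends it
  -- to all loops.
  have := hl.form_eq_zero hl.neg (fun b c hb hc => by
    rw [← hydroMap_inv_mulVec hreg hb, ← hydroMap_inv_mulVec hreg hc, pairing_neg_right,
      hP _ _ (hb.mulVec _) (hc.mulVec _)]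
    ring) hv hw
  rw [pairing_neg_right] at this
  linarith

end

end Closedness

/-! ### Poincaré lemmas for closed 1-forms and 2-forms. -/

section Homotopy

variable {n : ℕ}

/-- The Poincaré lemma for a closed `1`-form `a`: the functional with density
`∫₀¹ a(λ u) · u dλ` has the variational derivative `a`. -/
theorem IsDiffVec.pairing_gateaux_potential {a : (ℝ → Fin n → ℝ) → ℝ → Fin n → ℝ}
    (ha : IsDiffVec a)
    (hcl : ∀ u v w, IsLoop u → IsLoop v → IsLoop w →
      pairing v (_root_.gateaux a u w) = pairing w (_root_.gateaux a u v))
    {u v : ℝ → Fin n → ℝ} (hu : IsLoop u) (hv : IsLoop v) :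
    ∫ x in (0 : ℝ)..1, _root_.gateaux
      (fun u x => u x ⬝ᵥ ∫ l in (0 : ℝ)..1, a (l • u) x) u v x = pairing v (a u) := by
  have hH : IsDiffVec fun u x => ∫ l in (0 : ℝ)..1, a (l • u) x := fun c =>
    (ha c).homotopy.congr fun u hu x => intervalIntegral_apply
      ((ha.isLoopMap.1.contDiff_ray hu).continuous.comp
        (by fun_prop : Continuous fun l : ℝ => (l, x))) c
  set H : (ℝ → Fin n → ℝ) → ℝ → Fin n → ℝ := fun u x => ∫ l in (0 : ℝ)..1, a (l • u) x with hHdef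
  have hd : ∀ x, _root_.gateaux (fun u x => u x ⬝ᵥ H u x) u v x =
      v x ⬝ᵥ H u x + u x ⬝ᵥ _root_.gateaux H u v x := by
    intro x
    have h1 := hasDerivAt_pi.1 (hH.isLoopMap.hasDerivAt_gateaux hu hv x)
    have h2 : ∀ i, HasDerivAt (fun s : ℝ => (u + s • v) x i) (v x i) 0 := fun i => by
      simpa using ((hasDerivAt_id (0 : ℝ)).mul_const (v x i)).const_add (u x i)
    have h3 := HasDerivAt.fun_sum fun i (_ : i ∈ Finset.univ) => (h2 i).mul (h1 i)
    refine h3.deriv.trans ?_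
    simp [dotProduct, Finset.sum_add_distrib]
  have hHl := hH.isLoop hu
  have hHg := hH.isLoopMap.isLoop_gateaux hu hv
  rw [show (∫ x in (0 : ℝ)..1, _root_.gateaux (fun u x => u x ⬝ᵥ H u x) u v x) =
    pairing v (H u) + pairing u (_root_.gateaux H u v) by
      simp only [hd, pairing]
      exact intervalIntegral.integral_add
        ((continuous_dotProduct hv.continuous hHl.continuous).intervalIntegrable _ _)
        ((continuous_dotProduct hu.continuous hHg.continuous).intervalIntegrable _ _),
    hHdef, ha.isLoopMap.pairing_homotopy hv hu, ha.isLoopMap.pairing_gateaux_homotopy hu hu hv]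
  -- Closedness exchanges `u` and `v`, after which the integrand is the λ-derivative of λ⟨v, a(λu)⟩.
  simp only [hcl _ u v (hu.smul _) hu hv]
  have hc1 := ha.isLoopMap.continuous_pairing_ray hv hu
  have hc2 : Continuous fun l : ℝ => l * pairing v (_root_.gateaux a (l • u) u) :=
    continuous_id.mul (ha.isLoopMap.continuous_pairing_gateaux_ray hv hu hu)
  rw [← intervalIntegral.integral_add (hc1.intervalIntegrable _ _) (hc2.intervalIntegrable _ _)]
  have hder : ∀ l : ℝ, HasDerivAt (fun l : ℝ => l * pairing v (a (l • u)))
      (pairing v (a (l • u)) + l * pairing v (_root_.gateaux a (l • u) u)) l := fun l => by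
    exact ((hasDerivAt_id l).mul (ha.isLoopMap.hasDerivAt_pairing_ray hv hu l)).congr_deriv
      (by simp)
  refine (intervalIntegral.integral_eq_sub_of_hasDerivAt (fun l _ => hder l)
    ((hc1.add hc2).intervalIntegrable _ _)).trans ?_
  simp

/-- The transversal field `Z` of a matrix with closed columns satisfies `Z' = -Aᵗ + ∂ R`. -/
theorem exists_isTransversalField {A : DiffMat n}
    (hcl : ∀ (e : Fin n → ℝ) u v w, IsLoop u → IsLoop v → IsLoop w →
      pairing v (gateaux (fun u x => A.eval u x *ᵥ e) u w) =
        pairing w (gateaux (fun u x => A.eval u x *ᵥ e) u v)) :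
    ∃ (Z : DiffVec n) (S : DiffOp n), IsTransversalField A Z ∧
      ∀ u φ, IsLoop u → IsLoop φ → ∀ x,
        gateaux Z.eval u φ x = -((A.eval u x)ᵀ *ᵥ φ x) + deriv (S.app u φ) x := by
  set a : Fin n → (ℝ → Fin n → ℝ) → ℝ → Fin n → ℝ := fun c u x => A.eval u x *ᵥ Pi.single c 1
  have ha : ∀ c, IsDiffVec (a c) := fun c => A.isMatDiffOp.isDiffVec_const _
  have haA : ∀ c u x b, a c u x b = (A b c).eval u x := fun c u x b => by
    simp [a, DiffMat.eval]
  have hcont : ∀ {u}, IsLoop u → ∀ c x, Continuous fun l : ℝ => a c (l • u) x := fun hu c x =>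
    ((ha c).isLoopMap.1.contDiff_ray hu).continuous.comp
      (by fun_prop : Continuous fun l : ℝ => (l, x))
  have hH : ∀ c b, IsDiffFun fun u x => (∫ l in (0 : ℝ)..1, a c (l • u) x) b := fun c b =>
    (ha c b).homotopy.congr fun u hu x => intervalIntegral_apply (hcont hu c x) b
  have hZ' : IsDiffVec fun u x c => -(u x ⬝ᵥ ∫ l in (0 : ℝ)..1, a c (l • u) x) := fun c =>
    (IsDiffFun.sum Finset.univ fun b _ => IsDiffFun.mul
      (by simpa using IsDiffFun.iteratedDeriv_apply (n := n) 0 b) (hH c b)).neg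
  obtain ⟨Z, hZ⟩ := hZ'.exists_eval
  have hZv := IsDiffVec.eval Z
  obtain ⟨M, S, hMS⟩ := hZv.gateaux.exists_left_division
  refine ⟨Z, S, fun u hu x c => ?_, fun u φ hu hφ x => ?_⟩
  · rw [hZ u hu x]
    simp only [dotProduct, neg_inj]
    rw [intervalIntegral.integral_finsetSum fun b _ => by
      simp only [← haA]
      exact ((continuous_pi_iff.1 (hcont hu c x) b).mul continuous_const).intervalIntegrable _ _]
    refine Finset.sum_congr rfl fun b _ => ?_
    rw [intervalIntegral.integral_mul_const, intervalIntegral_apply (hcont hu c x), mul_comm]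
    simp only [haA]
  · have hS := fun {φ} (hφ : IsLoop φ) => (IsMatDiffOp.app S).isLoop hu hφ
    -- Integrating the component Z^c removes ∂S, so the zeroth-order part of Z' is read off from the
    -- variational derivative of -h^c, the negative of the c-th column of A.
    have key : ∀ c, (M.eval u x)ᵀ *ᵥ Pi.single c 1 = -(A.eval u x *ᵥ Pi.single c 1) := by
      intro c
      refine eq_of_pairing_eq (v := fun x => (M.eval u x)ᵀ *ᵥ Pi.single c 1)
        (w := -fun x => A.eval u x *ᵥ Pi.single c 1)
        (M.isMatDiffOp_transpose.isLoop hu (.const _)) ((ha c).isLoop hu).neg (fun β hβ => ?_) x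
      have h1 : pairing (fun _ => Pi.single c 1) (gateaux Z.eval u β) = -pairing β (a c u) := by
        rw [← (ha c).pairing_gateaux_potential (hcl _) hu hβ, ← intervalIntegral.integral_neg,
          pairing]
        refine intervalIntegral.integral_congr fun y _ => ?_
        rw [single_one_dotProduct, hZv.gateaux_apply hu hβ]
        have : (fun s : ℝ => Z.eval (u + s • β) y c) = fun s =>
            -((u + s • β) y ⬝ᵥ ∫ l in (0 : ℝ)..1, a c (l • (u + s • β)) y) := funext fun s =>
          congrFun (hZ _ (hu.add (hβ.smul s)) y) c
        rw [gateaux, this]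
        exact deriv.fun_neg
      rw [show gateaux Z.eval u β = (fun x => M.eval u x *ᵥ β x) + deriv (S.app u β) from
        funext (hMS u β hu hβ), pairing_add_right continuous_const
        (M.isMatDiffOp.isLoop hu hβ).continuous (hS hβ).deriv.continuous,
        pairing_const_deriv _ (hS hβ), add_zero, pairing_mulVec, pairing_comm] at h1
      rw [h1, pairing_neg_right]
    have h2 : (M.eval u x)ᵀ = -A.eval u x := Matrix.ext_of_mulVec_single fun c => by
      rw [key c, Matrix.neg_mulVec]
    rw [hMS u φ hu hφ x, show M.eval u x = -(A.eval u x)ᵀ by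
      simpa using congrArg Matrix.transpose h2, Matrix.neg_mulVec]

/-- Skewness holds at every base point, so it may be differentiated in the direction `z`. -/
theorem DiffOp.IsSkew.pairing_gateaux {Ω : DiffOp n} (hΩ : Ω.IsSkew) {u v w z : ℝ → Fin n → ℝ}
    (hu : IsLoop u) (hv : IsLoop v) (hw : IsLoop w) (hz : IsLoop z) :
    pairing v (gateaux (fun u => Ω.app u w) u z) =
      -pairing w (gateaux (fun u => Ω.app u v) u z) := by
  have h := IsMatDiffOp.app Ω
  exact ((h.isLoopMap hw).hasDerivAt_pairing_zero hv hu hz).eq_of_forall_eq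
    ((h.isLoopMap hv).hasDerivAt_pairing_zero hw hu hz).neg fun s =>
      Ω.isSkew_iff.1 hΩ _ _ _ (hu.add (hz.smul s)) hv hw

/-- The homotopy formula for a closed `2`-form. -/
theorem DiffOp.IsSkew.exists_homotopyForm {Ω : DiffOp n} (hΩ : Ω.IsSkew) :
    ∃ θ : DiffVec n, (∀ u, IsLoop u → ∀ x,
        θ.eval u x = -∫ l in (0 : ℝ)..1, Ω.app (l • u) (l • u) x) ∧
      ∀ u v w, IsLoop u → IsLoop v → IsLoop w →
        (∀ u z, IsLoop u → IsLoop z → pairing v (gateaux (fun u => Ω.app u w) u z) +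
          pairing w (gateaux (fun u => Ω.app u z) u v) +
          pairing z (gateaux (fun u => Ω.app u v) u w) = 0) →
        pairing v (gateaux θ.eval u w) - pairing w (gateaux θ.eval u v) =
          -pairing v (Ω.app u w) := by
  have hop := IsMatDiffOp.app Ω
  set F : (ℝ → Fin n → ℝ) → ℝ → Fin n → ℝ := fun u => Ω.app u u
  have hF : IsDiffVec F := hop.isDiffVec_self
  have hH : IsDiffVec fun u x => ∫ l in (0 : ℝ)..1, F (l • u) x := fun c =>
    (hF c).homotopy.congr fun u hu x => intervalIntegral_apply
      ((hF.isLoopMap.1.contDiff_ray hu).continuous.comp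
        (by fun_prop : Continuous fun l : ℝ => (l, x))) c
  have hHn : IsDiffVec fun u x => -∫ l in (0 : ℝ)..1, F (l • u) x := fun c => (hH c).neg
  obtain ⟨θ, hθ⟩ := hHn.exists_eval
  refine ⟨θ, hθ, fun u v w hu hv hw hcl => ?_⟩
  have hg : ∀ {v}, IsLoop v → gateaux θ.eval u v =
      -gateaux (fun u x => ∫ l in (0 : ℝ)..1, F (l • u) x) u v := by
    intro v hv
    funext x
    refine (congrArg (fun f => deriv f 0) (funext fun s : ℝ =>
      hθ _ (hu.add (hv.smul s)) x)).trans ?_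
    exact deriv.fun_neg
  rw [hg hv, hg hw, pairing_neg_right, pairing_neg_right,
    hF.isLoopMap.pairing_gateaux_homotopy hv hu hw, hF.isLoopMap.pairing_gateaux_homotopy hw hu hv]
  have hc : ∀ {v w}, IsLoop v → IsLoop w →
      Continuous fun l : ℝ => l * pairing v (gateaux F (l • u) w) := fun hv hw =>
    continuous_id.mul (hF.isLoopMap.continuous_pairing_gateaux_ray hv hu hw)
  rw [neg_sub_neg, ← intervalIntegral.integral_sub ((hc hw hv).intervalIntegrable _ _)
    ((hc hv hw).intervalIntegrable _ _)]
  -- Cartan's formula for the radial field: closedness with third argument `u`, together with the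
  -- skewness of Ω and Ω', identifies the antisymmetrised integrand with an exact derivative. One
  -- factor l comes from the chain rule, the other from the argument λu of Ω.
  have hder : ∀ l : ℝ, HasDerivAt (fun l : ℝ => -(l ^ 2 * pairing v (Ω.app (l • u) w)))
      (l * pairing w (gateaux F (l • u) v) - l * pairing v (gateaux F (l • u) w)) l := by
    intro l
    have hl := hu.smul l
    have hexp : ∀ {v w}, IsLoop v → IsLoop w → pairing v (gateaux F (l • u) w) =
        l * pairing v (gateaux (fun r => Ω.app r u) (l • u) w) +
          pairing v (Ω.app (l • u) w) := by
      intro v w hv hw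
      have h1 : gateaux F (l • u) w = _ := hop.gateaux_self hl hw
      rw [h1, hop.gateaux_smul_argument hl hu hw, pairing_add_right hv.continuous
        (((hop.isLoopMap hu).isLoop_gateaux hl hw).smul l).continuous (hop.isLoop hl hw).continuous,
        pairing_smul_right]
    have h2 := ((hasDerivAt_pow 2 l).mul ((hop.isLoopMap hw).hasDerivAt_pairing_ray hv hu l)).neg
    refine h2.congr_deriv ?_
    have h3 := hcl (l • u) u hl hu
    have h4 := hΩ.pairing_gateaux hl hu hv hw
    have h5 := Ω.isSkew_iff.1 hΩ _ _ _ hl hw hv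
    rw [hexp hw hv, hexp hv hw]
    simp only [Nat.cast_ofNat, Nat.add_one_sub_one, pow_one]
    linear_combination (-l ^ 2) * h3 + l ^ 2 * h4 - l * h5
  rw [intervalIntegral.integral_eq_sub_of_hasDerivAt (fun l _ => hder l)
    (((hc hw hv).sub (hc hv hw)).intervalIntegrable _ _)]
  simp

end Homotopy

/-! ### Assembling X = Z + Pθ. -/

section MainTheorem

variable {n : ℕ} {g : Matrix (Fin n) (Fin n) ℝ} {Q Γ R : DiffOp n} {A : DiffMat n}
  {Z : DiffVec n}

/-- The `2`-form `Γ + R - R^*` as a differential operator. -/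
theorem DiffOp.IsSkew.exists_add_sub_adj (hΓ : Γ.IsSkew) (R : DiffOp n) :
    ∃ Ω : DiffOp n, Ω.IsSkew ∧ (∀ u φ, IsLoop u → IsLoop φ → ∀ x,
        Ω.app u φ x = Γ.app u φ x + R.app u φ x - R.adj u φ x) ∧
      ∀ u v w, IsLoop u → IsLoop v → IsLoop w → pairing v (Ω.app u w) =
        pairing v (Γ.app u w) + pairing v (R.app u w) - pairing w (R.app u v) := by
  have hΓo := IsMatDiffOp.app Γ
  have hRo := IsMatDiffOp.app R
  have hRa := R.isMatDiffOp_adj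
  obtain ⟨Ω, hΩ⟩ := ((hΓo.add hRo).add hRa.neg).exists_app
  have hpair : ∀ u v w, IsLoop u → IsLoop v → IsLoop w → pairing v (Ω.app u w) =
      pairing v (Γ.app u w) + pairing v (R.app u w) - pairing w (R.app u v) := by
    intro u v w hu hv hw
    have h1 := hΓo.isLoop hu hw
    have h2 := hRo.isLoop hu hw
    have h3 := hRa.isLoop hu hw
    rw [show Ω.app u w = (Γ.app u w + R.app u w) + -R.adj u w from hΩ u w hu hw,
      pairing_add_right hv.continuous (h1.add h2).continuous h3.neg.continuous,
      pairing_add_right hv.continuous h1.continuous h2.continuous, pairing_neg_right,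
      ← R.pairing_app hu hw hv, sub_eq_add_neg]
  refine ⟨Ω, Ω.isSkew_iff.2 fun u v w hu hv hw => ?_, fun u φ hu hφ x => ?_, hpair⟩
  · rw [hpair u v w hu hv hw, hpair u w v hu hw hv, Γ.isSkew_iff.1 hΓ u v w hu hv hw]
    ring
  · rw [hΩ u φ hu hφ, sub_eq_add_neg]

/-- `Q - L_Z(P) = P Ω P`, in terms of the pairing. -/
theorem IsRepresentation.pairing_app_eq (h : IsRepresentation (DiffOp.hydro g) Q A Γ)
    (hg : g.IsSymm) (hR : IsRemainder (DiffOp.hydro g) A Z R) {Ω : DiffOp n}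
    (hΩ : ∀ u v w, IsLoop u → IsLoop v → IsLoop w → pairing v (Ω.app u w) =
      pairing v (Γ.app u w) + pairing v (R.app u w) - pairing w (R.app u v))
    {u α β : ℝ → Fin n → ℝ} (hu : IsLoop u) (hα : IsLoop α) (hβ : IsLoop β) :
    pairing β (Q.app u α) = pairing α (gateaux Z.eval u (hydroMap g β)) -
      pairing β (gateaux Z.eval u (hydroMap g α)) -
      pairing (hydroMap g β) (Ω.app u (hydroMap g α)) := by
  -- The weak form of Z' = -Aᵗ + PR; its antisymmetrisation reproduces the A-terms of Q and the
  -- R-terms of Ω.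
  have hZ : ∀ {β w}, IsLoop β → IsLoop w → pairing β (gateaux Z.eval u w) =
      -pairing w (fun x => A.eval u x *ᵥ β x) - pairing (hydroMap g β) (R.app u w) := by
    intro β w hβ hw
    have h1 := (A.isMatDiffOp_transpose.isLoop hu hw).neg
    have h2 := (IsMatDiffOp.app R).isLoop hu hw
    have h3 : gateaux Z.eval u w =
        (-fun x => (A.eval u x)ᵀ *ᵥ w x) + hydroMap g (R.app u w) := by
      funext x
      have := hR u w hu hw x
      rw [hydro_app] at this
      exact this
    rw [h3, pairing_add_right hβ.continuous h1.continuous h2.hydroMap.continuous,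
      pairing_neg_right, pairing_hydroMap hg hβ h2, pairing_mulVec (fun x => (A.eval u x)ᵀ)]
    simp only [Matrix.transpose_transpose]
    rw [pairing_comm (fun x => A.eval u x *ᵥ β x)]
    ring
  rw [h.pairing_app hg hu hα hβ, hΩ u _ _ hu hβ.hydroMap hα.hydroMap, hZ hα hβ.hydroMap,
    hZ hβ hα.hydroMap]
  ring

/-- The `2`-form `Ω` is closed. -/
theorem IsRepresentation.cyclic_sum (h : IsRepresentation (DiffOp.hydro g) Q A Γ)
    (hg : g.IsSymm) (hreg : IsUnit g.det) (hQ : IsCocycle (DiffOp.hydro g) Q)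
    (hR : IsRemainder (DiffOp.hydro g) A Z R) {Ω : DiffOp n} (hskew : Ω.IsSkew)
    (hΩ : ∀ u v w, IsLoop u → IsLoop v → IsLoop w → pairing v (Ω.app u w) =
      pairing v (Γ.app u w) + pairing v (R.app u w) - pairing w (R.app u v))
    {u v w z : ℝ → Fin n → ℝ} (hu : IsLoop u) (hv : IsLoop v) (hw : IsLoop w) (hz : IsLoop z) :
    pairing v (gateaux (fun u => Ω.app u (hydroMap g w)) u z) +
      pairing (hydroMap g w) (gateaux (fun u => Ω.app u z) u v) +
      pairing z (gateaux (fun u => Ω.app u v) u (hydroMap g w)) = 0 := by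
  have hop := IsMatDiffOp.app Ω
  have hZ := IsDiffVec.eval Z
  have hd : ∀ {α β γ}, IsLoop α → IsLoop β → IsLoop γ →
      pairing β (gateaux (fun u => Q.app u α) u (hydroMap g γ)) =
        pairing α (gateaux (fun u => gateaux Z.eval u (hydroMap g β)) u (hydroMap g γ)) -
        pairing β (gateaux (fun u => gateaux Z.eval u (hydroMap g α)) u (hydroMap g γ)) -
        pairing (hydroMap g β) (gateaux (fun u => Ω.app u (hydroMap g α)) u (hydroMap g γ)) := by
    intro α β γ hα hβ hγ
    have hPγ := hγ.hydroMap (g := g)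
    exact (((IsMatDiffOp.app Q).isLoopMap hα).hasDerivAt_pairing_zero hβ hu hPγ).eq_of_forall_eq
      ((((hZ.gateaux.isLoopMap (hβ.hydroMap (g := g))).hasDerivAt_pairing_zero hα hu hPγ).sub
        ((hZ.gateaux.isLoopMap (hα.hydroMap (g := g))).hasDerivAt_pairing_zero hβ hu hPγ)).sub
        ((hop.isLoopMap (hα.hydroMap (g := g))).hasDerivAt_pairing_zero hβ.hydroMap hu hPγ))
      fun s => h.pairing_app_eq hg hR hΩ (hu.add (hPγ.smul s)) hα hβ
  have hP : ∀ {α β γ}, IsLoop α → IsLoop β → IsLoop γ →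
      pairing (hydroMap g α) (gateaux (fun u => Ω.app u (hydroMap g β)) u (hydroMap g γ)) +
      pairing (hydroMap g β) (gateaux (fun u => Ω.app u (hydroMap g γ)) u (hydroMap g α)) +
      pairing (hydroMap g γ) (gateaux (fun u => Ω.app u (hydroMap g α)) u (hydroMap g β)) = 0 := by
    intro α β γ hα hβ hγ
    have hc := hQ.cyclic_sum hu hα hβ hγ
    -- The second derivatives of Z cancel in pairs by symmetry, leaving the cyclic sum for Ω on the
    -- image of P.
    rw [hd hβ hα hγ, hd hγ hβ hα, hd hα hγ hβ,
      hZ.gateaux_gateaux_comm hu (hα.hydroMap (g := g)) (hγ.hydroMap (g := g)),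
      hZ.gateaux_gateaux_comm hu (hβ.hydroMap (g := g)) (hα.hydroMap (g := g)),
      hZ.gateaux_gateaux_comm hu (hγ.hydroMap (g := g)) (hβ.hydroMap (g := g))] at hc
    linarith
  have hPw := hw.hydroMap (g := g)
  have hL := hop.isLocalMap_gateaux_direction hu hPw
  have hM := (hop.isLocalMap_gateaux_argument hu hPw).sub hL
  -- With Pw held fixed, skewness of Ω' turns the cyclic sum into a local bilinear form in (v, z),
  -- so that `IsLocalMap.form_eq_zero` applies.
  have hform : ∀ {v z}, IsLoop v → IsLoop z →
      pairing v (gateaux (fun u => Ω.app u (hydroMap g w)) u z) +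
        pairing (hydroMap g w) (gateaux (fun u => Ω.app u z) u v) +
        pairing z (gateaux (fun u => Ω.app u v) u (hydroMap g w)) =
      pairing v (gateaux (fun u => Ω.app u (hydroMap g w)) u z) +
        pairing z (gateaux (fun u => Ω.app u v) u (hydroMap g w) -
          gateaux (fun u => Ω.app u (hydroMap g w)) u v) := by
    intro v z hv hz
    rw [pairing_sub_right hz.continuous ((hop.isLoopMap hv).isLoop_gateaux hu hPw).continuous
      (hL.isLoop v hv).continuous, hskew.pairing_gateaux hu hPw hz hv]
    ring
  rw [hform hv hz]
  refine hL.form_eq_zero hM (fun a b ha hb => ?_) hv hz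
  rw [← hform ha.deriv hb.deriv, ← hydroMap_inv_mulVec hreg ha, ← hydroMap_inv_mulVec hreg hb]
  exact hP (ha.mulVec _) hw (hb.mulVec _)

/-- A vector field given by a transversal field and a `1`-form. -/
theorem exists_add_hydroMap (g : Matrix (Fin n) (Fin n) ℝ) (Z θ : DiffVec n) :
    ∃ X : DiffVec n, ∀ u, IsLoop u → ∀ x, X.eval u x = Z.eval u x + hydroMap g (θ.eval u) x := by
  have hθ := IsDiffVec.eval θ
  refine IsDiffVec.exists_eval (F := fun u x => Z.eval u x + hydroMap g (θ.eval u) x) fun a => ?_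
  refine (IsDiffVec.eval Z a).add ((IsDiffFun.sum Finset.univ fun b _ =>
    (IsDiffFun.const (g a b)).mul (hθ b).deriv).congr fun u hu x => ?_)
  simp only [hydroMap, Matrix.mulVec, dotProduct]
  exact Finset.sum_congr rfl fun b _ => by rw [deriv_apply_of_isLoop (hθ.isLoop hu)]

/-- The explicit potential of a cocycle `Q = Aᵗ P + P A + P Γ P`. -/
theorem IsRepresentation.exists_potential (h : IsRepresentation (DiffOp.hydro g) Q A Γ)
    (hg : g.IsSymm) (hreg : IsUnit g.det) (hQ : IsCocycle (DiffOp.hydro g) Q) :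
    ∃ (Z : DiffVec n) (R : DiffOp n) (θ X : DiffVec n),
      IsTransversalField A Z ∧ IsRemainder (DiffOp.hydro g) A Z R ∧ IsHomotopyForm Γ R θ ∧
      (∀ u : ℝ → Fin n → ℝ, IsLoop u → ∀ x,
        DiffVec.eval X u x =
          DiffVec.eval Z u x + (DiffOp.hydro g).app u (DiffVec.eval θ u) x) ∧
      IsPotential (DiffOp.hydro g) Q X := by
  obtain ⟨Z, S, hZA, hZS⟩ := exists_isTransversalField fun e u v w hu hv hw =>
    h.closed hg hreg hQ e hu hv hw
  have hSo := IsMatDiffOp.app S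
  obtain ⟨R, hR⟩ := (IsMatDiffOp.mulVec (A := fun _ _ => g⁻¹) (fun a b => .const _)
    hSo).exists_app
  have hrem : IsRemainder (DiffOp.hydro g) A Z R := fun u φ hu hφ x => by
    rw [hydro_app, hR u φ hu hφ, hydroMap_inv_mulVec hreg (hSo.isLoop hu hφ)]
    exact hZS u φ hu hφ x
  obtain ⟨Ω, hskew, hΩΓ, hΩ⟩ := h.1.exists_add_sub_adj R
  obtain ⟨θ, hθΩ, hθ⟩ := hskew.exists_homotopyForm
  obtain ⟨X, hX⟩ := exists_add_hydroMap g Z θ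
  refine ⟨Z, R, θ, X, hZA, hrem, fun u hu x => ?_, fun u hu x => by rw [hydro_app, hX u hu], ?_⟩
  · rw [hθΩ u hu x, neg_inj]
    exact intervalIntegral.integral_congr fun l _ => hΩΓ _ _ (hu.smul l) (hu.smul l) x
  · refine isPotential_of_pairing hg fun u α β hu hα hβ => ?_
    have hZv := IsDiffVec.eval Z
    have hθv := IsDiffVec.eval θ
    have hg' : ∀ {β w}, IsLoop β → IsLoop w → pairing β (gateaux X.eval u w) =
        pairing β (gateaux Z.eval u w) - pairing (hydroMap g β) (gateaux θ.eval u w) := by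
      intro β w hβ hw
      refine ((IsDiffVec.eval X).isLoopMap.hasDerivAt_pairing_zero hβ hu hw).eq_of_forall_eq
        ((hZv.isLoopMap.hasDerivAt_pairing_zero hβ hu hw).sub
          (hθv.isLoopMap.hasDerivAt_pairing_zero (hβ.hydroMap (g := g)) hu hw)) fun s => ?_
      have hs := hu.add (hw.smul s)
      rw [show X.eval (u + s • w) = Z.eval (u + s • w) + hydroMap g (θ.eval (u + s • w)) from
        funext (hX _ hs), pairing_add_right hβ.continuous (hZv.isLoop hs).continuous
        (hθv.isLoop hs).hydroMap.continuous, pairing_hydroMap hg hβ (hθv.isLoop hs)]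
      exact (sub_eq_add_neg _ _).symm
    -- The homotopy formula is needed only on the image of P, but its third slot carries the radial
    -- direction, an arbitrary loop; this is why closedness had to be extended beyond that image.
    have h1 := hθ u (hydroMap g β) (hydroMap g α) hu hβ.hydroMap hα.hydroMap fun u z hu hz =>
      h.cyclic_sum hg hreg hQ hrem hskew hΩ hu hβ.hydroMap hα hz
    rw [h.pairing_app_eq hg hrem hΩ hu hα hβ, hg' hα hβ.hydroMap, hg' hβ hα.hydroMap]
    linarith

end MainTheorem

theorem proposition1 (n : ℕ) (g : Matrix (Fin n) (Fin n) ℝ) (hsymm : g.IsSymm)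
    (hreg : IsUnit g.det) (Q : DiffOp n) (hskew : Q.IsSkew)
    (hQ : IsCocycle (DiffOp.hydro g) Q) :
    (CasimirsCommute Q →
      (∃ X : DiffVec n, IsPotential (DiffOp.hydro g) Q X) ∧
      (∃ (A : DiffMat n) (Γ : DiffOp n), IsRepresentation (DiffOp.hydro g) Q A Γ) ∧
      ∀ (A : DiffMat n) (Γ : DiffOp n), IsRepresentation (DiffOp.hydro g) Q A Γ →
        ∃ (Z : DiffVec n) (R : DiffOp n) (θ X : DiffVec n),
          IsTransversalField A Z ∧ IsRemainder (DiffOp.hydro g) A Z R ∧ IsHomotopyForm Γ R θ ∧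
          (∀ u : ℝ → Fin n → ℝ, IsLoop u → ∀ x,
            DiffVec.eval X u x =
              DiffVec.eval Z u x + (DiffOp.hydro g).app u (DiffVec.eval θ u) x) ∧
          IsPotential (DiffOp.hydro g) Q X) ∧
    (n = 1 → CasimirsCommute Q ∧ ∃ X : DiffVec n, IsPotential (DiffOp.hydro g) Q X) := by
  have hpot : ∀ (A : DiffMat n) (Γ : DiffOp n), IsRepresentation (DiffOp.hydro g) Q A Γ → _ :=
    fun A Γ h => h.exists_potential hsymm hreg hQ
  have hex : CasimirsCommute Q → ∃ X : DiffVec n, IsPotential (DiffOp.hydro g) Q X := fun hC => by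
    obtain ⟨A, Γ, h⟩ := exists_isRepresentation hsymm hreg hskew hC
    obtain ⟨_, _, _, X, _, _, _, _, hX⟩ := hpot A Γ h
    exact ⟨X, hX⟩
  refine ⟨fun hC => ⟨hex hC, exists_isRepresentation hsymm hreg hskew hC, hpot⟩, fun hn => ?_⟩
  -- For n = 1 the two functionals coincide, and a skew bracket vanishes on equal arguments.
  have hC : CasimirsCommute Q := fun a b u hu => by
    subst hn
    rw [functionalBracket, DiffFun.euler_coord, DiffFun.euler_coord, Subsingleton.elim b a]
    have := Q.isSkew_iff.1 hskew u _ _ hu (.const (Pi.single a 1)) (.const (Pi.single a 1))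
    linarith
  exact ⟨hC, hex hC⟩
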